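/- Let $S=\mathbb Z^{d_Z}\times\mathbb R^{d_R}\subset\mathbb R^d$, $d=d_Z+d_R$, and let $h(S)$ be its $S$-Helly number, i.e. the smallest $h$ such that for all $m$ and all convex $K_1,\dots,K_m\subset\mathbb R^d$: if any $h$ of the sets $S\cap K_j$ have a common point, then $S\cap K_1,\dots,S\cap K_m$ have a common point. Let $c\in\mathbb R^d$, let $\mathbb Q$ be a measurable space with a probability measure $\Pr$, and for $i=1,\dots,n$ let $f^i:\mathbb R^d\times\mathbb Q\to\mathbb R$ be convex in $x$ and measurable in $q$, and $\mathcal F^i(q)=\{x\in S: f^i(x,q)\le 0\}$. For $m_1,\dots,m_n\in\mathbb N$ and a multi-sample $\mathbf q=(q^{(i,\ell)})_{1\le i\le n,\,1\le\ell\le m_i}$ the sampled problem is $$\min\ c^Tx\quad\text{subject to}\quad x\in\bigcap_{i=1}^n\bigcap_{\ell=1}^{m_i}\mathcal F^i(q^{(i,\ell)}),\quad x\in S .$$ Assume that, for all $m_1,\dots,m_n$ and almost every multi-sample (for the product measure), the sampled problem has exactly one minimum point whenever it contains at least $h(S)-1$ different constraints, i.e. different pairs $(i,q^{(i,\ell)})$.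 Let $\varepsilon_i,\delta_i>0$ for $i=1,\dots,n$, $\varepsilon=\sum_{i}\varepsilon_i$, $\delta=\sum_{i}\delta_i$. Let $M_i^{\mathrm{scen}}$ be the smallest natural number $M$ with $$\delta_i\ \ge\ \sum_{\ell=0}^{h(S)-2}\binom{M}{\ell}\varepsilon_i^{\ell}(1-\varepsilon_i)^{M-\ell},$$ and $M^{\mathrm{scen}}=\sum_{i}M_i^{\mathrm{scen}}$. Let $x^*=x^*(\mathbf q)$ be, for almost every $\mathbf q\in\mathbb Q^{M^{\mathrm{scen}}}$, an optimal solution of the sampled problem with $m_i=M_i^{\mathrm{scen}}$. Then $$\Pr\nolimits^{M^{\mathrm{scen}}}\Big\{\mathbf q\in\mathbb Q^{M^{\mathrm{scen}}}:\ \Pr\Big\{q\in\mathbb Q:\ x^*(\mathbf q)\notin\bigcap_{i=1}^n\mathcal F^i(q)\Big\}\le\varepsilon\Big\}\ \ge\ 1-\delta,$$ where $\Pr^{M^{\mathrm{scen}}}$ is the product probability measure on $\mathbb Q^{M^{\mathrm{scen}}}$. -/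

import Mathlib

open MeasureTheory

/-- `h` has the Helly property for the family `𝒦`: for all `m` and `K₁, …, Kₘ ∈ 𝒦`, if any `h` of
these sets have a common point then all of them have a common point. -/
def HasHellyProperty {X : Type*} (𝒦 : Set (Set X)) (h : ℕ) : Prop :=
  ∀ (m : ℕ) (K : Fin m → Set X), (∀ j, K j ∈ 𝒦) →
    (∀ i : Fin h → Fin m, (⋂ k, K (i k)).Nonempty) → (⋂ j, K j).Nonempty

/-- The Helly number of a family of sets: the smallest `h` with the Helly property, and `⊤` if
there is none. -/
noncomputable def hellyNumber {X : Type*} (𝒦 : Set (Set X)) : ℕ∞ :=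
  sInf {a : ℕ∞ | ∃ h : ℕ, a = (h : ℕ∞) ∧ HasHellyProperty 𝒦 h}

/-- The `S`-Helly number: the Helly number of the family of all `S ∩ K` with `K` convex. -/
noncomputable def sHellyNumber {E : Type*} [AddCommGroup E] [Module ℝ E] (S : Set E) : ℕ∞ :=
  hellyNumber {T : Set E | ∃ K : Set E, Convex ℝ K ∧ T = S ∩ K}

/-- The ambient space `ℝ^d`, `d = dZ + dR`, with the integer coordinates listed first. -/
abbrev MixedSpace (dZ dR : ℕ) : Type := Fin dZ ⊕ Fin dR → ℝ

/-- The set `S = ℤ^dZ × ℝ^dR`. -/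
def mixedIntegerSet (dZ dR : ℕ) : Set (MixedSpace dZ dR) :=
  {x | ∀ i : Fin dZ, ∃ k : ℤ, x (Sum.inl i) = (k : ℝ)}

/-- The Helly number `h(S)` of `S = ℤ^dZ × ℝ^dR`, as a natural number (it is finite). -/
noncomputable def mixedHelly (dZ dR : ℕ) : ℕ :=
  (sHellyNumber (mixedIntegerSet dZ dR)).toNat

/-- The constraint set `F^i(q) = {x ∈ S : f^i(x, q) ≤ 0}`. -/
def constraintSet {dZ dR n : ℕ} {Q : Type*} (f : Fin n → MixedSpace dZ dR → Q → ℝ)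
    (i : Fin n) (q : Q) : Set (MixedSpace dZ dR) :=
  {x | x ∈ mixedIntegerSet dZ dR ∧ f i x q ≤ 0}

/-- Multi-samples in which agent `i` draws `M i` samples, so `∑ i, M i` samples altogether. -/
abbrev MultiSample {n : ℕ} (M : Fin n → ℕ) (Q : Type*) : Type _ :=
  (Σ i : Fin n, Fin (M i)) → Q

/-- The product probability measure on the multi-samples. -/
noncomputable def multiSampleMeasure {n : ℕ} (M : Fin n → ℕ) {Q : Type*} [MeasurableSpace Q]
    (μ : Measure Q) : Measure (MultiSample M Q) :=
  Measure.pi fun _ => μ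

/-- The constraint set `⋂ i, ⋂ ℓ, F^i(q^(i,ℓ))` of the sampled problem. -/
def sampledConstraint {dZ dR n : ℕ} {Q : Type*} (f : Fin n → MixedSpace dZ dR → Q → ℝ)
    (M : Fin n → ℕ) (q : MultiSample M Q) : Set (MixedSpace dZ dR) :=
  ⋂ i : Fin n, ⋂ l : Fin (M i), constraintSet f i (q ⟨i, l⟩)

/-- `x` is an optimal solution of: minimize `c^T y` subject to `y ∈ F` and `y ∈ S`. -/
def IsOptimalSolution {dZ dR : ℕ} (c : MixedSpace dZ dR) (F : Set (MixedSpace dZ dR))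
    (x : MixedSpace dZ dR) : Prop :=
  x ∈ F ∩ mixedIntegerSet dZ dR ∧ ∀ y ∈ F ∩ mixedIntegerSet dZ dR, c ⬝ᵥ x ≤ c ⬝ᵥ y

/-- Almost surely, a sampled problem with at least `h(S) - 1` different constraints (pairs of an
agent and an uncertainty value) has a minimum point, and only one. -/
def UniqueMinimumPoints {dZ dR n : ℕ} {Q : Type*} [MeasurableSpace Q] (μ : Measure Q)
    (c : MixedSpace dZ dR) (f : Fin n → MixedSpace dZ dR → Q → ℝ) : Prop :=
  ∀ m : Fin n → ℕ, ∀ᵐ q ∂(multiSampleMeasure m μ),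
    mixedHelly dZ dR - 1 ≤ (Set.range fun p : (Σ i : Fin n, Fin (m i)) => (p.1, q p)).ncard →
      ∃! x, IsOptimalSolution c (sampledConstraint f m q) x

/-- The sum `∑_{ℓ = 0}^{h - 2} (M choose ℓ) ε^ℓ (1 - ε)^(M - ℓ)` (empty for `h ≤ 1`). -/
noncomputable def binomialTail (h M : ℕ) (ε : ℝ) : ℝ :=
  ∑ l ∈ Finset.range (h - 1), (M.choose l : ℝ) * ε ^ l * (1 - ε) ^ (M - l)

/-!
Write `h = d + 1` for the Helly number of `S`. It is enough to show for each agent that the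
probability of drawing samples after which its constraint is violated with probability more than
`ε` is at most the binomial tail; a union bound over the agents then gives the theorem.

**From probabilities to counting.** Let the agent draw `L` further samples besides its `M` samples.
If the violation probability exceeds `ε` by a fixed amount, then for large `L` most likely at least
`v = ⌈εL⌉` of the further samples are violated (`one_sub_le_measure_count`). As the `M + L` samples
are exchangeable, it is enough to count, for a fixed sample of size `N = M + L`, the `M`-element
subfamilies `R` whose minimum point `x R` violates at least `v` of the constraints. There are at
most `∑_{l < d} mc(v, l) mc(N - v, M - l)` of them, where `mc` counts multisets
(`card_violators_le`), and divided by `N.choose M` this tends to the binomial tail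
(`le_binomialTail_of_le_sparseCount`).

**Counting by Hilbert functions.** If `x R` were always determined by `d` of the constraints in `R`,
the count would be classical. In the integer case degenerate problems cannot be excluded, and
there is no perturbation to general position, so commutative algebra takes the place of support
sets.
All monomials of degree `M` in variables indexed by the `N` constraints are distributed according
to the minimum point belonging to their support. The supports belonging to a point `y` consist of
constraints satisfied by `y` and form an upper set, because they are characterised by the absence
of better feasible points. Hence these monomials span a squarefree monomial ideal in as
many variables as there are constraints satisfied by `y`. If that ideal is regular in degrees
`> d`, meaning that generic linear forms act injectively one after the other there, then its Hilbert
function is a nonnegative combination of the Hilbert functions `s ↦ mc(i + 1, s)`, where `i` is less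
than the number of variables (`GradedOps.Reg.exists_hilbert`). The sum over all `y` is the Hilbert
function `mc(N, M)` of the polynomial ring, whose coefficients are known. The minimum points
violating at least `v` constraints have at most `N - v` variables and so use only the
coefficients with `i < N - v`, and these add up to the bound (`sum_le_sparseCount`).

**Regularity from Helly's theorem.** The ideal of families of `S`-convex sets without common point
better than `y` is regular in degrees `> d` (`squarefreeReg_killSet`). The proof is an induction in
which the half-space of better points is cut down by further `S`-convex sets `Q l`, each provided
with a point `y l` that lies in all sets except possibly `Q l`. Each cut is a short exact
sequence of ideals (`SquarefreeReg.of_inter`); it either decreases the number of intersecting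
families or adds a set to the `Q l` while decreasing the degree by one. Once there are more than
`h` sets `Q l`, Helly's theorem leaves nothing. The samples with fewer than `d` different
constraints, for which there need not be a unique minimum point, are sorted by their set of
constraints instead, which gives equally regular ideals (`squarefreeReg_image_notMem`).

That the Helly number of `ℤ^a × ℝ^b` is finite, so that it has the Helly property, is
proved along the way: Doignon's theorem by a parity argument (`hasHellyProperty_of_parity`) and the
classical theorem of Helly in the fibres over `ℤ^a`.
-/

/-! ### Graded modules with partially regular sequences of linear operators -/

/-- A graded vector space `⨁ₑ Cₑ` with a sequence of commuting operators of degree one. -/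
structure GradedOps (k : Type) [Field k] where
  C : ℕ → Type
  [grp : ∀ e, AddCommGroup (C e)]
  [mod : ∀ e, Module k (C e)]
  op : ℕ → ∀ e, C e →ₗ[k] C (e + 1)
  comm : ∀ i j e x, op i (e + 1) (op j e x) = op j (e + 1) (op i e x)

namespace GradedOps

variable {k : Type} [Field k]

attribute [instance] GradedOps.grp GradedOps.mod

/-- The image of the first operator, as a graded subspace. -/
def im (P : GradedOps k) : ∀ e, Submodule k (P.C e)
  | 0 => ⊥
  | e + 1 => LinearMap.range (P.op 0 e)

lemma im_le_comap (P : GradedOps k) (i e : ℕ) :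
    P.im e ≤ (P.im (e + 1)).comap (P.op i e) := by
  cases e with
  | zero => exact bot_le
  | succ e =>
    rintro _ ⟨x, rfl⟩
    exact ⟨P.op i e x, P.comm _ _ _ _⟩

/-- The quotient by the image of the first operator, with the remaining operators. -/
def quot (P : GradedOps k) : GradedOps k where
  C e := P.C e ⧸ P.im e
  op i e := (P.im e).mapQ (P.im (e + 1)) (P.op (i + 1) e) (P.im_le_comap _ _)
  comm i j e x := by
    obtain ⟨x, rfl⟩ := (P.im e).mkQ_surjective x
    simp [P.comm (i + 1) (j + 1)]

/-- `Reg n D P`: the first `n` operators form a sequence which is regular in degrees `≥ D`, and the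
quotient by it vanishes in degrees `≥ D`. For an ideal of a polynomial ring and generic linear forms
this says that the Castelnuovo–Mumford regularity is less than `D` (Bayer–Stillman criterion). -/
def Reg : ℕ → ℕ → GradedOps k → Prop
  | 0, D, P => ∀ e, D ≤ e → ∀ x : P.C e, x = 0
  | n + 1, D, P => (∀ e, D ≤ e → Function.Injective (P.op 0 e)) ∧ Reg n D P.quot

lemma Reg.mono {n D D' : ℕ} (h : D ≤ D') {P : GradedOps k} (hP : Reg n D P) : Reg n D' P := by
  induction n generalizing P with
  | zero => exact fun e he => hP e (h.trans he)
  | succ n ih => exact ⟨fun e he => hP.1 e (h.trans he), ih hP.2⟩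

lemma quot_eq_zero {P : GradedOps k} {e : ℕ} (h : ∀ x : P.C e, x = 0) (x : P.quot.C e) :
    x = 0 := by
  obtain ⟨x, rfl⟩ := (P.im e).mkQ_surjective x
  rw [h x, map_zero]
  rfl

lemma reg_of_forall_eq_zero {n D : ℕ} {P : GradedOps k} (h : ∀ e, D ≤ e → ∀ x : P.C e, x = 0) :
    Reg n D P := by
  induction n generalizing P with
  | zero => exact h
  | succ n ih =>
    refine ⟨fun e he x y _ => ?_, ih fun e he x => quot_eq_zero (h e he) x⟩
    rw [h e he x, h e he y]

/-- A graded linear map commuting with the operators. -/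
structure Hom (P Q : GradedOps k) where
  f : ∀ e, P.C e →ₗ[k] Q.C e
  comm : ∀ i e x, f (e + 1) (P.op i e x) = Q.op i e (f e x)

lemma Hom.im_le_comap {P Q : GradedOps k} (φ : Hom P Q) (e : ℕ) :
    P.im e ≤ (Q.im e).comap (φ.f e) := by
  cases e with
  | zero => exact bot_le
  | succ e =>
    rintro _ ⟨x, rfl⟩
    exact ⟨φ.f e x, (φ.comm _ _ _).symm⟩

/-- The map induced on the quotients by the first operators. -/
def Hom.quot {P Q : GradedOps k} (φ : Hom P Q) : Hom P.quot Q.quot where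
  f e := (P.im e).mapQ (Q.im e) (φ.f e) (φ.im_le_comap e)
  comm i e x := by
    obtain ⟨x, rfl⟩ := (P.im e).mkQ_surjective x
    change (P.im (e + 1)).mapQ _ _ _ ((P.im (e + 1)).mkQ (P.op (i + 1) e x)) =
      (Q.im (e + 1)).mkQ (Q.op (i + 1) e (φ.f e x))
    simp [φ.comm]

/-- `A → B → C → 0` is exact, and `A → B` is injective in degrees `> D`. If `B` is regular in degrees
`> D` and `C` in degrees `≥ D`, then `A` is regular in degrees `> D`. -/
lemma Reg.of_exact {n D : ℕ} {A B C : GradedOps k} (φ : Hom A B) (ψ : Hom B C)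
    (hψ : ∀ e, Function.Surjective (ψ.f e))
    (hex : ∀ e y, ψ.f e y = 0 ↔ ∃ x, φ.f e x = y)
    (hφ : ∀ e, D + 1 ≤ e → Function.Injective (φ.f e))
    (hB : Reg n (D + 1) B) (hC : Reg n D C) : Reg n (D + 1) A := by
  induction n generalizing A B C with
  | zero =>
    intro e he x
    exact hφ e he (by rw [hB e he (φ.f e x), map_zero])
  | succ n ih =>
    refine ⟨fun e he x y hxy => hφ e he (hB.1 e he ?_), ?_⟩
    · rw [← φ.comm, ← φ.comm, hxy]
    refine ih φ.quot ψ.quot ?_ ?_ ?_ hB.2 hC.2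
    · intro e y
      obtain ⟨y, rfl⟩ := (C.im e).mkQ_surjective y
      obtain ⟨x, rfl⟩ := hψ e y
      exact ⟨(B.im e).mkQ x, rfl⟩
    · intro e y
      obtain ⟨y, rfl⟩ := (B.im e).mkQ_surjective y
      constructor
      · intro h
        have h1 : ψ.f e y ∈ C.im e := (Submodule.Quotient.mk_eq_zero _).1 h
        have h2 : ∃ y' ∈ B.im e, ψ.f e y' = ψ.f e y := by
          cases e with
          | zero => exact ⟨0, zero_mem _, by rw [map_zero]; exact (show ψ.f 0 y = 0 from h1).symm⟩
          | succ e =>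
            obtain ⟨z, hz⟩ := h1
            obtain ⟨w, rfl⟩ := hψ e z
            exact ⟨B.op 0 e w, ⟨w, rfl⟩, by rw [ψ.comm, hz]⟩
        obtain ⟨y', hy', hyy⟩ := h2
        obtain ⟨x, hx⟩ := (hex e (y - y')).1 (by rw [map_sub, hyy, sub_self])
        refine ⟨(A.im e).mkQ x, ?_⟩
        change (B.im e).mkQ (φ.f e x) = (B.im e).mkQ y
        rw [hx, map_sub, (show (B.im e).mkQ y' = 0 from (Submodule.Quotient.mk_eq_zero _).2 hy'),
          sub_zero]
      · rintro ⟨x, hx⟩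
        obtain ⟨x, rfl⟩ := (A.im e).mkQ_surjective x
        have h1 : (B.im e).mkQ (φ.f e x) = (B.im e).mkQ y := hx
        rw [← h1]
        change (C.im e).mkQ (ψ.f e (φ.f e x)) = 0
        rw [(hex e _).2 ⟨x, rfl⟩, map_zero]
    · intro e he
      rw [injective_iff_map_eq_zero]
      intro x hx
      obtain ⟨x, rfl⟩ := (A.im e).mkQ_surjective x
      have h1 : φ.f e x ∈ B.im e := (Submodule.Quotient.mk_eq_zero _).1 hx
      refine (Submodule.Quotient.mk_eq_zero _).2 ?_
      cases e with
      | zero => omega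
      | succ e =>
        obtain ⟨y, hy⟩ := h1
        -- the operator is injective on `C` already in degree `e = D`
        have h2 : ψ.f e y = 0 := by
          apply hC.1 e (by omega)
          rw [← ψ.comm, hy, map_zero, (hex _ _).2 ⟨x, rfl⟩]
        obtain ⟨z, rfl⟩ := (hex e y).1 h2
        exact ⟨z, hφ _ he (by rw [φ.comm, hy])⟩

lemma Reg.of_iso {n D : ℕ} {A B : GradedOps k} (φ : Hom A B)
    (hφ : ∀ e, Function.Bijective (φ.f e)) (hB : Reg n D B) : Reg n D A := by
  induction n generalizing A B with
  | zero => exact fun e he x => (hφ e).1 (by rw [hB e he (φ.f e x), map_zero])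
  | succ n ih =>
    refine ⟨fun e he x y hxy => (hφ e).1 (hB.1 e he ?_), ?_⟩
    · rw [← φ.comm, ← φ.comm, hxy]
    refine ih φ.quot (fun e => ⟨?_, ?_⟩) hB.2
    · rw [injective_iff_map_eq_zero]
      intro x hx
      obtain ⟨x, rfl⟩ := (A.im e).mkQ_surjective x
      have h1 : φ.f e x ∈ B.im e := (Submodule.Quotient.mk_eq_zero _).1 hx
      refine (Submodule.Quotient.mk_eq_zero _).2 ?_
      cases e with
      | zero => exact (hφ 0).1 (by rw [map_zero]; exact h1)
      | succ e =>
        obtain ⟨y, hy⟩ := h1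
        obtain ⟨z, rfl⟩ := (hφ e).2 y
        exact ⟨z, (hφ _).1 (by rw [φ.comm, hy])⟩
    · intro y
      obtain ⟨y, rfl⟩ := (B.im e).mkQ_surjective y
      obtain ⟨x, rfl⟩ := (hφ e).2 y
      exact ⟨(A.im e).mkQ x, rfl⟩

open Module in
/-- The Hilbert function of a module which is regular in degrees `> d` is a combination with
nonnegative coefficients of Hilbert functions of polynomial rings in at most `n` variables,
generated in degree `d`. -/
lemma Reg.exists_hilbert {n d : ℕ} {P : GradedOps k} [hfin : ∀ e, FiniteDimensional k (P.C e)]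
    (hP : Reg n (d + 1) P) :
    ∃ b : ℕ → ℕ, ∑ i ∈ Finset.range n, b i ≤ finrank k (LinearMap.range (P.op 0 d)) ∧
      ∀ t, finrank k (P.C (d + 1 + t)) =
        ∑ i ∈ Finset.range n, b i * (t + 1 + i).choose i := by
  induction n generalizing P with
  | zero =>
    refine ⟨0, by simp, fun t => ?_⟩
    have : Subsingleton (P.C (d + 1 + t)) := subsingleton_of_forall_eq 0 (hP _ (by omega))
    simp [finrank_zero_of_subsingleton]
  | succ n ih =>
    have : ∀ e, FiniteDimensional k (P.quot.C e) := fun e =>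
      inferInstanceAs (FiniteDimensional k (P.C e ⧸ P.im e))
    obtain ⟨b, hb, hH⟩ := ih hP.2
    have hquot : ∀ e, finrank k (P.quot.C (e + 1)) + finrank k (LinearMap.range (P.op 0 e)) =
        finrank k (P.C (e + 1)) := fun e =>
      Submodule.finrank_quotient_add_finrank (LinearMap.range (P.op 0 e))
    have hinj : ∀ e, d + 1 ≤ e → finrank k (LinearMap.range (P.op 0 e)) = finrank k (P.C e) :=
      fun e he => LinearMap.finrank_range_of_inj (hP.1 e he)
    -- an element of degree `d` killed by the first operator is killed by all of them
    have hker : LinearMap.ker (P.op 0 d) ≤ LinearMap.ker (P.op 1 d) := by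
      intro x hx
      rw [LinearMap.mem_ker] at hx ⊢
      apply hP.1 (d + 1) le_rfl
      rw [P.comm, hx, map_zero, map_zero]
    have hrk : finrank k (LinearMap.range (P.quot.op 0 d)) ≤
        finrank k (LinearMap.range (P.op 0 d)) := by
      let π : P.C (d + 1) →ₗ[k] P.quot.C (d + 1) := (P.im (d + 1)).mkQ
      have h1 : LinearMap.range (P.quot.op 0 d) = (LinearMap.range (P.op 1 d)).map π := by
        ext y
        constructor
        · rintro ⟨x, rfl⟩
          obtain ⟨x, rfl⟩ := (P.im d).mkQ_surjective x
          exact ⟨P.op 1 d x, ⟨x, rfl⟩, rfl⟩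
        · rintro ⟨_, ⟨x, rfl⟩, rfl⟩
          exact ⟨(P.im d).mkQ x, rfl⟩
      have h2 : finrank k (LinearMap.range (P.quot.op 0 d)) ≤
          finrank k (LinearMap.range (P.op 1 d)) := by
        rw [h1]; exact Submodule.finrank_map_le _ _
      have h3 := LinearMap.finrank_range_add_finrank_ker (P.op 0 d)
      have h4 := LinearMap.finrank_range_add_finrank_ker (P.op 1 d)
      have h5 := Submodule.finrank_mono hker
      omega
    refine ⟨fun i => if i = 0 then finrank k (LinearMap.range (P.op 0 d)) -
      ∑ i ∈ Finset.range n, b i else b (i - 1), ?_, ?_⟩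
    · rw [Finset.sum_range_succ']
      simp only [Nat.add_eq_zero_iff, one_ne_zero, and_false, if_false, if_true,
        Nat.add_sub_cancel]
      omega
    · intro t
      rw [Finset.sum_range_succ']
      simp only [Nat.add_eq_zero_iff, one_ne_zero, and_false, if_false, if_true,
        Nat.add_sub_cancel, Nat.choose_zero_right, mul_one]
      induction t with
      | zero =>
        have h1 := hquot d
        have h2 := hH 0
        rw [add_zero] at h2 ⊢
        rw [h2] at h1
        have h3 : ∑ i ∈ Finset.range n, b i * (0 + 1 + (i + 1)).choose (i + 1) =
            ∑ i ∈ Finset.range n, b i * (0 + 1 + i).choose i + ∑ i ∈ Finset.range n, b i := by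
          rw [← Finset.sum_add_distrib]
          refine Finset.sum_congr rfl fun i _ => ?_
          rw [show 0 + 1 + (i + 1) = (0 + 1 + i) + 1 by ring, Nat.choose_succ_succ',
            show 0 + 1 + i = i + 1 by ring, Nat.choose_self]
          ring
        simp only [zero_add] at h1 h3 ⊢
        omega
      | succ t iht =>
        have h1 := hquot (d + 1 + t)
        rw [hinj _ (by omega), iht] at h1
        have h2 := hH (t + 1)
        rw [show d + 1 + (t + 1) = d + 1 + t + 1 by ring] at h2 ⊢
        rw [h2] at h1
        rw [← h1, ← add_assoc, ← Finset.sum_add_distrib]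
        congr 1
        refine Finset.sum_congr rfl fun i _ => ?_
        rw [show t + 1 + 1 + (i + 1) = (t + 1 + 1 + i) + 1 by ring, Nat.choose_succ_succ',
          show t + 1 + 1 + i = t + 1 + (i + 1) by ring]
        ring

end GradedOps

/-! ### Squarefree modules over a polynomial ring -/

section SquarefreeModules

open MvPolynomial

variable {α : Type}

/-- The exponent vectors of degree `e` whose support is contained in `W` and belongs to `U`. -/
def suppMonomials (W : Finset α) (U : Set (Finset α)) (e : ℕ) : Set (α →₀ ℕ) :=
  {m | m.degree = e ∧ m.support ⊆ W ∧ m.support ∈ U}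

/-- The linear form `∑_{j ∈ W} a_{ij} X_j`. -/
noncomputable def linForm (a : ℕ → α → ℚ) (W : Finset α) (i : ℕ) : MvPolynomial α ℚ :=
  ∑ j ∈ W, C (a i j) * X j

lemma X_mul_mem_restrictSupport {W : Finset α} {U : Set (Finset α)} (hU : IsUpperSet U) {e : ℕ}
    {j : α} (hj : j ∈ W) {p : MvPolynomial α ℚ}
    (hp : p ∈ restrictSupport ℚ (suppMonomials W U e)) :
    X j * p ∈ restrictSupport ℚ (suppMonomials W U (e + 1)) := by
  classical
  rw [mem_restrictSupport_iff] at hp ⊢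
  rw [support_X_mul]
  intro m hm
  rw [Finset.mem_coe, Finset.mem_map] at hm
  obtain ⟨m, hm, rfl⟩ := hm
  obtain ⟨h1, h2, h3⟩ := hp hm
  have hs : (Finsupp.single j 1 + m).support = insert j m.support := by
    ext l
    by_cases h : l = j
    · subst h; simp
    · simp [h]
  refine ⟨?_, ?_, ?_⟩
  · simp [h1, add_comm]
  · change (Finsupp.single j 1 + m).support ⊆ W
    rw [hs]
    exact Finset.insert_subset hj h2
  · change (Finsupp.single j 1 + m).support ∈ U
    rw [hs]
    exact hU (Finset.subset_insert _ _) h3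

lemma linForm_mul_mem_restrictSupport {W : Finset α} {U : Set (Finset α)} (hU : IsUpperSet U)
    {e : ℕ} (a : ℕ → α → ℚ) (i : ℕ) {p : MvPolynomial α ℚ}
    (hp : p ∈ restrictSupport ℚ (suppMonomials W U e)) :
    linForm a W i * p ∈ restrictSupport ℚ (suppMonomials W U (e + 1)) := by
  rw [linForm, Finset.sum_mul]
  refine Submodule.sum_mem _ fun j hj => ?_
  rw [mul_assoc, ← smul_eq_C_mul]
  exact Submodule.smul_mem _ _ (X_mul_mem_restrictSupport hU hj hp)

/-- The span of the monomials in the variables of `W` whose support belongs to the upper set `U`: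
a squarefree monomial ideal of `ℚ[X_j : j ∈ W]`, with multiplication by linear forms. -/
noncomputable def squarefreeModule (a : ℕ → α → ℚ) (W : Finset α) (U : Set (Finset α))
    (hU : IsUpperSet U) : GradedOps ℚ where
  C e := restrictSupport ℚ (suppMonomials W U e)
  op i e := (LinearMap.mulLeft ℚ (linForm a W i)).restrict
    fun _ hp => linForm_mul_mem_restrictSupport hU a i hp
  comm i j e x := by
    ext1
    change linForm a W i * (linForm a W j * x.1) = linForm a W j * (linForm a W i * x.1)
    ring

/-- Regularity of a squarefree monomial ideal with respect to the linear forms given by `a`. -/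
def SquarefreeReg (a : ℕ → α → ℚ) (n D : ℕ) (W : Finset α) (U : Set (Finset α)) : Prop :=
  ∀ hU : IsUpperSet U, GradedOps.Reg n D (squarefreeModule a W U hU)

lemma SquarefreeReg.mono {a : ℕ → α → ℚ} {n D D' : ℕ} {W : Finset α} {U : Set (Finset α)}
    (h : SquarefreeReg a n D W U) (hD : D ≤ D') : SquarefreeReg a n D' W U :=
  fun hU => (h hU).mono hD

lemma suppMonomials_congr {W : Finset α} {U U' : Set (Finset α)}
    (h : ∀ R ⊆ W, R ∈ U ↔ R ∈ U') (e : ℕ) : suppMonomials W U e = suppMonomials W U' e := by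
  ext m
  exact and_congr_right fun _ => and_congr_right fun hm => h _ hm

lemma SquarefreeReg.congr {a : ℕ → α → ℚ} {n D : ℕ} {W : Finset α} {U U' : Set (Finset α)}
    (h : SquarefreeReg a n D W U) (hU : IsUpperSet U) (hUU' : ∀ R ⊆ W, R ∈ U ↔ R ∈ U') :
    SquarefreeReg a n D W U' := by
  intro hU'
  have hC : ∀ e, restrictSupport ℚ (suppMonomials W U' e) =
      restrictSupport ℚ (suppMonomials W U e) := fun e => by rw [suppMonomials_congr hUU']
  let φ : GradedOps.Hom (squarefreeModule a W U' hU') (squarefreeModule a W U hU) :=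
    { f := fun e => Submodule.inclusion (hC e).le
      comm := fun i e x => rfl }
  refine GradedOps.Reg.of_iso φ (fun e => ⟨Submodule.inclusion_injective (hC e).le, ?_⟩) (h hU)
  rintro ⟨x, hx⟩
  exact ⟨⟨x, (hC e).ge hx⟩, rfl⟩

lemma squarefreeReg_of_eq_empty (a : ℕ → α → ℚ) (n D : ℕ) {W : Finset α} {U : Set (Finset α)}
    (h : ∀ R ⊆ W, R ∉ U) : SquarefreeReg a n D W U := by
  intro hU
  refine GradedOps.reg_of_forall_eq_zero ?_
  rintro e - ⟨x, hx⟩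
  rw [mem_restrictSupport_iff] at hx
  refine Subtype.ext (support_eq_empty.1 (Finset.eq_empty_of_forall_notMem fun m hm => ?_))
  exact h _ (hx hm).2.1 (hx hm).2.2

lemma finite_suppMonomials [Finite α] (W : Finset α) (U : Set (Finset α)) (e : ℕ) :
    (suppMonomials W U e).Finite :=
  (Finsupp.finite_of_degree_eq e).subset fun _ hm => hm.1

lemma finrank_squarefreeModule [Finite α] (a : ℕ → α → ℚ) (W : Finset α) (U : Set (Finset α))
    (hU : IsUpperSet U) (e : ℕ) :
    Module.finrank ℚ ((squarefreeModule a W U hU).C e) = (suppMonomials W U e).ncard :=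
  (Module.finrank_eq_nat_card_basis (basisRestrictSupport ℚ (suppMonomials W U e))).trans
    (Nat.card_coe_set_eq _)

instance [Finite α] (a : ℕ → α → ℚ) (W : Finset α) (U : Set (Finset α)) (hU : IsUpperSet U)
    (e : ℕ) : FiniteDimensional ℚ ((squarefreeModule a W U hU).C e) := by
  have := (finite_suppMonomials W U e).to_subtype
  exact (basisRestrictSupport ℚ (suppMonomials W U e)).finiteDimensional_of_finite

/-- The first `|W|` linear forms in the variables of `W` are linearly independent. -/
def NondegenerateForms (a : ℕ → α → ℚ) (W : Finset α) : Prop :=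
  ∀ c : α → ℚ, (∀ i < W.card, ∑ j ∈ W, a i j * c j = 0) → ∀ j ∈ W, c j = 0

/-- Vandermonde: the forms `∑ⱼ tⱼ^i X_j` with distinct `tⱼ` are independent. -/
lemma nondegenerateForms_pow {t : α → ℚ} (ht : Function.Injective t) (W : Finset α) :
    NondegenerateForms (fun i j => t j ^ i) W := by
  intro c hc j hj
  let e := W.equivFin
  have h1 : (fun i => c (e.symm i)) = 0 := by
    apply Matrix.eq_zero_of_forall_pow_sum_mul_pow_eq_zero (f := fun i => t (e.symm i))
    · intro x y hxy
      exact e.symm.injective (Subtype.ext (ht hxy))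
    · intro i
      have h2 := hc i i.2
      rw [← Finset.sum_coe_sort, ← e.symm.sum_comp] at h2
      rw [← h2]
      exact Finset.sum_congr rfl fun _ _ => mul_comm _ _
  simpa using congrFun h1 (e ⟨j, hj⟩)

/-- Induction on the degree for homogeneous polynomials in the variables of `W`. -/
lemma restrictSupport_univ_le {W : Finset α} (N : ℕ → Submodule ℚ (MvPolynomial α ℚ))
    (h0 : 1 ∈ N 0)
    (hN : ∀ e, ∀ j ∈ W, ∀ p ∈ restrictSupport ℚ (suppMonomials W Set.univ e), p ∈ N e →
      X j * p ∈ N (e + 1)) (e : ℕ) :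
    restrictSupport ℚ (suppMonomials W Set.univ e) ≤ N e := by
  rw [restrictSupport_eq_span, Submodule.span_le]
  rintro _ ⟨m, hm, rfl⟩
  change monomial m 1 ∈ N e
  induction e generalizing m with
  | zero =>
    have : m = 0 := by
      have h1 := hm.1
      rwa [Finsupp.degree_eq_zero_iff] at h1
    subst this
    exact h0
  | succ e ih =>
    obtain ⟨h1, h2, -⟩ := hm
    have hne : m.support.Nonempty := by
      rw [Finsupp.support_nonempty_iff]
      rintro rfl
      simp at h1
    obtain ⟨j, hj⟩ := hne
    have hsplit : m = Finsupp.single j 1 + (m - Finsupp.single j 1) := by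
      rw [add_comm, tsub_add_cancel_of_le]
      rw [Finsupp.single_le_iff]
      exact Nat.one_le_iff_ne_zero.2 (Finsupp.mem_support_iff.1 hj)
    have hmem : m - Finsupp.single j 1 ∈ suppMonomials W Set.univ e := by
      refine ⟨?_, (Finsupp.support_mono tsub_le_self).trans h2, Set.mem_univ _⟩
      have h3 : Finsupp.degree (Finsupp.single j 1 + (m - Finsupp.single j 1)) = e + 1 := by
        rw [← hsplit]; exact h1
      rw [map_add, Finsupp.degree_single] at h3
      omega
    rw [hsplit, show (monomial (Finsupp.single j 1 + (m - Finsupp.single j 1)) (1 : ℚ)) =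
      X j * monomial (m - Finsupp.single j 1) 1 by rw [X, monomial_mul, one_mul]]
    exact hN e j (h2 hj) _ ((monomial_mem_restrictSupport ℚ).2 (Or.inl hmem)) (ih _ hmem)

variable [DecidableEq α]

/-- The algebra map sending the variables of `Z` to zero. -/
noncomputable def killVars (Z : Finset α) : MvPolynomial α ℚ →ₐ[ℚ] MvPolynomial α ℚ :=
  aeval fun j => if j ∈ Z then 0 else X j

lemma killVars_monomial (Z : Finset α) (m : α →₀ ℕ) (r : ℚ) :
    killVars Z (monomial m r) = if Disjoint m.support Z then monomial m r else 0 := by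
  rw [killVars, aeval_monomial]
  split_ifs with h
  · rw [monomial_eq]
    refine congrArg _ (Finset.prod_congr rfl fun j hj => ?_)
    change (if j ∈ Z then (0 : MvPolynomial α ℚ) else X j) ^ m j = X j ^ m j
    rw [if_neg (Finset.disjoint_left.1 h hj)]
  · obtain ⟨j, hj, hjZ⟩ := Finset.not_disjoint_iff.1 h
    rw [Finsupp.prod, Finset.prod_eq_zero hj, mul_zero]
    change (if j ∈ Z then (0 : MvPolynomial α ℚ) else X j) ^ m j = _
    rw [if_pos hjZ, zero_pow (Finsupp.mem_support_iff.1 hj)]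

lemma coeff_killVars (Z : Finset α) (m : α →₀ ℕ) (p : MvPolynomial α ℚ) :
    coeff m (killVars Z p) = if Disjoint m.support Z then coeff m p else 0 := by
  induction p using MvPolynomial.induction_on' with
  | monomial u r =>
    rw [killVars_monomial]
    by_cases h : u = m
    · subst h; split_ifs <;> simp
    · split_ifs <;> simp [coeff_monomial, h]
  | add p q hp hq => rw [map_add, coeff_add, hp, hq]; split_ifs <;> simp

lemma killVars_linForm (a : ℕ → α → ℚ) (W Z : Finset α) (i : ℕ) :
    killVars Z (linForm a W i) = linForm a (W \ Z) i := by
  rw [linForm, linForm, map_sum, ← Finset.sum_sdiff (Finset.sdiff_subset (s := W) (t := Z))]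
  rw [Finset.sum_eq_zero (s := W \ (W \ Z)), zero_add]
  · refine Finset.sum_congr rfl fun j hj => ?_
    simp [killVars, (Finset.mem_sdiff.1 hj).2]
  · intro j hj
    have : j ∈ Z := by
      simp only [Finset.mem_sdiff, not_and, not_not] at hj
      exact hj.2 hj.1
    simp [killVars, this]

/-- Deletion and contraction: requiring in addition that a set of variables be met raises the
regularity at most to one more than that of the module in the remaining variables. -/
lemma SquarefreeReg.of_inter {a : ℕ → α → ℚ} {n D : ℕ} {W Z : Finset α} {U : Set (Finset α)}
    (hU : IsUpperSet U) (hB : SquarefreeReg a n (D + 1) W U) (hC : SquarefreeReg a n D (W \ Z) U) :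
    SquarefreeReg a n (D + 1) W {R | R ∈ U ∧ ¬ Disjoint R Z} := by
  intro hU'
  have hsub : ∀ e, restrictSupport ℚ (suppMonomials W {R | R ∈ U ∧ ¬ Disjoint R Z} e) ≤
      restrictSupport ℚ (suppMonomials W U e) := fun e =>
    restrictSupport_mono _ fun m hm => ⟨hm.1, hm.2.1, hm.2.2.1⟩
  have hkill : ∀ e, ∀ p ∈ restrictSupport ℚ (suppMonomials W U e),
      killVars Z p ∈ restrictSupport ℚ (suppMonomials (W \ Z) U e) := by
    intro e p hp
    rw [mem_restrictSupport_iff] at hp ⊢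
    intro m hm
    rw [Finset.mem_coe, mem_support_iff, coeff_killVars] at hm
    by_cases hd : Disjoint m.support Z
    · rw [if_pos hd] at hm
      obtain ⟨h1, h2, h3⟩ := hp (mem_support_iff.2 hm)
      exact ⟨h1, Finset.subset_sdiff.2 ⟨h2, hd⟩, h3⟩
    · exact absurd (if_neg hd) hm
  let φ : GradedOps.Hom (squarefreeModule a W _ hU') (squarefreeModule a W U hU) :=
    { f := fun e => Submodule.inclusion (hsub e)
      comm := fun i e x => rfl }
  let ψ : GradedOps.Hom (squarefreeModule a W U hU) (squarefreeModule a (W \ Z) U hU) :=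
    { f := fun e => (killVars Z).toLinearMap.restrict (hkill e)
      comm := fun i e x => by
        refine Subtype.ext ?_
        change killVars Z (linForm a W i * x.1) = linForm a (W \ Z) i * killVars Z x.1
        rw [map_mul, killVars_linForm] }
  refine GradedOps.Reg.of_exact φ ψ ?_ ?_ (fun e _ => Submodule.inclusion_injective (hsub e))
    (hB hU) (hC hU)
  · rintro e ⟨p, hp⟩
    rw [mem_restrictSupport_iff] at hp
    refine ⟨⟨p, ?_⟩, Subtype.ext ?_⟩
    · rw [mem_restrictSupport_iff]
      exact fun m hm => ⟨(hp hm).1, (hp hm).2.1.trans Finset.sdiff_subset, (hp hm).2.2⟩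
    · change killVars Z p = p
      ext m
      rw [coeff_killVars]
      split_ifs with h
      · rfl
      · by_contra hm
        exact h (Finset.subset_sdiff.1 (hp (mem_support_iff.2 (Ne.symm hm))).2.1).2
  · rintro e ⟨p, hp⟩
    constructor
    · intro h
      have h0 : killVars Z p = 0 := congrArg Subtype.val h
      rw [mem_restrictSupport_iff] at hp
      refine ⟨⟨p, ?_⟩, rfl⟩
      rw [mem_restrictSupport_iff]
      refine fun m hm => ⟨(hp hm).1, (hp hm).2.1, (hp hm).2.2, fun hd => ?_⟩
      have := coeff_killVars Z m p
      rw [h0, if_pos hd, coeff_zero] at this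
      exact mem_support_iff.1 hm this.symm
    · rintro ⟨⟨q, hq⟩, h⟩
      have hqp : q = p := congrArg Subtype.val h
      subst hqp
      refine Subtype.ext ?_
      change killVars Z q = 0
      ext m
      rw [coeff_killVars, coeff_zero]
      split_ifs with hd
      · by_contra hm
        rw [mem_restrictSupport_iff] at hq
        exact (hq (mem_support_iff.2 hm)).2.2.2 hd
      · rfl

/-! ### Polynomial rings -/

lemma NondegenerateForms.exists_ne_zero {a : ℕ → α → ℚ} {W : Finset α}
    (h : NondegenerateForms a W) (hW : W.Nonempty) : ∃ j ∈ W, a 0 j ≠ 0 := by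
  by_contra! h0
  -- otherwise there are `|W| - 1` equations in `|W|` unknowns
  let T : (W → ℚ) →ₗ[ℚ] (Fin (W.card - 1) → ℚ) :=
    LinearMap.pi fun i => ∑ j : W, a (i + 1) j • LinearMap.proj j
  have hT : Function.Injective T := by
    rw [injective_iff_map_eq_zero]
    intro c hc
    have := h (fun j => if hj : j ∈ W then c ⟨j, hj⟩ else 0) ?_
    · ext ⟨j, hj⟩
      simpa [hj] using this j hj
    · intro i hi
      cases i with
      | zero => exact Finset.sum_eq_zero fun j hj => by rw [h0 j hj, zero_mul]
      | succ i =>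
        have h1 := congrFun hc ⟨i, by omega⟩
        rw [← Finset.sum_coe_sort]
        simpa [T] using h1
  have := LinearMap.finrank_le_finrank_of_injective hT
  simp at this
  have := hW.card_pos
  omega

lemma linForm_ne_zero {a : ℕ → α → ℚ} {W : Finset α} {i : ℕ} {j : α} (hj : j ∈ W)
    (h : a i j ≠ 0) : linForm a W i ≠ 0 := by
  intro h0
  apply h
  have := congrArg (coeff (Finsupp.single j 1)) h0
  rw [linForm, coeff_sum, coeff_zero, Finset.sum_eq_single j] at this
  · simpa using this
  · intro l _ hl
    rw [coeff_C_mul, coeff_X, if_neg, mul_zero]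
    rw [Finsupp.single_eq_single_iff]
    simp [hl]
  · exact fun h => absurd hj h

/-- A polynomial ring, with independent linear forms, is regular in positive degrees. -/
theorem squarefreeReg_univ {n : ℕ} {a : ℕ → α → ℚ} {W : Finset α} (hn : W.card ≤ n)
    (ha : NondegenerateForms a W) : SquarefreeReg a n 1 W Set.univ := by
  intro hU
  induction n generalizing a W with
  | zero =>
    rintro e he ⟨p, hp⟩
    rw [mem_restrictSupport_iff] at hp
    refine Subtype.ext (support_eq_empty.1 (Finset.eq_empty_of_forall_notMem fun m hm => ?_))
    obtain ⟨h1, h2, -⟩ := hp hm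
    rw [Finset.card_eq_zero.1 (Nat.le_zero.1 hn), Finset.subset_empty, Finsupp.support_eq_empty]
      at h2
    subst h2
    rw [map_zero] at h1
    omega
  | succ n ih =>
    obtain rfl | hW := W.eq_empty_or_nonempty
    · refine GradedOps.reg_of_forall_eq_zero ?_
      rintro e he ⟨p, hp⟩
      rw [mem_restrictSupport_iff] at hp
      refine Subtype.ext (support_eq_empty.1 (Finset.eq_empty_of_forall_notMem fun m hm => ?_))
      obtain ⟨h1, h2, -⟩ := hp hm
      rw [Finset.subset_empty, Finsupp.support_eq_empty] at h2
      subst h2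
      rw [map_zero] at h1
      omega
    obtain ⟨j, hj, hj0⟩ := ha.exists_ne_zero hW
    have hcard : (W.erase j).card + 1 = W.card := Finset.card_erase_add_one hj
    let a' : ℕ → α → ℚ := fun i l => a (i + 1) l - a (i + 1) j * (a 0 l / a 0 j)
    have ha' : NondegenerateForms a' (W.erase j) := by
      intro c hc
      let c' : α → ℚ := fun l => if l = j then -∑ l ∈ W.erase j, a 0 l / a 0 j * c l else c l
      have hc'j : c' j = -∑ l ∈ W.erase j, a 0 l / a 0 j * c l := if_pos rfl
      have hsum : ∀ i, ∑ l ∈ W.erase j, a i l * c' l = ∑ l ∈ W.erase j, a i l * c l := fun i =>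
        Finset.sum_congr rfl fun l hl => by
          rw [show c' l = c l from if_neg (Finset.ne_of_mem_erase hl)]
      have := ha c' ?_
      · intro l hl
        have h1 := this l (Finset.mem_of_mem_erase hl)
        rwa [show c' l = c l from if_neg (Finset.ne_of_mem_erase hl)] at h1
      · intro i hi
        rw [← Finset.add_sum_erase _ _ hj, hsum, hc'j]
        cases i with
        | zero =>
          rw [mul_neg, Finset.mul_sum, neg_add_eq_zero]
          exact Finset.sum_congr rfl fun l _ => by field_simp
        | succ i =>
          have h1 := hc i (by omega)
          rw [← h1, mul_neg, Finset.mul_sum, neg_add_eq_sub, ← Finset.sum_sub_distrib]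
          exact Finset.sum_congr rfl fun l _ => by simp only [a']; ring
    refine ⟨?_, ?_⟩
    · intro e _ x y hxy
      exact Subtype.ext (mul_left_cancel₀ (linForm_ne_zero (i := 0) hj hj0)
        (congrArg Subtype.val hxy))
    -- eliminate the variable `X_j` by means of the first linear form
    let σ : MvPolynomial α ℚ →ₐ[ℚ] MvPolynomial α ℚ := aeval fun l =>
      if l = j then -∑ l ∈ W.erase j, C (a 0 l / a 0 j) * X l else X l
    have hσj : σ (X j) = -∑ l ∈ W.erase j, C (a 0 l / a 0 j) * X l := by
      simp [σ]
    have hσl : ∀ l, l ≠ j → σ (X l) = X l := fun l hl => by simp [σ, hl]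
    have hσC : ∀ r, σ (C r) = C r := fun r => σ.commutes r
    have hlin : ∀ i, σ (linForm a W i) = C (a i j) * σ (X j) +
        ∑ l ∈ W.erase j, C (a i l) * X l := by
      intro i
      rw [linForm, map_sum, ← Finset.add_sum_erase _ _ hj, map_mul, hσC]
      congr 1
      refine Finset.sum_congr rfl fun l hl => ?_
      rw [map_mul, hσC, hσl l (Finset.ne_of_mem_erase hl)]
    have hlin0 : σ (linForm a W 0) = 0 := by
      rw [hlin, hσj, mul_neg, Finset.mul_sum, neg_add_eq_zero]
      refine Finset.sum_congr rfl fun l _ => ?_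
      rw [← mul_assoc, ← C_mul, mul_div_cancel₀ _ hj0]
    have hlin1 : ∀ i, σ (linForm a W (i + 1)) = linForm a' (W.erase j) i := by
      intro i
      rw [hlin, hσj, mul_neg, Finset.mul_sum, neg_add_eq_sub, ← Finset.sum_sub_distrib, linForm]
      refine Finset.sum_congr rfl fun l _ => ?_
      rw [← mul_assoc, ← C_mul, ← sub_mul, ← C_sub]
    have hσmem : ∀ e, restrictSupport ℚ (suppMonomials W Set.univ e) ≤
        (restrictSupport ℚ (suppMonomials (W.erase j) Set.univ e)).comap σ.toLinearMap := by
      apply restrictSupport_univ_le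
      · change σ 1 ∈ restrictSupport ℚ (suppMonomials (W.erase j) Set.univ 0)
        rw [map_one, show (1 : MvPolynomial α ℚ) = monomial 0 1 from rfl,
          monomial_mem_restrictSupport]
        exact Or.inl ⟨by simp, by simp, Set.mem_univ _⟩
      · intro e l hl p _ hp
        change σ (X l * p) ∈ restrictSupport ℚ (suppMonomials (W.erase j) Set.univ (e + 1))
        rw [map_mul]
        by_cases hlj : l = j
        · rw [hlj, hσj, neg_mul, Finset.sum_mul]
          refine Submodule.neg_mem _ (Submodule.sum_mem _ fun i hi => ?_)
          rw [mul_assoc, ← smul_eq_C_mul]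
          exact Submodule.smul_mem _ _ (X_mul_mem_restrictSupport isUpperSet_univ hi hp)
        · rw [hσl l hlj]
          exact X_mul_mem_restrictSupport isUpperSet_univ (Finset.mem_erase.2 ⟨hlj, hl⟩) hp
    let P := squarefreeModule a W Set.univ hU
    -- modulo the first linear form the substitution is the identity
    have hσsub : ∀ e, ∀ p (hp : p ∈ restrictSupport ℚ (suppMonomials W Set.univ e)),
        ∃ x ∈ P.im e, x.1 = p - σ p := by
      let N : ℕ → Submodule ℚ (MvPolynomial α ℚ) := fun e =>
        ((P.im e).map (Submodule.subtype _)).comap (LinearMap.id - σ.toLinearMap)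
      have hN : ∀ e, restrictSupport ℚ (suppMonomials W Set.univ e) ≤ N e := by
        apply restrictSupport_univ_le
        · change 1 - σ 1 ∈ (P.im 0).map (Submodule.subtype _)
          rw [map_one, sub_self]
          exact zero_mem _
        · intro e l hl p hp hpN
          obtain ⟨x, hx, hxp⟩ := hpN
          have hxp' : x.1 = p - σ p := hxp
          change X l * p - σ (X l * p) ∈ (P.im (e + 1)).map (Submodule.subtype _)
          have h1 : X l * p - σ (X l * p) = X l * x.1 + (X l - σ (X l)) * σ p := by
            rw [hxp', map_mul]; ring
          rw [h1]
          refine add_mem ?_ ?_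
          · cases e with
            | zero =>
              rw [show x = 0 from hx]
              exact ⟨0, zero_mem _, by simp⟩
            | succ e =>
              obtain ⟨y, rfl⟩ := hx
              refine ⟨P.op 0 (e + 1)
                ⟨X l * y.1, X_mul_mem_restrictSupport isUpperSet_univ hl y.2⟩, ⟨_, rfl⟩, ?_⟩
              change linForm a W 0 * (X l * y.1) = X l * (linForm a W 0 * y.1)
              ring
          · by_cases hlj : l = j
            · have h2 : X l - σ (X l) = C (a 0 j)⁻¹ * linForm a W 0 := by
                rw [hlj, hσj, sub_neg_eq_add, linForm, ← Finset.add_sum_erase _ _ hj, mul_add,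
                  ← mul_assoc, ← C_mul, inv_mul_cancel₀ hj0, C_1, one_mul, Finset.mul_sum]
                congr 1
                refine Finset.sum_congr rfl fun i _ => ?_
                rw [← mul_assoc, ← C_mul, div_eq_inv_mul]
              have h3 : C (a 0 j)⁻¹ * σ p ∈ restrictSupport ℚ (suppMonomials W Set.univ e) := by
                rw [← smul_eq_C_mul]
                refine Submodule.smul_mem _ _ (restrictSupport_mono _ ?_ (hσmem e hp))
                exact fun m hm => ⟨hm.1, hm.2.1.trans (Finset.erase_subset _ _), hm.2.2⟩
              refine ⟨P.op 0 e ⟨_, h3⟩, ⟨_, rfl⟩, ?_⟩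
              change linForm a W 0 * (C (a 0 j)⁻¹ * σ p) = _
              rw [h2]
              ring
            · rw [hσl l hlj, sub_self, zero_mul]
              exact zero_mem _
      intro e p hp
      obtain ⟨x, hx, hxp⟩ := hN e hp
      exact ⟨x, hx, hxp⟩
    let P' := squarefreeModule a' (W.erase j) Set.univ hU
    let f : ∀ e, P.C e →ₗ[ℚ] P'.C e := fun e => σ.toLinearMap.restrict (hσmem e)
    have hf : ∀ e, P.im e ≤ LinearMap.ker (f e) := by
      intro e
      cases e with
      | zero => exact bot_le
      | succ e =>
        rintro _ ⟨y, rfl⟩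
        refine Subtype.ext ?_
        change σ (linForm a W 0 * y.1) = 0
        rw [map_mul, hlin0, zero_mul]
    let φ : GradedOps.Hom P.quot P' :=
      { f := fun e => (P.im e).liftQ (f e) (hf e)
        comm := fun i e x => by
          obtain ⟨x, rfl⟩ := (P.im e).mkQ_surjective x
          refine Subtype.ext ?_
          change σ (linForm a W (i + 1) * x.1) = linForm a' (W.erase j) i * σ x.1
          rw [map_mul, hlin1] }
    refine GradedOps.Reg.of_iso φ (fun e => ⟨?_, ?_⟩) (ih (by omega) ha')
    · rw [injective_iff_map_eq_zero]
      intro x hx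
      obtain ⟨x, rfl⟩ := (P.im e).mkQ_surjective x
      have h1 : σ x.1 = 0 := congrArg Subtype.val hx
      obtain ⟨y, hy, hyx⟩ := hσsub e x.1 x.2
      rw [h1, sub_zero] at hyx
      refine (Submodule.Quotient.mk_eq_zero _).2 ?_
      rwa [← show y = x from Subtype.ext hyx]
    · rintro ⟨p, hp⟩
      have hp' : p ∈ restrictSupport ℚ (suppMonomials W Set.univ e) :=
        restrictSupport_mono ℚ (s := suppMonomials (W.erase j) Set.univ e)
          (t := suppMonomials W Set.univ e)
          (fun m hm => ⟨hm.1, hm.2.1.trans (Finset.erase_subset _ _), hm.2.2⟩) hp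
      refine ⟨(P.im e).mkQ ⟨p, hp'⟩, Subtype.ext ?_⟩
      change σ p = p
      conv_rhs => rw [← aeval_X_left_apply p]
      refine eval₂Hom_congr' rfl ?_ rfl
      intro l hl _
      have hlj : l ≠ j := by
        rintro rfl
        obtain ⟨m, hm, hml⟩ := (mem_vars_iff_mem_support _).1 hl
        exact Finset.notMem_erase l W ((hp hm).2.1 hml)
      simp [hlj]

end SquarefreeModules

/-! ### Convexity relative to a closed set and its Helly number -/

section RelativeConvexity

variable {E : Type*} [AddCommGroup E] [Module ℝ E]

/-- `A` is the intersection of `S` with a convex set. -/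
def SConvex (S A : Set E) : Prop :=
  A ⊆ S ∧ S ∩ convexHull ℝ A ⊆ A

lemma SConvex.inter_of_convex {S K : Set E} (hK : Convex ℝ K) : SConvex S (S ∩ K) :=
  ⟨Set.inter_subset_left, fun _ hx =>
    ⟨hx.1, convexHull_min Set.inter_subset_right hK hx.2⟩⟩

lemma SConvex.eq {S A : Set E} (h : SConvex S A) : A = S ∩ convexHull ℝ A :=
  Set.Subset.antisymm (fun _ hx => ⟨h.1 hx, subset_convexHull ℝ A hx⟩) h.2

lemma sConvex_sHull (S X : Set E) : SConvex S (S ∩ convexHull ℝ X) :=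
  SConvex.inter_of_convex (convex_convexHull ℝ X)

lemma SConvex.sHull_subset {S A X : Set E} (h : SConvex S A) (hX : X ⊆ A) :
    S ∩ convexHull ℝ X ⊆ A :=
  fun _ hx => h.2 ⟨hx.1, convexHull_mono hX hx.2⟩

lemma SConvex.inter {S A B : Set E} (hA : SConvex S A) (hB : SConvex S B) : SConvex S (A ∩ B) :=
  ⟨fun _ hx => hA.1 hx.1, fun _ hx =>
    ⟨hA.sHull_subset Set.inter_subset_left hx, hB.sHull_subset Set.inter_subset_right hx⟩⟩

/-- The Helly property, for finite families over any index type. -/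
lemma HasHellyProperty.nonempty_iInter {S : Set E} {h : ℕ}
    (hh : HasHellyProperty {T : Set E | ∃ K : Set E, Convex ℝ K ∧ T = S ∩ K} h)
    {ι : Type*} [Finite ι] {A : ι → Set E} (hA : ∀ i, SConvex S (A i))
    (hJ : ∀ J : Finset ι, J.card ≤ h → (⋂ j ∈ J, A j).Nonempty) : (⋂ i, A i).Nonempty := by
  classical
  obtain ⟨m, ⟨e⟩⟩ := Finite.exists_equiv_fin ι
  have := hh m (fun j => A (e.symm j)) (fun j => ⟨_, convex_convexHull ℝ _, (hA _).eq⟩) ?_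
  · obtain ⟨x, hx⟩ := this
    refine ⟨x, Set.mem_iInter.2 fun i => ?_⟩
    simpa using Set.mem_iInter.1 hx (e i)
  · intro t
    obtain ⟨x, hx⟩ := hJ (Finset.univ.image fun s => e.symm (t s))
      (Finset.card_image_le.trans (by simp))
    refine ⟨x, Set.mem_iInter.2 fun s => ?_⟩
    exact Set.mem_iInter₂.1 hx _ (Finset.mem_image_of_mem _ (Finset.mem_univ s))

/-- A point outside the convex hull of a set is an extreme point of the hull of their union. -/
lemma convex_convexHull_insert_diff {G : Set E} {z : E} (hz : z ∉ convexHull ℝ G) :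
    Convex ℝ (convexHull ℝ (insert z G) \ {z}) := by
  obtain rfl | hG := G.eq_empty_or_nonempty
  · simp [convex_empty]
  refine ((convex_convexHull ℝ _).mem_extremePoints_iff_convex_sdiff.1 ?_).2
  refine ⟨subset_convexHull ℝ _ (Set.mem_insert z G), ?_⟩
  rw [convexHull_insert hG]
  intro p hp q hq hpq
  simp only [convexJoin_singleton_left, Set.mem_iUnion] at hp hq
  obtain ⟨g, hg, s₁, s, hs₁, hs, hs1, rfl⟩ := hp
  obtain ⟨g', hg', t₁, t, ht₁, ht, ht1, rfl⟩ := hq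
  obtain ⟨u, v, hu, hv, huv, he⟩ := hpq
  obtain hs0 | hs0 := hs.eq_or_lt'
  · obtain rfl : s₁ = 1 := by linarith
    simp [hs0]
  exfalso
  apply hz
  have hpos : 0 < u * s + v * t := by positivity
  have hcomb : (u * s / (u * s + v * t)) • g + (v * t / (u * s + v * t)) • g' = z := by
    obtain rfl : s₁ = 1 - s := by linarith
    obtain rfl : t₁ = 1 - t := by linarith
    obtain rfl : u = 1 - v := by linarith
    have h1 : ((1 - v) * s) • g + (v * t) • g' = ((1 - v) * s + v * t) • z := by
      linear_combination (norm := module) he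
    rw [div_eq_inv_mul, div_eq_inv_mul, mul_smul _ ((1 - v) * s) g, mul_smul _ (v * t) g',
      ← smul_add, h1, inv_smul_smul₀ hpos.ne']
  rw [← hcomb]
  refine convex_convexHull ℝ G hg hg' (by positivity) (by positivity) ?_
  rw [← add_div, div_self hpos.ne']

end RelativeConvexity

section Separation

variable {E : Type*} [NormedAddCommGroup E] [NormedSpace ℝ E]

lemma isCompact_sHull {S : Set E} (hS : IsClosed S) {X : Set E} (hX : X.Finite) :
    IsCompact (S ∩ convexHull ℝ X) :=
  (hX.isCompact_convexHull ℝ).inter_left hS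

/-- Given finitely many compact sets, one of which avoids the hull of `F`, there is an `S`-convex
set `Q ⊇ F` which avoids at least one of them and such that all sets avoided by `Q` share a point.
One takes `Q = T \ {z}` for a minimal compact `S`-convex `T ⊇ F` meeting all the sets and an extreme
point `z` of `T` outside the hull of `F`. -/
lemma exists_sConvex_avoiding {S : Set E} (hS : IsClosed S) {F : Set E} (hF : F.Finite)
    (hFS : F ⊆ S) {ι : Type*} [Finite ι] {A : ι → Set E} (hA : ∀ r, IsCompact (A r))
    (hAS : ∀ r, A r ⊆ S) (hne : ∀ r, (A r).Nonempty) (r₀ : ι)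
    (hr₀ : Disjoint (convexHull ℝ F) (A r₀)) :
    ∃ Q z, SConvex S Q ∧ F ⊆ Q ∧ (∃ r, Disjoint (A r) Q ∧ z ∈ A r) ∧
      ∀ r, Disjoint (A r) Q → z ∈ A r := by
  classical
  let 𝒯 : Set (Set E) :=
    {T | IsCompact T ∧ SConvex S T ∧ F ⊆ T ∧ ∀ r, (A r ∩ T).Nonempty}
  have hhull : ∀ x : ι → E, (∀ r, x r ∈ A r) → S ∩ convexHull ℝ (F ∪ Set.range x) ∈ 𝒯 := by
    intro x hx
    refine ⟨isCompact_sHull hS (hF.union (Set.finite_range x)), sConvex_sHull _ _, fun p hp =>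
      ⟨hFS hp, subset_convexHull ℝ _ (Or.inl hp)⟩, fun r => ⟨x r, hx r, hAS r (hx r),
        subset_convexHull ℝ _ (Or.inr ⟨r, rfl⟩)⟩⟩
  choose x₀ hx₀ using hne
  obtain ⟨T, -, hT⟩ := zorn_superset_nonempty 𝒯 (by
    intro c hc hchain hcne
    have : Nonempty c := hcne.to_subtype
    refine ⟨⋂₀ c, ⟨?_, ⟨?_, ?_⟩, ?_, ?_⟩, fun s hs => Set.sInter_subset_of_mem hs⟩
    · obtain ⟨s, hs⟩ := hcne
      exact (hc hs).1.of_isClosed_subset (isClosed_sInter fun t ht => (hc ht).1.isClosed)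
        (Set.sInter_subset_of_mem hs)
    · obtain ⟨s, hs⟩ := hcne
      exact (Set.sInter_subset_of_mem hs).trans (hc hs).2.1.1
    · intro p hp s hs
      exact (hc hs).2.1.sHull_subset (Set.sInter_subset_of_mem hs) hp
    · exact fun p hp s hs => (hc hs).2.2.1 hp
    · intro r
      have h1 := IsCompact.nonempty_iInter_of_directed_nonempty_isCompact_isClosed
        (fun s : c => A r ∩ s.1) ?_ (fun s => (hc s.2).2.2.2 r)
        (fun s => (hA r).inter (hc s.2).1) (fun s => ((hA r).inter (hc s.2).1).isClosed)
      · obtain ⟨p, hp⟩ := h1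
        rw [Set.mem_iInter] at hp
        exact ⟨p, (hp (Classical.arbitrary c)).1, fun s hs => (hp ⟨s, hs⟩).2⟩
      · intro s t
        rcases hchain.total s.2 t.2 with h | h
        · exact ⟨s, subset_rfl, Set.inter_subset_inter_right _ h⟩
        · exact ⟨t, Set.inter_subset_inter_right _ h, subset_rfl⟩) _ (hhull x₀ hx₀)
  choose x hxA hxT using hT.prop.2.2.2
  have hTeq : T = S ∩ convexHull ℝ (F ∪ Set.range x) := by
    refine Set.Subset.antisymm (hT.le_of_le (hhull x hxA) ?_) ?_ <;>
    exact hT.prop.2.1.sHull_subset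
      (Set.union_subset hT.prop.2.2.1 (Set.range_subset_iff.2 hxT))
  -- a minimal set `W` of points spanning `T` together with `F`
  let 𝒲 : Set (Finset ι) := {W | Set.range x ⊆ convexHull ℝ (F ∪ x '' W)}
  have := Fintype.ofFinite ι
  obtain ⟨W, hW⟩ : ∃ W, Minimal (· ∈ 𝒲) W := by
    refine exists_minimal_of_wellFoundedLT _ ⟨Finset.univ, ?_⟩
    intro p hp
    exact subset_convexHull ℝ _ (Or.inr (by simpa using hp))
  have hWne : W.Nonempty := by
    rw [Finset.nonempty_iff_ne_empty]
    rintro rfl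
    have h1 := hW.prop ⟨r₀, rfl⟩
    simp only [Finset.coe_empty, Set.image_empty, Set.union_empty] at h1
    exact Set.disjoint_left.1 hr₀ h1 (hxA r₀)
  obtain ⟨w, hw⟩ := hWne
  let G : Set E := F ∪ x '' (W.erase w)
  have hFW : F ∪ x '' W = insert (x w) G := by
    conv_lhs => rw [← Finset.insert_erase hw]
    rw [Finset.coe_insert, Set.image_insert_eq, Set.union_insert]
  have hzG : x w ∉ convexHull ℝ G := by
    intro hz
    have h1 : W.erase w ∈ 𝒲 := by
      refine hW.prop.trans (convexHull_min ?_ (convex_convexHull ℝ _))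
      rw [hFW]
      exact Set.insert_subset hz (subset_convexHull ℝ _)
    exact Finset.notMem_erase w W (hW.le_of_le h1 (Finset.erase_subset _ _) hw)
  have hTG : T = S ∩ convexHull ℝ (insert (x w) G) := by
    rw [hTeq, ← hFW]
    congr 1
    refine Set.Subset.antisymm (convexHull_min ?_ (convex_convexHull ℝ _))
      (convexHull_mono (Set.union_subset_union_right _ (Set.image_subset_range _ _)))
    exact Set.union_subset (Set.subset_union_left.trans (subset_convexHull ℝ _)) hW.prop
  have hFQ : F ⊆ T \ {x w} := by
    intro p hp
    refine ⟨hT.prop.2.2.1 hp, ?_⟩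
    rintro rfl
    exact hzG (subset_convexHull ℝ _ (Or.inl hp))
  have hQ : SConvex S (T \ {x w}) := by
    have h1 := SConvex.inter_of_convex (S := S) (convex_convexHull_insert_diff hzG)
    rwa [← Set.inter_sdiff_assoc, ← hTG] at h1
  have hall : ∀ r, Disjoint (A r) (T \ {x w}) → x w ∈ A r := by
    intro r hr
    by_contra hz
    refine Set.disjoint_left.1 hr (hxA r) ⟨hxT r, ?_⟩
    intro (h : x r = x w)
    exact hz (h ▸ hxA r)
  refine ⟨T \ {x w}, x w, hQ, hFQ, ?_, hall⟩
  by_contra! hcon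
  have h2 : ∀ r, ∃ p ∈ A r, p ∈ T \ {x w} := by
    intro r
    by_contra! h3
    have h4 := Set.disjoint_left.2 h3
    exact hcon r h4 (hall r h4)
  choose x' hx'A hx'T using h2
  have h5 := hQ.sHull_subset (Set.union_subset hFQ (Set.range_subset_iff.2 hx'T))
  exact (h5 (hT.le_of_le (hhull x' hx'A) (h5.trans Set.sdiff_subset) (hxT w))).2 rfl

end Separation

/-! ### Regularity of the ideal of non-intersecting families -/

section KillSet

/-- The families of sets `K i` without a common point in `P`. -/
def killSet {α E : Type*} (K : α → Set E) (P : Set E) : Set (Finset α) :=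
  {R | Disjoint (⋂ i ∈ R, K i) P}

lemma isUpperSet_killSet {α E : Type*} (K : α → Set E) (P : Set E) :
    IsUpperSet (killSet K P) := by
  intro R R' hRR' hR
  exact Disjoint.mono_left (Set.biInter_subset_biInter_left hRR') hR

variable {α : Type} [DecidableEq α]
variable {E : Type*} [NormedAddCommGroup E] [NormedSpace ℝ E]

/-- Helly's theorem for the sets `K i`, `i ∈ R`, together with more than `h` sets `Q l`, each of
which is missed by at most one of the points `y l` common to everything else. -/
lemma HasHellyProperty.notMem_killSet {S : Set E} {h : ℕ}
    (hh : HasHellyProperty {T : Set E | ∃ K : Set E, Convex ℝ K ∧ T = S ∩ K} h)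
    {ι : Type} [Fintype ι] {R : Finset α} {K : α → Set E} {Q : ι → Set E} {y : ι → E}
    (hK : ∀ i ∈ R, SConvex S (K i)) (hQ : ∀ l, SConvex S (Q l)) (hyK : ∀ l, ∀ i ∈ R, y l ∈ K i)
    (hyQ : ∀ l l', l ≠ l' → y l ∈ Q l') (hcard : h + 1 ≤ Fintype.card ι) :
    R ∉ killSet K (⋂ l, Q l) := by
  classical
  obtain ⟨p, hp⟩ := hh.nonempty_iInter (ι := R ⊕ ι) (A := Sum.elim (fun i => K i.1) Q)
    (by rintro (i | l) <;> simp [hQ, hK]) (by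
      intro J hJ
      obtain ⟨l, hl⟩ : ∃ l : ι, Sum.inr l ∉ J := by
        by_contra! hcon
        have h1 : Finset.univ.map ⟨Sum.inr, Sum.inr_injective⟩ ⊆ J := by
          intro j hj
          obtain ⟨l, -, rfl⟩ := Finset.mem_map.1 hj
          exact hcon l
        have h2 := Finset.card_le_card h1
        rw [Finset.card_map, Finset.card_univ] at h2
        omega
      refine ⟨y l, Set.mem_iInter₂.2 ?_⟩
      rintro (i | l') hj
      · exact hyK l i.1 i.2
      · exact hyQ l l' (by rintro rfl; exact hl hj))
  rw [Set.mem_iInter] at hp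
  intro hR
  exact Set.disjoint_left.1 hR (Set.mem_iInter₂.2 fun i hi => hp (Sum.inl ⟨i, hi⟩))
    (Set.mem_iInter.2 fun l => hp (Sum.inr l))

/-- The ideal of families of `K i` without common point in `P = ⋂ l, Q l` is regular in degrees
`≥ D` when `#ι + D` exceeds the Helly number. If the `K i` do have a common point in `P`, or if `P`
is empty, then the claim is clear. Otherwise `P` is cut down to `P ∩ Q'`, where `Q'` avoids
only intersections that contain a point `z`, at the price of an ideal with the additional set `Q'`
and the additional point `z`, in which only the `K i` through `z` take part. -/
theorem squarefreeReg_killSet {S : Set E} (hS : IsClosed S) {h : ℕ}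
    (hh : HasHellyProperty {T : Set E | ∃ K : Set E, Convex ℝ K ∧ T = S ∩ K} h)
    {a : ℕ → α → ℚ} {n : ℕ} (D : ℕ) : ∀ (ι : Type) [Fintype ι] [Nonempty ι] (H : Finset α)
    (K : α → Set E) (Q : ι → Set E) (y : ι → E), (∀ i ∈ H, SConvex S (K i)) →
    (∀ l, SConvex S (Q l)) → (∀ l, y l ∈ S) → (∀ l, ∀ i ∈ H, y l ∈ K i) →
    (∀ l l', l ≠ l' → y l ∈ Q l') → h + 1 ≤ Fintype.card ι + D →
    (∀ W ⊆ H, SquarefreeReg a n 1 W Set.univ) →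
    SquarefreeReg a n D H (killSet K (⋂ l, Q l)) := by
  classical
  induction D with
  | zero =>
    intro ι _ _ H K Q y hK hQ hyS hyK hyQ hcard hbase
    refine squarefreeReg_of_eq_empty a n 0 fun R hR => ?_
    exact hh.notMem_killSet (fun i hi => hK i (hR hi)) hQ (fun l i hi => hyK l i (hR hi)) hyQ hcard
  | succ D ihD =>
    intro ι _ _ H K Q
    obtain ⟨N, hN⟩ : ∃ N, (H.powerset.filter (· ∉ killSet K (⋂ l, Q l))).card = N := ⟨_, rfl⟩
    induction N using Nat.strong_induction_on generalizing K Q with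
    | _ N ihN =>
    intro y hK hQ hyS hyK hyQ hcard hbase
    by_cases hH : H ∈ killSet K (⋂ l, Q l)
    swap
    · exact squarefreeReg_of_eq_empty a n _ fun R hR hR' => hH (isUpperSet_killSet _ _ hR hR')
    by_cases hempty : ∅ ∈ killSet K (⋂ l, Q l)
    · refine ((hbase H subset_rfl).mono (by omega)).congr isUpperSet_univ fun R hR => ?_
      exact iff_of_true trivial (isUpperSet_killSet _ _ (Finset.empty_subset R) hempty)
    -- finitely generated sets with the same non-intersecting families
    let ρ := {R : Finset α // R ∈ H.powerset.filter (· ∉ killSet K (⋂ l, Q l))}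
    have hρ : ∀ R : ρ, R.1 ⊆ H ∧ R.1 ∉ killSet K (⋂ l, Q l) := fun R => by
      simpa only [Finset.mem_filter, Finset.mem_powerset] using R.2
    have hx : ∀ R : ρ, ∃ x, x ∈ (⋂ i ∈ R.1, K i) ∧ x ∈ ⋂ l, Q l := fun R =>
      Set.not_disjoint_iff.1 (hρ R).2
    choose x hxK hxQ using hx
    have hxS : ∀ R, x R ∈ S := fun R =>
      (hQ (Classical.arbitrary ι)).1 (Set.mem_iInter.1 (hxQ R) _)
    let QQ : ι → Set E := fun l => S ∩ convexHull ℝ (Set.range x ∪ y '' {l' | l' ≠ l})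
    let KK : α → Set E := fun i => S ∩ convexHull ℝ (x '' {R | i ∈ R.1} ∪ Set.range y)
    have hQQ : ∀ l, QQ l ⊆ Q l := fun l => (hQ l).sHull_subset <| Set.union_subset
      (Set.range_subset_iff.2 fun R => Set.mem_iInter.1 (hxQ R) l)
      (Set.image_subset_iff.2 fun l' hl' => hyQ l' l hl')
    have hKK : ∀ i ∈ H, KK i ⊆ K i := fun i hi => (hK i hi).sHull_subset <| Set.union_subset
      (Set.image_subset_iff.2 fun R (hR : i ∈ R.1) => Set.mem_iInter₂.1 (hxK R) i hR)
      (Set.range_subset_iff.2 fun l => hyK l i hi)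
    have hyKK : ∀ l i, y l ∈ KK i := fun l i =>
      ⟨hyS l, subset_convexHull ℝ _ (Or.inr ⟨l, rfl⟩)⟩
    have hyQQ : ∀ l l', l ≠ l' → y l ∈ QQ l' := fun l l' hl =>
      ⟨hyS l, subset_convexHull ℝ _ (Or.inr ⟨l, hl, rfl⟩)⟩
    have hxKK : ∀ R : ρ, x R ∈ ⋂ i ∈ R.1, KK i := fun R => Set.mem_iInter₂.2 fun i hi =>
      ⟨hxS R, subset_convexHull ℝ _ (Or.inl ⟨R, hi, rfl⟩)⟩
    have hxQQ : ∀ R : ρ, x R ∈ ⋂ l, QQ l := fun R => Set.mem_iInter.2 fun l =>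
      ⟨hxS R, subset_convexHull ℝ _ (Or.inl ⟨R, rfl⟩)⟩
    have hQQc : IsCompact (⋂ l, QQ l) :=
      (isCompact_sHull hS ((Set.finite_range x).union (Set.toFinite _))).of_isClosed_subset
        (isClosed_iInter fun l => (isCompact_sHull hS
          ((Set.finite_range x).union (Set.toFinite _))).isClosed)
        (Set.iInter_subset QQ (Classical.arbitrary ι))
    have hsame : ∀ R ⊆ H, R ∈ killSet KK (⋂ l, QQ l) ↔ R ∈ killSet K (⋂ l, Q l) := by
      intro R hR
      constructor
      · intro h1
        by_contra h2
        have hmem : R ∈ H.powerset.filter (· ∉ killSet K (⋂ l, Q l)) :=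
          Finset.mem_filter.2 ⟨Finset.mem_powerset.2 hR, h2⟩
        exact Set.disjoint_left.1 h1 (hxKK ⟨R, hmem⟩) (hxQQ ⟨R, hmem⟩)
      · intro h1
        exact Set.disjoint_of_subset (Set.iInter₂_mono fun i hi => hKK i (hR hi))
          (Set.iInter_mono hQQ) h1
    let A : ρ → Set E := fun R => (⋂ i ∈ R.1, KK i) ∩ ⋂ l, QQ l
    have hA : ∀ R, IsCompact (A R) := fun R => hQQc.inter_left <|
      isClosed_biInter fun i _ => (isCompact_sHull hS
        ((Set.toFinite _).union (Set.finite_range y))).isClosed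
    have hAS : ∀ R, A R ⊆ S := fun R p hp =>
      (Set.mem_iInter.1 hp.2 (Classical.arbitrary ι)).1
    let r₀ : ρ := ⟨∅, Finset.mem_filter.2 ⟨Finset.empty_mem_powerset H, hempty⟩⟩
    have hr₀ : Disjoint (convexHull ℝ (Set.range y)) (A r₀) := by
      rw [Set.disjoint_left]
      intro p hp hpA
      refine Set.disjoint_left.1 hH (Set.mem_iInter₂.2 fun i hi => ?_)
        (Set.iInter_mono hQQ hpA.2)
      exact hKK i hi ⟨hAS _ hpA, convexHull_mono Set.subset_union_right hp⟩
    obtain ⟨Q', z, hQ', hFQ', ⟨r, hr, hzr⟩, hall⟩ := exists_sConvex_avoiding hS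
      (Set.finite_range y) (Set.range_subset_iff.2 hyS) hA hAS
      (fun R => ⟨x R, hxKK R, hxQQ R⟩) r₀ hr₀
    have hyQ' : ∀ l, y l ∈ Q' := fun l => hFQ' ⟨l, rfl⟩
    let Z : Finset α := H.filter fun i => z ∉ KK i
    have hinter : (⋂ l, QQ l ∩ Q') = (⋂ l, QQ l) ∩ Q' := (Set.iInter_inter _ _).symm
    have hkey : ∀ R ⊆ H, R ∈ {R | R ∈ killSet KK (⋂ l, QQ l ∩ Q') ∧ ¬ Disjoint R Z} ↔
        R ∈ killSet K (⋂ l, Q l) := by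
      intro R hR
      rw [← hsame R hR, Set.mem_ofPred_eq, hinter]
      constructor
      · rintro ⟨h1, h2⟩
        by_contra h3
        have hmem : R ∈ H.powerset.filter (· ∉ killSet K (⋂ l, Q l)) :=
          Finset.mem_filter.2 ⟨Finset.mem_powerset.2 hR, by rwa [← hsame R hR]⟩
        have h4 : z ∈ A ⟨R, hmem⟩ := by
          refine hall ⟨R, hmem⟩ (Set.disjoint_left.2 fun p hp hpQ => ?_)
          exact Set.disjoint_left.1 h1 hp.1 ⟨hp.2, hpQ⟩
        refine h2 (Finset.disjoint_left.2 fun i hi hiZ => ?_)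
        exact (Finset.mem_filter.1 hiZ).2 (Set.mem_iInter₂.1 h4.1 i hi)
      · intro h1
        refine ⟨Set.disjoint_of_subset_right Set.inter_subset_left h1, fun h2 => ?_⟩
        refine Set.disjoint_left.1 h1 (Set.mem_iInter₂.2 fun i hi => ?_) hzr.2
        by_contra h3
        exact Finset.disjoint_left.1 h2 hi (Finset.mem_filter.2 ⟨hR hi, h3⟩)
    refine (SquarefreeReg.of_inter (isUpperSet_killSet _ _) ?_ ?_).congr ?_ hkey
    · refine ihN _ ?_ KK (fun l => QQ l ∩ Q') rfl y (fun i _ => sConvex_sHull _ _)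
        (fun l => (sConvex_sHull _ _).inter hQ') hyS (fun l i _ => hyKK l i)
        (fun l l' hl => ⟨hyQQ l l' hl, hyQ' l⟩) hcard hbase
      rw [← hN]
      refine Finset.card_lt_card ⟨fun R hR => ?_, fun hsub => ?_⟩
      · rw [Finset.mem_filter, Finset.mem_powerset] at hR ⊢
        refine ⟨hR.1, fun h1 => hR.2 ?_⟩
        rw [← hsame R hR.1] at h1
        rw [hinter]
        exact Set.disjoint_of_subset_right Set.inter_subset_left h1
      · refine (Finset.mem_filter.1 (hsub r.2)).2 ?_
        rw [hinter]
        exact Set.disjoint_left.2 fun p hp hpQ => Set.disjoint_left.1 hr ⟨hp, hpQ.1⟩ hpQ.2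
    · have h1 := ihD (Option ι) (H \ Z) KK (fun o => o.elim Q' QQ) (fun o => o.elim z y)
        (fun i _ => sConvex_sHull _ _)
        (by rintro (_ | l); exacts [hQ', sConvex_sHull _ _])
        (by rintro (_ | l); exacts [hAS r hzr, hyS l])
        (by
          rintro (_ | l) i hi
          · by_contra h2
            rw [Finset.mem_sdiff] at hi
            exact hi.2 (Finset.mem_filter.2 ⟨hi.1, h2⟩)
          · exact hyKK l i)
        (by
          rintro (_ | l) (_ | l') hl
          · exact absurd rfl hl
          · exact Set.mem_iInter.1 hzr.2 l'
          · exact hyQ' l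
          · exact hyQQ l l' fun h2 => hl (congrArg _ h2))
        (by rw [Fintype.card_option]; omega)
        (fun W hW => hbase W (hW.trans Finset.sdiff_subset))
      have h2 : (⋂ o : Option ι, o.elim Q' QQ) = ⋂ l, QQ l ∩ Q' := by
        rw [hinter, Set.inter_comm]
        exact iInf_option _
      rwa [h2] at h1
    · intro R R' hRR' hR
      exact ⟨isUpperSet_killSet _ _ hRR' hR.1, fun h1 => hR.2 (h1.mono_left hRR')⟩

end KillSet

/-! ### Identities between multiset counts -/

section Multichoose

open Finset Nat

lemma sum_multichoose_mul_multichoose (v n e : ℕ) :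
    ∑ l ∈ range (e + 1), multichoose v l * multichoose n (e - l) = multichoose (n + v) e := by
  induction v generalizing e with
  | zero => simp [sum_range_succ']
  | succ v ihv =>
    induction e with
    | zero => simp
    | succ e ihe =>
      have h1 := ihv (e + 1)
      rw [sum_range_succ'] at h1 ⊢
      simp only [multichoose_succ_succ, add_mul, sum_add_distrib, Nat.add_sub_add_right] at h1 ⊢
      rw [ihe, show n + (v + 1) = (n + v) + 1 by ring, multichoose_succ_succ, ← h1]
      simp only [multichoose_zero_right]
      ring

/-- Multisets of size `e + 1 + s` from `n` ordered elements, sorted by their `(s+1)`-st smallest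
member. -/
lemma sum_multichoose_sub (n e s : ℕ) :
    ∑ i ∈ range n, multichoose (n - i) e * multichoose (i + 1) s = multichoose n (e + 1 + s) := by
  induction n generalizing e with
  | zero => simp [show e + 1 + s = (e + s) + 1 by ring]
  | succ n ihn =>
    induction e with
    | zero =>
      have h1 := ihn 0
      simp only [multichoose_zero_right, one_mul] at h1 ⊢
      rw [sum_range_succ, h1, show 0 + 1 + s = s + 1 by ring, multichoose_succ_succ]
    | succ e ihe =>
      have h1 : ∀ i ∈ range (n + 1), multichoose (n + 1 - i) (e + 1) * multichoose (i + 1) s =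
          multichoose (n - i) (e + 1) * multichoose (i + 1) s +
            multichoose (n + 1 - i) e * multichoose (i + 1) s := by
        intro i hi
        rw [mem_range] at hi
        rw [show n + 1 - i = (n - i) + 1 by omega, multichoose_succ_succ, add_mul]
      rw [sum_congr rfl h1, sum_add_distrib, ihe, sum_range_succ, ihn]
      simp only [Nat.sub_self, multichoose_zero_succ, zero_mul, add_zero]
      rw [show e + 1 + 1 + s = (e + 1 + s) + 1 by ring, multichoose_succ_succ]

/-- Multisets of size `M` from `N` elements with fewer than `d` members among `v` given ones. -/
def sparseCount (d N v M : ℕ) : ℕ :=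
  ∑ l ∈ range d, multichoose v l * multichoose (N - v) (M - l)

/-- The coefficients of `s ↦ multichoose N (d + s)` in the basis `multichoose (i + 1) s`, `i < N`,
of the polynomials of degree `< N`. -/
def hilbertCoeff (N i : ℕ) : ℕ → ℕ
  | 0 => if i + 1 = N then 1 else 0
  | e + 1 => multichoose (N - i) e

lemma sum_hilbertCoeff {N : ℕ} (hN : 0 < N) (d s : ℕ) :
    ∑ i ∈ range N, hilbertCoeff N i d * multichoose (i + 1) s = multichoose N (d + s) := by
  cases d with
  | zero =>
    obtain ⟨N, rfl⟩ := Nat.exists_eq_add_of_lt hN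
    simp [hilbertCoeff]
  | succ e => exact sum_multichoose_sub N e s

lemma sum_hilbertCoeff_sub {N v : ℕ} (hv : 0 < v) (hvN : v ≤ N) (d s : ℕ) :
    ∑ i ∈ range (N - v), hilbertCoeff N i d * multichoose (i + 1) s =
      sparseCount d N v (d + s) := by
  cases d with
  | zero =>
    rw [sparseCount, range_zero, sum_empty]
    refine sum_eq_zero fun i hi => ?_
    rw [mem_range] at hi
    rw [hilbertCoeff, if_neg (by omega), zero_mul]
  | succ e =>
    have h1 : ∀ i ∈ range (N - v), hilbertCoeff N i (e + 1) * multichoose (i + 1) s =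
        ∑ l ∈ range (e + 1), multichoose v l *
          (multichoose (N - v - i) (e - l) * multichoose (i + 1) s) := by
      intro i hi
      rw [mem_range] at hi
      rw [hilbertCoeff, show N - i = (N - v - i) + v by omega, ← sum_multichoose_mul_multichoose,
        sum_mul]
      exact sum_congr rfl fun l _ => by ring
    rw [sum_congr rfl h1, sum_comm, sparseCount]
    refine sum_congr rfl fun l hl => ?_
    rw [mem_range] at hl
    rw [← mul_sum, sum_multichoose_sub, show e - l + 1 + s = e + 1 + s - l by omega]

lemma eq_zero_of_sum_multichoose_eq_zero (N : ℕ) (s₀ : ℕ) (x : ℕ → ℤ)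
    (h : ∀ s, s₀ ≤ s → ∑ i ∈ range N, x i * (multichoose (i + 1) s : ℤ) = 0) :
    ∀ i < N, x i = 0 := by
  induction N generalizing s₀ x with
  | zero => intro i hi; omega
  | succ N ih =>
    have h1 : ∀ i < N, x (i + 1) = 0 := by
      refine ih (s₀ + 1) (fun i => x (i + 1)) fun s hs => ?_
      obtain ⟨s, rfl⟩ : ∃ t, s = t + 1 := ⟨s - 1, by omega⟩
      have h2 := h (s + 1) (by omega)
      have h3 := h s (by omega)
      rw [sum_range_succ'] at h2 h3
      simp only [multichoose_succ_succ, zero_add, multichoose_one, multichoose_zero_succ, mul_add,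
        sum_add_distrib, Nat.cast_add] at h2 h3 ⊢
      linarith
    intro i hi
    cases i with
    | succ i => exact h1 i (by omega)
    | zero =>
      have h2 := h s₀ le_rfl
      rw [sum_range_succ', sum_eq_zero fun i hi => by rw [h1 i (mem_range.1 hi), zero_mul]] at h2
      simpa using h2

/-- If `multichoose N` is a sum of Hilbert functions `F x`, with expansions in the first `n x`
basis polynomials having nonnegative coefficients, then those with few basis polynomials add up to
at most the corresponding part of the expansion of `multichoose N`. -/
lemma sum_le_sparseCount {Λ : Type*} (L : Finset Λ) {N d : ℕ} (hN : 0 < N) (n : Λ → ℕ)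
    (F b : Λ → ℕ → ℕ) (hn : ∀ x ∈ L, n x ≤ N)
    (hb : ∀ x ∈ L, ∑ i ∈ range (n x), b x i ≤ F x d)
    (hF : ∀ x ∈ L, ∀ t, F x (d + 1 + t) = ∑ i ∈ range (n x), b x i * (t + 1 + i).choose i)
    (hsum : ∀ M, ∑ x ∈ L, F x M = multichoose N M) {v : ℕ} (hv : 0 < v) (hvN : v ≤ N)
    {M : ℕ} (hM : d ≤ M) :
    ∑ x ∈ L with n x + v ≤ N, F x M ≤ sparseCount d N v M := by
  classical
  let b' : Λ → ℕ → ℕ := fun x i => if i < n x then b x i else 0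
  have hext : ∀ x ∈ L, ∀ (k : ℕ) (g : ℕ → ℕ), n x ≤ k →
      ∑ i ∈ range (n x), b x i * g i = ∑ i ∈ range k, b' x i * g i := by
    intro x hx k g hk
    rw [← sum_subset (range_subset_range.2 hk) (fun i _ hi => by
      rw [mem_range] at hi
      simp [b', hi])]
    refine sum_congr rfl fun i hi => ?_
    simp [b', mem_range.1 hi]
  have hmc : ∀ t i : ℕ, (t + 1 + i).choose i = multichoose (i + 1) (t + 1) := by
    intro t i
    rw [multichoose_eq, show i + 1 + (t + 1) - 1 = t + 1 + i by omega, ← Nat.choose_symm_add]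
  let B : ℕ → ℕ := fun i => ∑ x ∈ L, b' x i
  have hB : ∀ i < N, B i = hilbertCoeff N i d := by
    have h1 := eq_zero_of_sum_multichoose_eq_zero N 1
      (fun i => (B i : ℤ) - hilbertCoeff N i d) (by
        intro s hs
        obtain ⟨t, rfl⟩ : ∃ t, s = t + 1 := ⟨s - 1, by omega⟩
        have h2 := sum_hilbertCoeff hN d (t + 1)
        rw [← hsum, show d + (t + 1) = d + 1 + t by ring, sum_congr rfl fun x hx => hF x hx t,
          sum_congr rfl fun x hx => hext x hx N _ (hn x hx), sum_comm] at h2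
        simp only [sub_mul, sum_sub_distrib, sub_eq_zero]
        norm_cast
        rw [h2]
        refine sum_congr rfl fun i _ => ?_
        rw [sum_mul]
        exact sum_congr rfl fun x _ => by rw [hmc])
    intro i hi
    have h3 := h1 i hi
    simp only [sub_eq_zero] at h3
    exact_mod_cast h3
  have hbad : ∀ s, ∑ x ∈ L with n x + v ≤ N, ∑ i ∈ range (n x), b x i * multichoose (i + 1) s ≤
      sparseCount d N v (d + s) := by
    intro s
    rw [← sum_hilbertCoeff_sub hv hvN, sum_congr rfl fun x hx => hext x (mem_filter.1 hx).1 (N - v)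
      _ (Nat.le_sub_of_add_le (mem_filter.1 hx).2), sum_comm]
    refine sum_le_sum fun i hi => ?_
    rw [← hB i (by rw [mem_range] at hi; omega), ← sum_mul]
    exact Nat.mul_le_mul_right _ (sum_le_sum_of_subset (filter_subset _ _))
  obtain ⟨s, rfl⟩ := Nat.exists_eq_add_of_le hM
  cases s with
  | succ t =>
    refine le_trans (le_of_eq (sum_congr rfl fun x hx => ?_)) (hbad (t + 1))
    rw [← Nat.add_assoc, Nat.add_right_comm, hF x (mem_filter.1 hx).1]
    exact sum_congr rfl fun i _ => by rw [hmc]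
  | zero =>
    -- in degree `d` only the lower bound for the other summands is available
    have h1 := hbad 0
    simp only [multichoose_zero_right, mul_one, Nat.add_zero] at h1 ⊢
    have h2 := sum_hilbertCoeff hN d 0
    rw [← hsum, sum_congr rfl fun i hi => by rw [← hB i (mem_range.1 hi)]] at h2
    simp only [multichoose_zero_right, mul_one, Nat.add_zero, B] at h2
    rw [sum_comm, ← sum_filter_add_sum_filter_not L (fun x => n x + v ≤ N) (fun x => F x d),
      ← sum_filter_add_sum_filter_not L (fun x => n x + v ≤ N)] at h2
    have h3 : ∀ x ∈ L, ∑ i ∈ range N, b' x i = ∑ i ∈ range (n x), b x i := by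
      intro x hx
      simpa using (hext x hx N (fun _ => 1) (hn x hx)).symm
    have h4 : ∑ x ∈ L with ¬ n x + v ≤ N, ∑ i ∈ range N, b' x i ≤
        ∑ x ∈ L with ¬ n x + v ≤ N, F x d := by
      refine sum_le_sum fun x hx => ?_
      rw [h3 x (mem_filter.1 hx).1]
      exact hb x (mem_filter.1 hx).1
    have h5 : ∑ x ∈ L with n x + v ≤ N, ∑ i ∈ range N, b' x i ≤ sparseCount d N v d := by
      refine le_trans (le_of_eq (sum_congr rfl fun x hx => ?_)) h1
      exact h3 x (mem_filter.1 hx).1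
    omega

end Multichoose

/-! ### Counting samples by the number of violated constraints -/

section TypeTruncation

variable {α : Type} {τ : Type*} [DecidableEq τ] (Φ : α → τ)

lemma isUpperSet_image_superset (σ : Finset τ) : IsUpperSet {R : Finset α | σ ⊆ R.image Φ} :=
  fun _ _ hRR' hR => le_trans hR (Finset.image_subset_image hRR')

variable [DecidableEq α]

/-- Meeting each of the `|σ|` disjoint fibres over `σ` costs one degree per fibre. -/
lemma squarefreeReg_image_superset {a : ℕ → α → ℚ} {n : ℕ} (σ : Finset τ) (W : Finset α)
    (hbase : ∀ W' ⊆ W, SquarefreeReg a n 1 W' Set.univ) :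
    SquarefreeReg a n (σ.card + 1) W {R | σ ⊆ R.image Φ} := by
  induction σ using Finset.induction_on generalizing W with
  | empty =>
    exact (hbase W subset_rfl).congr isUpperSet_univ fun R _ =>
      iff_of_true trivial (Finset.empty_subset (R.image Φ))
  | insert t σ ht ih =>
    rw [Finset.card_insert_of_notMem ht]
    refine (SquarefreeReg.of_inter (Z := W.filter fun j => Φ j = t)
      (isUpperSet_image_superset Φ σ) ((ih W hbase).mono (by omega)) (ih _ fun W' hW' =>
        hbase W' (hW'.trans Finset.sdiff_subset))).congr ?_ ?_
    · intro R R' hRR' hR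
      exact ⟨isUpperSet_image_superset Φ σ hRR' hR.1, fun h => hR.2 (h.mono_left hRR')⟩
    · intro R hR
      simp only [Set.mem_ofPred_eq, Finset.insert_subset_iff, Finset.mem_image,
        Finset.not_disjoint_iff, Finset.mem_filter]
      constructor
      · rintro ⟨h1, j, hj, -, hjt⟩
        exact ⟨⟨j, hj, hjt⟩, h1⟩
      · rintro ⟨⟨j, hj, hjt⟩, h1⟩
        exact ⟨h1, j, hj, hR hj, hjt⟩

/-- Regularity in degrees `> D` survives the removal of the supports with a type set in a
down-closed family of sets of fewer than `D` types, provided membership in `U` depends on types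
only. The type sets are removed one at a time, each maximal among those removed so far. -/
lemma squarefreeReg_image_notMem {a : ℕ → α → ℚ} {n D : ℕ} {U : Set (Finset α)}
    (hU : IsUpperSet U) (hUΦ : ∀ R R' : Finset α, R.image Φ = R'.image Φ → R ∈ U → R' ∈ U)
    (W : Finset α) (hbase : ∀ W' ⊆ W, SquarefreeReg a n 1 W' Set.univ)
    (h : SquarefreeReg a n (D + 1) W U) (𝒯 : Finset (Finset τ))
    (hlow : IsLowerSet (𝒯 : Set (Finset τ))) (hcard : ∀ σ ∈ 𝒯, σ.card < D) :
    SquarefreeReg a n (D + 1) W {R | R ∈ U ∧ R.image Φ ∉ 𝒯} := by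
  induction 𝒯 using Finset.strongInduction with
  | H 𝒯 ih =>
  obtain rfl | hne := 𝒯.eq_empty_or_nonempty
  · exact h.congr hU fun R _ => by simp
  obtain ⟨σ, hσ⟩ := 𝒯.exists_maximal hne
  have hup : ∀ 𝒯' : Finset (Finset τ), IsLowerSet (𝒯' : Set (Finset τ)) →
      IsUpperSet {R | R ∈ U ∧ R.image Φ ∉ 𝒯'} := fun 𝒯' h' R R' hRR' hR =>
    ⟨hU hRR' hR.1, fun h1 => hR.2 (h' (Finset.image_subset_image hRR') h1)⟩
  have hlow' : IsLowerSet ((𝒯.erase σ : Finset (Finset τ)) : Set (Finset τ)) := by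
    intro ρ ρ' hρ hρm
    rw [Finset.mem_coe, Finset.mem_erase] at hρm ⊢
    refine ⟨?_, hlow hρ hρm.2⟩
    rintro rfl
    exact hρm.1 (le_antisymm (hσ.le_of_ge hρm.2 hρ) hρ)
  have hB := ih (𝒯.erase σ) (Finset.erase_ssubset hσ.prop) hlow'
    fun ρ hρ => hcard ρ (Finset.mem_of_mem_erase hρ)
  have hkey : ∀ R : Finset α, R.image Φ ∉ 𝒯.erase σ → R.image Φ ⊆ σ → R.image Φ = σ := by
    intro R h1 h2
    by_contra h3
    exact h1 (Finset.mem_erase.2 ⟨h3, hlow h2 hσ.prop⟩)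
  have hC : SquarefreeReg a n D (W \ W.filter fun j => Φ j ∉ σ)
      {R | R ∈ U ∧ R.image Φ ∉ 𝒯.erase σ} := by
    have hsub : ∀ R ⊆ W \ W.filter (fun j => Φ j ∉ σ), R.image Φ ⊆ σ := by
      intro R hR
      refine Finset.image_subset_iff.2 fun j hj => ?_
      have := hR hj
      rw [Finset.mem_sdiff, Finset.mem_filter] at this
      by_contra h1
      exact this.2 ⟨this.1, h1⟩
    by_cases hex : ∃ R ∈ U, R.image Φ = σ
    · obtain ⟨R₀, hR₀, hR₀σ⟩ := hex
      refine ((squarefreeReg_image_superset Φ σ _ fun W' hW' =>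
        hbase W' (hW'.trans Finset.sdiff_subset)).mono (hcard σ hσ.prop)).congr
        (isUpperSet_image_superset Φ σ) fun R hR => ?_
      constructor
      · intro (h1 : σ ⊆ R.image Φ)
        have h2 := Finset.Subset.antisymm (hsub R hR) h1
        exact ⟨hUΦ R₀ R (hR₀σ.trans h2.symm) hR₀, by rw [h2]; exact Finset.notMem_erase _ _⟩
      · intro h1
        exact (hkey R h1.2 (hsub R hR)).ge
    · refine squarefreeReg_of_eq_empty a n D fun R hR hRU => hex ⟨R, hRU.1, ?_⟩
      exact hkey R hRU.2 (hsub R hR)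
  refine (SquarefreeReg.of_inter (hup _ hlow') hB hC).congr ?_ fun R hR => ?_
  · intro R R' hRR' hR
    exact ⟨hup _ hlow' hRR' hR.1, fun h1 => hR.2 (h1.mono_left hRR')⟩
  · constructor
    · rintro ⟨⟨h1, h2⟩, h3⟩
      refine ⟨h1, fun h4 => h3 ?_⟩
      have h5 : R.image Φ = σ := by
        by_contra h5
        exact h2 (Finset.mem_erase.2 ⟨h5, h4⟩)
      refine Finset.disjoint_left.2 fun j hj hjZ => (Finset.mem_filter.1 hjZ).2 ?_
      exact h5 ▸ Finset.mem_image_of_mem Φ hj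
    · rintro ⟨h1, h2⟩
      refine ⟨⟨h1, fun h3 => h2 (Finset.mem_of_mem_erase h3)⟩, fun h3 => ?_⟩
      have h4 : R.image Φ ⊆ σ := Finset.image_subset_iff.2 fun j hj => by
        by_contra h5
        exact Finset.disjoint_left.1 h3 hj (Finset.mem_filter.2 ⟨hR hj, h5⟩)
      exact h2 (hlow h4 hσ.prop)

end TypeTruncation

section Counting

variable {α : Type} [Fintype α] {τ : Type*} [DecidableEq τ] {E : Type*}

/-- The constraints violated by the choice `x R` based on the constraints in `R`. As long as there
are fewer than `d` different types of constraints in `R`, these are by definition the constraints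
of other types. -/
noncomputable def violators (Φ : α → τ) (K : α → Set E) (d : ℕ) (x : Finset α → E)
    (R : Finset α) : Finset α := by
  classical exact
  if d ≤ (R.image Φ).card then Finset.univ.filter (fun i => x R ∉ K i)
  else Finset.univ.filter (fun i => Φ i ∉ R.image Φ)

lemma mem_violators_of_le {Φ : α → τ} {K : α → Set E} {d : ℕ} {x : Finset α → E} {R : Finset α}
    (h : d ≤ (R.image Φ).card) {i : α} : i ∈ violators Φ K d x R ↔ x R ∉ K i := by
  simp [violators, h]

lemma mem_violators_of_not_le {Φ : α → τ} {K : α → Set E} {d : ℕ} {x : Finset α → E} {R : Finset α}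
    (h : ¬ d ≤ (R.image Φ).card) {i : α} : i ∈ violators Φ K d x R ↔ Φ i ∉ R.image Φ := by
  simp [violators, h]

variable [DecidableEq α]

lemma mem_finsuppAntidiag_univ {m : α →₀ ℕ} {M : ℕ} :
    m ∈ Finset.univ.finsuppAntidiag M ↔ m.degree = M := by
  simp [Finset.mem_finsuppAntidiag, Finsupp.degree_eq_sum]

lemma card_finsuppAntidiag_univ (M : ℕ) :
    (Finset.univ.finsuppAntidiag M : Finset (α →₀ ℕ)).card =
      (Fintype.card α).multichoose M := by
  rw [Finset.card_finsuppAntidiag_nat_eq_multichoose, Finset.card_univ]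

variable [NormedAddCommGroup E] [NormedSpace ℝ E]

/-- All monomials are distributed according to the choice made for their support. The supports with
a given choice form an upper set in a set of variables, and the resulting squarefree monomial ideals
are regular in degrees above `d`, so that their Hilbert functions can be compared. -/
theorem card_violators_le {S : Set E} (hS : IsClosed S) {d : ℕ}
    (hh : HasHellyProperty {T : Set E | ∃ K : Set E, Convex ℝ K ∧ T = S ∩ K} (d + 1))
    (Φ : α → τ) (K : α → Set E) (hK : ∀ i, SConvex S (K i))
    (hΦ : ∀ i j, Φ i = Φ j → K i = K j) (c : E →ₗ[ℝ] ℝ) (x : Finset α → E)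
    (hx : ∀ R : Finset α, d ≤ (R.image Φ).card → x R ∈ S ∧ (∀ i ∈ R, x R ∈ K i) ∧
      ∀ y ∈ S, (∀ i ∈ R, y ∈ K i) → c y ≤ c (x R) → y = x R)
    {v M : ℕ} (hv : 0 < v) (hvN : v ≤ Fintype.card α) (hM : d ≤ M) :
    ((Finset.univ.powersetCard M).filter fun R => v ≤ (violators Φ K d x R).card).card ≤
      sparseCount d (Fintype.card α) v M := by
  classical
  -- `lab` is the choice made for a support, `G l` consists of the constraints satisfied under the
  -- choice `l`, and the supports with choice `l` are the members of `U l` inside `G l`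
  let lab : Finset α → Finset τ ⊕ E := fun R =>
    if d ≤ (R.image Φ).card then Sum.inr (x R) else Sum.inl (R.image Φ)
  let G : Finset τ ⊕ E → Finset α := Sum.elim (fun σ => Finset.univ.filter fun i => Φ i ∈ σ)
    (fun y => Finset.univ.filter fun i => y ∈ K i)
  let below : E → Set E := fun y => {p | p ∈ S ∧ c p < c y}
  let U : Finset τ ⊕ E → Set (Finset α) := Sum.elim (fun σ => {R | σ ⊆ R.image Φ})
    (fun y => {R | R ∈ killSet K (below y) ∧ d ≤ (R.image Φ).card})
  let L : Finset (Finset τ ⊕ E) := Finset.univ.image lab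
  have hL : ∀ l ∈ L, (∃ σ : Finset τ, σ.card < d ∧ l = Sum.inl σ) ∨ ∃ y ∈ S, l = Sum.inr y := by
    intro l hl
    obtain ⟨R, -, rfl⟩ := Finset.mem_image.1 hl
    by_cases h : d ≤ (R.image Φ).card
    · exact Or.inr ⟨x R, (hx R h).1, if_pos h⟩
    · exact Or.inl ⟨R.image Φ, not_le.1 h, if_neg h⟩
  have hbelow : ∀ y, SConvex S (below y) := fun y =>
    SConvex.inter_of_convex (K := {p | c p < c y}) (convex_halfSpace_lt c.isLinear (c y))
  have hkillΦ : ∀ y, ∀ R R' : Finset α, R.image Φ = R'.image Φ → R ∈ killSet K (below y) →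
      R' ∈ killSet K (below y) := by
    intro y R R' hRR' hR
    refine Set.disjoint_of_subset_left (fun p hp => ?_) hR
    refine Set.mem_iInter₂.2 fun i hi => ?_
    have h1 : Φ i ∈ R'.image Φ := hRR' ▸ Finset.mem_image_of_mem Φ hi
    obtain ⟨j, hj, hji⟩ := Finset.mem_image.1 h1
    rw [← hΦ j i hji]
    exact Set.mem_iInter₂.1 hp j hj
  have hU : ∀ l, IsUpperSet (U l) := by
    rintro (σ | y)
    · exact isUpperSet_image_superset Φ σ
    · intro R R' hRR' hR
      exact ⟨isUpperSet_killSet _ _ hRR' hR.1,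
        hR.2.trans (Finset.card_le_card (Finset.image_subset_image hRR'))⟩
  have hlab : ∀ l ∈ L, ∀ R : Finset α, R ⊆ G l ∧ R ∈ U l ↔ lab R = l := by
    intro l hl R
    obtain ⟨σ, hσ, rfl⟩ | ⟨y, hyS, rfl⟩ := hL l hl
    · constructor
      · rintro ⟨h1, h2 : σ ⊆ R.image Φ⟩
        have h3 : R.image Φ = σ := by
          refine Finset.Subset.antisymm (Finset.image_subset_iff.2 fun j hj => ?_) h2
          exact (Finset.mem_filter.1 (h1 hj)).2
        change ite _ _ _ = _
        rw [if_neg (by rw [h3]; omega), h3]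
      · intro h1
        change ite _ _ _ = _ at h1
        split_ifs at h1 with h2
        obtain rfl := Sum.inl_injective h1
        exact ⟨fun j hj => Finset.mem_filter.2 ⟨Finset.mem_univ _, Finset.mem_image_of_mem Φ hj⟩,
          Finset.Subset.refl (R.image Φ)⟩
    · constructor
      · rintro ⟨h1, h2, h3⟩
        change ite _ _ _ = _
        rw [if_pos h3]
        obtain ⟨hxS, hxK, hxu⟩ := hx R h3
        refine congrArg Sum.inr (hxu y hyS (fun i hi => (Finset.mem_filter.1 (h1 hi)).2) ?_).symm
        by_contra! h4
        exact Set.disjoint_left.1 h2 (Set.mem_iInter₂.2 hxK) ⟨hxS, h4⟩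
      · intro h1
        change ite _ _ _ = _ at h1
        split_ifs at h1 with h2
        obtain rfl := Sum.inr_injective h1
        obtain ⟨hxS, hxK, hxu⟩ := hx R h2
        refine ⟨fun i hi => Finset.mem_filter.2 ⟨Finset.mem_univ _, hxK i hi⟩,
          Set.disjoint_left.2 fun p hp hpb => ?_, h2⟩
        have h3 := hxu p hpb.1 (fun i hi => Set.mem_iInter₂.1 hp i hi) hpb.2.le
        exact absurd hpb.2 (by rw [h3]; exact lt_irrefl _)
  -- distinct nodes for the Vandermonde linear forms
  let t : α → ℚ := fun j => (Fintype.equivFin α j : ℕ)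
  have ht : Function.Injective t := fun i j hij =>
    (Fintype.equivFin α).injective (Fin.ext (Nat.cast_injective hij))
  let a : ℕ → α → ℚ := fun i j => t j ^ i
  have hreg : ∀ l ∈ L, SquarefreeReg a (G l).card (d + 1) (G l) (U l) := by
    intro l hl
    have hbase : ∀ W' ⊆ G l, SquarefreeReg a (G l).card 1 W' Set.univ := fun W' hW' =>
      squarefreeReg_univ (Finset.card_le_card hW') (nondegenerateForms_pow ht W')
    obtain ⟨σ, hσ, rfl⟩ | ⟨y, hyS, rfl⟩ := hL l hl
    · exact (squarefreeReg_image_superset Φ σ _ hbase).mono (by omega)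
    · -- the induction starts with the single set of better points and the point `y` outside it
      have h1 := squarefreeReg_killSet hS hh (a := a) (n := (G (Sum.inr y)).card) (d + 1) Unit
        (G (Sum.inr y)) K (fun _ => below y) (fun _ => y) (fun i _ => hK i) (fun _ => hbelow y)
        (fun _ => hyS) (fun _ i hi => (Finset.mem_filter.1 hi).2)
        (fun l l' hl => absurd (Subsingleton.elim l l') hl) (by simp) hbase
      rw [Set.iInter_const] at h1
      have h2 := squarefreeReg_image_notMem Φ (isUpperSet_killSet K (below y)) (hkillΦ y)
        (G (Sum.inr y)) hbase h1
        ((Finset.univ.image Φ).powerset.filter fun σ => σ.card < d) (by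
          intro σ σ' hσ hσm
          rw [Finset.mem_coe, Finset.mem_filter, Finset.mem_powerset] at hσm ⊢
          exact ⟨hσ.trans hσm.1, (Finset.card_le_card hσ).trans_lt hσm.2⟩)
        (fun σ hσ => (Finset.mem_filter.1 hσ).2)
      refine h2.congr ?_ fun R hR => ?_
      · intro R R' hRR' hR
        refine ⟨isUpperSet_killSet _ _ hRR' hR.1, fun h3 => hR.2 ?_⟩
        rw [Finset.mem_filter, Finset.mem_powerset] at h3 ⊢
        have h4 := Finset.image_subset_image (f := Φ) hRR'
        exact ⟨h4.trans h3.1, (Finset.card_le_card h4).trans_lt h3.2⟩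
      · refine and_congr_right fun _ => ?_
        rw [Finset.mem_filter, Finset.mem_powerset, not_and, not_lt]
        exact ⟨fun h3 => h3 (Finset.image_subset_image (Finset.subset_univ R)), fun h3 _ => h3⟩
  have hF : ∀ l ∈ L, ∀ M, (suppMonomials (G l) (U l) M).ncard =
      ((Finset.univ.finsuppAntidiag M).filter fun m : α →₀ ℕ => lab m.support = l).card := by
    intro l hl M
    rw [← Set.ncard_coe_finset]
    congr 1
    ext m
    rw [Finset.mem_coe, Finset.mem_filter, mem_finsuppAntidiag_univ, ← hlab l hl]
    rfl
  have hb : ∀ l ∈ L, ∃ b : ℕ → ℕ,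
      ∑ i ∈ Finset.range (G l).card, b i ≤ (suppMonomials (G l) (U l) d).ncard ∧
      ∀ t, (suppMonomials (G l) (U l) (d + 1 + t)).ncard =
        ∑ i ∈ Finset.range (G l).card, b i * (t + 1 + i).choose i := by
    intro l hl
    obtain ⟨b, hb1, hb2⟩ := (hreg l hl (hU l)).exists_hilbert
    refine ⟨b, ?_, fun t => ?_⟩
    · rw [← finrank_squarefreeModule a (G l) (U l) (hU l)]
      exact hb1.trans (LinearMap.finrank_range_le _)
    · rw [← finrank_squarefreeModule a (G l) (U l) (hU l)]
      exact hb2 t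
  choose! b hb1 hb2 using hb
  have hbound := sum_le_sparseCount L (hv.trans_le hvN) (fun l => (G l).card)
    (fun l M => (suppMonomials (G l) (U l) M).ncard) b (fun l _ => Finset.card_le_univ _) hb1 hb2
    (by
      intro M
      rw [← card_finsuppAntidiag_univ, Finset.sum_congr rfl fun l hl => hF l hl M,
        ← Finset.card_eq_sum_card_fiberwise]
      exact fun m _ => Finset.mem_image_of_mem lab (Finset.mem_univ m.support)) hv hvN hM
  refine le_trans ?_ hbound
  rw [Finset.sum_congr rfl fun l hl => hF l (Finset.mem_filter.1 hl).1 M]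
  have hviol : ∀ R, v ≤ (violators Φ K d x R).card → (G (lab R)).card + v ≤ Fintype.card α := by
    intro R hR
    have h1 : violators Φ K d x R = Finset.univ \ G (lab R) := by
      by_cases h : d ≤ (R.image Φ).card
      · ext i
        simp [violators, lab, G, h]
      · ext i
        simp [violators, lab, G, h]
    rw [h1, Finset.card_sdiff_of_subset (Finset.subset_univ _), Finset.card_univ] at hR
    have := Finset.card_le_univ (G (lab R))
    omega
  have hcard : ∑ l ∈ L with (G l).card + v ≤ Fintype.card α,
      ((Finset.univ.finsuppAntidiag M).filter fun m : α →₀ ℕ => lab m.support = l).card =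
      ((Finset.univ.finsuppAntidiag M).filter fun m : α →₀ ℕ =>
        (G (lab m.support)).card + v ≤ Fintype.card α).card := by
    rw [Finset.card_eq_sum_card_fiberwise (f := fun m : α →₀ ℕ => lab m.support)
      (t := L.filter fun l => (G l).card + v ≤ Fintype.card α)]
    · refine Finset.sum_congr rfl fun l hl => ?_
      rw [Finset.filter_filter]
      congr 1
      refine Finset.filter_congr fun m _ => ?_
      constructor
      · rintro rfl
        exact ⟨(Finset.mem_filter.1 hl).2, rfl⟩
      · exact fun h => h.2
    · intro m hm
      exact Finset.mem_filter.2 ⟨Finset.mem_image_of_mem lab (Finset.mem_univ _),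
        (Finset.mem_filter.1 hm).2⟩
  rw [hcard]
  have hsupp : ∀ R : Finset α, (Finsupp.indicator R fun _ _ => 1 : α →₀ ℕ).support = R := by
    intro R
    ext i
    simp [Finsupp.indicator_apply]
  refine Finset.card_le_card_of_injOn (fun R => Finsupp.indicator R fun _ _ => 1) ?_ ?_
  · intro R hR
    rw [Finset.mem_coe, Finset.mem_filter, Finset.mem_powersetCard] at hR
    rw [Finset.mem_coe, Finset.mem_filter, mem_finsuppAntidiag_univ, hsupp]
    refine ⟨?_, hviol R hR.2⟩
    rw [Finsupp.degree_eq_sum]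
    simp [Finsupp.indicator_apply, hR.1.2]
  · intro R _ R' _ hRR'
    rw [← hsupp R, ← hsupp R']
    exact congrArg Finsupp.support hRR'

end Counting

/-! ### Finiteness of the Helly number -/

section AbstractLattice

variable {E : Type*} [AddCommGroup E] [Module ℝ E]

/-- Convex hulls have the anti-exchange property. -/
lemma eq_of_mem_convexHull_insert {K : Set E} {y w : E} (hy : y ∉ convexHull ℝ K)
    (hw : w ∈ convexHull ℝ (insert y K)) (hyw : y ∈ convexHull ℝ (insert w K)) : w = y := by
  by_contra hne
  refine (convexHull_min ?_ (convex_convexHull_insert_diff hy) hyw).2 rfl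
  refine Set.insert_subset ⟨hw, hne⟩ fun k hk =>
    ⟨subset_convexHull ℝ _ (Set.mem_insert_of_mem _ hk), ?_⟩
  rintro rfl
  exact hy (subset_convexHull ℝ _ hk)

/-- A family of `S`-convex sets without common point, each of whose proper subfamilies has a common
point, has at most `|P|` members if the midpoint of any two points of `S` with the same image in `P`
is in `S`. Inside the finite hull of the common points the sets may be taken as large as possible.
Points `y i` of the intersection of all sets but the `i`-th are chosen next to the `i`-th set; the
midpoint of two of them contradicts maximality. -/
lemma card_le_of_parity {S : Set E} (hfin : ∀ F : Set E, F.Finite → (S ∩ convexHull ℝ F).Finite)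
    {P : Type*} [Fintype P] (par : E → P)
    (hpar : ∀ y ∈ S, ∀ z ∈ S, par y = par z → midpoint ℝ y z ∈ S)
    {ι : Type*} [Fintype ι] (A : ι → Set E) (hA : ∀ i, SConvex S (A i)) (hempty : (⋂ i, A i) = ∅)
    (x : ι → E) (hxS : ∀ i, x i ∈ S) (hx : ∀ i j, i ≠ j → x i ∈ A j) :
    Fintype.card ι ≤ Fintype.card P := by
  classical
  let Ω : Set E := S ∩ convexHull ℝ (Set.range x)
  have hΩ : Ω.Finite := hfin _ (Set.finite_range x)
  have hΩc : SConvex S Ω := sConvex_sHull _ _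
  have hxΩ : ∀ i, x i ∈ Ω := fun i => ⟨hxS i, subset_convexHull ℝ _ ⟨i, rfl⟩⟩
  let 𝒢 : Set (ι → Set E) := {K | (∀ i, SConvex S (K i)) ∧ (∀ i, K i ⊆ Ω) ∧
    (∀ i j, i ≠ j → x i ∈ K j) ∧ (⋂ i, K i) = ∅}
  obtain ⟨K, hK⟩ : ∃ K, Maximal (· ∈ 𝒢) K := by
    refine Set.Finite.exists_maximal ?_ ⟨fun i => A i ∩ Ω, fun i => (hA i).inter hΩc,
      fun i => Set.inter_subset_right, fun i j hij => ⟨hx i j hij, hxΩ i⟩, ?_⟩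
    · refine (Set.Finite.pi fun _ => hΩ.finite_subsets).subset fun K hK i _ => hK.2.1 i
    · rw [← Set.subset_empty_iff, ← hempty]
      exact Set.iInter_mono fun i => Set.inter_subset_left
  obtain ⟨hKc, hKΩ, hxK, hKe⟩ := hK.prop
  let B : ι → Set E := fun i => {p | p ∈ Ω ∧ ∀ l, l ≠ i → p ∈ K l}
  have hy : ∀ i, ∃ y ∈ B i, ∀ p ∈ B i, p ∈ convexHull ℝ (insert y (K i)) →
      y ∈ convexHull ℝ (insert p (K i)) := by
    intro i
    obtain ⟨y, hy⟩ := Set.Finite.exists_minimalFor (fun y => convexHull ℝ (insert y (K i))) (B i)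
      (hΩ.subset fun p hp => hp.1) ⟨x i, hxΩ i, fun l hl => hxK i l hl.symm⟩
    refine ⟨y, hy.1, fun p hp hpy => ?_⟩
    refine hy.2 hp (convexHull_min ?_ (convex_convexHull ℝ _))
      (subset_convexHull ℝ _ (Set.mem_insert y _))
    exact Set.insert_subset hpy ((Set.subset_insert _ _).trans (subset_convexHull ℝ _))
  choose y hyB hymin using hy
  have hyK : ∀ i, y i ∉ K i := by
    intro i hi
    refine Set.notMem_empty (y i) (hKe ▸ Set.mem_iInter.2 fun l => ?_)
    by_cases hl : l = i
    · exact hl ▸ hi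
    · exact (hyB i).2 l hl
  have hyS : ∀ i, y i ∈ S := fun i => (hyB i).1.1
  have hyH : ∀ i, y i ∉ convexHull ℝ (K i) := fun i hi => hyK i ((hKc i).2 ⟨hyS i, hi⟩)
  by_contra! hlt
  obtain ⟨i, j, hij, hpij⟩ := Fintype.exists_ne_map_eq_of_card_lt (fun i => par (y i)) hlt
  have hyij : y i ≠ y j := fun h => hyK i (h ▸ (hyB j).2 i hij)
  let w := midpoint ℝ (y i) (y j)
  have hwS : w ∈ S := hpar _ (hyS i) _ (hyS j) hpij
  have hmid : ∀ C : Set E, Convex ℝ C → y i ∈ C → y j ∈ C → w ∈ C := fun C hC h1 h2 =>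
    hC.segment_subset h1 h2 (midpoint_mem_segment _ _)
  have hwΩ : w ∈ Ω := ⟨hwS, hmid _ (convex_convexHull ℝ _) (hyB i).1.2 (hyB j).1.2⟩
  have hwl : ∀ l, l ≠ i → l ≠ j → w ∈ K l := fun l hli hlj => (hKc l).2 ⟨hwS,
    hmid _ (convex_convexHull ℝ _) (subset_convexHull ℝ _ ((hyB i).2 l hli))
      (subset_convexHull ℝ _ ((hyB j).2 l hlj))⟩
  have hwi : w ≠ y i := fun h => hyij ((midpoint_eq_left_iff ℝ).1 h)
  have hwj : w ≠ y j := fun h => hyij ((midpoint_eq_right_iff ℝ).1 h)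
  have hwyi : w ∈ convexHull ℝ (insert (y i) (K i)) := hmid _ (convex_convexHull ℝ _)
    (subset_convexHull ℝ _ (Set.mem_insert _ _))
    (subset_convexHull ℝ _ (Set.mem_insert_of_mem _ ((hyB j).2 i hij)))
  have hwyj : w ∈ convexHull ℝ (insert (y j) (K j)) := hmid _ (convex_convexHull ℝ _)
    (subset_convexHull ℝ _ (Set.mem_insert_of_mem _ ((hyB i).2 j hij.symm)))
    (subset_convexHull ℝ _ (Set.mem_insert _ _))
  have hwKi : w ∉ K i := by
    intro hw
    refine hwj (eq_of_mem_convexHull_insert (hyH j) hwyj (hymin j w ⟨hwΩ, fun l hl => ?_⟩ hwyj))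
    by_cases hli : l = i
    · exact hli ▸ hw
    · exact hwl l hli hl
  -- enlarging `K i` by `w` must create a common point
  have hcommon : (S ∩ convexHull ℝ (insert w (K i)) ∩ B i).Nonempty := by
    rw [Set.nonempty_iff_ne_empty]
    intro he
    have hup : Function.update K i (S ∩ convexHull ℝ (insert w (K i))) ∈ 𝒢 := by
      have hsub : K i ⊆ S ∩ convexHull ℝ (insert w (K i)) := fun p hp =>
        ⟨(hKc i).1 hp, subset_convexHull ℝ _ (Set.mem_insert_of_mem _ hp)⟩
      have hsubΩ : S ∩ convexHull ℝ (insert w (K i)) ⊆ Ω :=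
        hΩc.sHull_subset (Set.insert_subset hwΩ (hKΩ i))
      refine ⟨fun l => ?_, fun l => ?_, fun l l' hl => ?_, ?_⟩
      · by_cases hli : l = i
        · subst hli
          rw [Function.update_self]
          exact sConvex_sHull _ _
        · rw [Function.update_of_ne hli]
          exact hKc l
      · by_cases hli : l = i
        · subst hli
          rw [Function.update_self]
          exact hsubΩ
        · rw [Function.update_of_ne hli]
          exact hKΩ l
      · by_cases hli : l' = i
        · subst hli
          rw [Function.update_self]
          exact hsub (hxK l l' hl)
        · rw [Function.update_of_ne hli]
          exact hxK l l' hl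
      · rw [Set.eq_empty_iff_forall_notMem]
        intro p hp
        rw [Set.mem_iInter] at hp
        have hpi := hp i
        rw [Function.update_self] at hpi
        refine Set.notMem_empty p (he ▸ ⟨hpi, hsubΩ hpi, fun l hl => ?_⟩)
        have := hp l
        rwa [Function.update_of_ne hl] at this
    have hle : K ≤ Function.update K i (S ∩ convexHull ℝ (insert w (K i))) := by
      rw [le_update_iff]
      exact ⟨fun p hp => ⟨(hKc i).1 hp, subset_convexHull ℝ _ (Set.mem_insert_of_mem _ hp)⟩,
        fun l _ => le_rfl⟩
    have h1 := hK.2 hup hle i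
    rw [Function.update_self] at h1
    exact hwKi (h1 ⟨hwS, subset_convexHull ℝ _ (Set.mem_insert _ _)⟩)
  obtain ⟨p, ⟨hpS, hpw⟩, hpB⟩ := hcommon
  have hpy : p ∈ convexHull ℝ (insert (y i) (K i)) := by
    refine convexHull_min (Set.insert_subset hwyi ?_) (convex_convexHull ℝ _) hpw
    exact (Set.subset_insert _ _).trans (subset_convexHull ℝ _)
  have hpyi : p = y i := eq_of_mem_convexHull_insert (hyH i) hpy (hymin i p hpB hpy)
  exact hwi (eq_of_mem_convexHull_insert (hyH i) hwyi (hpyi ▸ hpw))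

lemma nonempty_biInter_of_forall_fin {X : Type*} [Nonempty X] {m h : ℕ} {K : Fin m → Set X}
    (hK : ∀ i : Fin h → Fin m, (⋂ k, K (i k)).Nonempty) (J : Finset (Fin m)) (hJ : J.card ≤ h) :
    (⋂ j ∈ J, K j).Nonempty := by
  obtain rfl | ⟨j₀, hj₀⟩ := J.eq_empty_or_nonempty
  · simp
  · obtain ⟨p, hp⟩ := hK fun k => if hk : (k : ℕ) < J.card then J.equivFin.symm ⟨k, hk⟩ else j₀
    rw [Set.mem_iInter] at hp
    refine ⟨p, Set.mem_iInter₂.2 fun j hj => ?_⟩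
    have h1 := hp ⟨J.equivFin ⟨j, hj⟩, (Fin.is_lt _).trans_le hJ⟩
    simpa using h1

/-- Doignon's theorem, in the generality of `card_le_of_parity`. -/
lemma hasHellyProperty_of_parity {S : Set E}
    (hfin : ∀ F : Set E, F.Finite → (S ∩ convexHull ℝ F).Finite)
    {P : Type*} [Fintype P] (par : E → P)
    (hpar : ∀ y ∈ S, ∀ z ∈ S, par y = par z → midpoint ℝ y z ∈ S) :
    HasHellyProperty {T : Set E | ∃ K : Set E, Convex ℝ K ∧ T = S ∩ K} (Fintype.card P) := by
  classical
  intro m K hK hmeet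
  have hJ := nonempty_biInter_of_forall_fin hmeet
  have hKc : ∀ j, SConvex S (K j) := by
    intro j
    obtain ⟨C, hC, h⟩ := hK j
    exact h ▸ SConvex.inter_of_convex hC
  by_contra hne
  obtain ⟨J, hJmin⟩ := exists_minimal_of_wellFoundedLT
    (fun J : Finset (Fin m) => ¬ (⋂ j ∈ J, K j).Nonempty) ⟨Finset.univ, by simpa using hne⟩
  have hlt : Fintype.card P < J.card := by
    by_contra! h
    exact hJmin.prop (hJ J h)
  have hP : 0 < Fintype.card P := Fintype.card_pos_iff.2 ⟨par 0⟩
  have hx : ∀ j : J, ∃ x, ∀ l ∈ J.erase (j : Fin m), x ∈ K l := by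
    intro j
    by_contra h
    refine Finset.notMem_erase (j : Fin m) J (hJmin.le_of_le (fun ⟨p, hp⟩ => h ⟨p, fun l hl => ?_⟩)
      (Finset.erase_subset _ _) j.2)
    exact Set.mem_iInter₂.1 hp l hl
  choose x hx using hx
  have hle := card_le_of_parity hfin par hpar (fun j : J => K j) (fun j => hKc j)
    (by
      rw [Set.eq_empty_iff_forall_notMem]
      intro p hp
      exact hJmin.prop ⟨p, Set.mem_iInter₂.2 fun j hj => Set.mem_iInter.1 hp ⟨j, hj⟩⟩) x
    (by
      intro j
      obtain ⟨l, hl⟩ : (J.erase (j : Fin m)).Nonempty := by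
        rw [← Finset.card_pos, Finset.card_erase_of_mem j.2]
        omega
      exact (hKc l).1 (hx j l hl))
    (fun i j hij => hx i j (Finset.mem_erase.2 ⟨fun h => hij (Subtype.ext h.symm), j.2⟩))
  rw [Fintype.card_coe] at hle
  omega

end AbstractLattice

section MixedInteger

/-- The integer points of `ℝ^a`. -/
def latticePoints (a : ℕ) : Set (Fin a → ℝ) :=
  {x | ∀ i, ∃ k : ℤ, x i = (k : ℝ)}

lemma finite_latticePoints_inter_convexHull {a : ℕ} (F : Set (Fin a → ℝ)) (hF : F.Finite) :
    (latticePoints a ∩ convexHull ℝ F).Finite := by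
  obtain ⟨B, hB⟩ := (isBounded_convexHull.2 hF.isBounded).exists_norm_le
  refine ((Set.finite_Icc (fun _ : Fin a => -⌈B⌉) (fun _ => ⌈B⌉)).image
    fun (k : Fin a → ℤ) i => (k i : ℝ)).subset ?_
  rintro x ⟨hx, hxF⟩
  choose k hk using hx
  have hkB : ∀ i, |(k i : ℝ)| ≤ B := fun i => by
    rw [← hk, ← Real.norm_eq_abs]
    exact (norm_le_pi_norm x i).trans (hB x hxF)
  refine ⟨k, ⟨fun i => ?_, fun i => ?_⟩, funext fun i => (hk i).symm⟩
  · have h1 : ((-⌈B⌉ : ℤ) : ℝ) ≤ k i := by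
      push_cast
      linarith [(abs_le.1 (hkB i)).1, Int.le_ceil B]
    exact_mod_cast h1
  · have h1 : (k i : ℝ) ≤ (⌈B⌉ : ℤ) := (abs_le.1 (hkB i)).2.trans (Int.le_ceil B)
    exact_mod_cast h1

lemma exists_hasHellyProperty_latticePoints (a : ℕ) :
    ∃ h, HasHellyProperty
      {T : Set (Fin a → ℝ) | ∃ K : Set (Fin a → ℝ), Convex ℝ K ∧ T = latticePoints a ∩ K} h := by
  refine ⟨_, hasHellyProperty_of_parity (finite_latticePoints_inter_convexHull (a := a))
    (P := Fin a → ZMod 2) (fun x i => (⌊x i⌋ : ZMod 2)) fun y hy z hz hyz i => ?_⟩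
  obtain ⟨k, hk⟩ := hy i
  obtain ⟨l, hl⟩ := hz i
  have h1 := congrFun hyz i
  simp only [hk, hl, Int.floor_intCast] at h1
  obtain ⟨s, hs⟩ := (ZMod.intCast_eq_intCast_iff_dvd_sub k l 2).1 h1
  refine ⟨k + s, ?_⟩
  rw [pi_midpoint_apply, hk, hl, midpoint_eq_smul_add, smul_eq_mul]
  have h2 : (l : ℝ) = k + 2 * s := by
    have h3 : l = k + 2 * s := by
      push_cast at hs
      omega
    exact_mod_cast h3
  rw [h2, invOf_eq_inv]
  push_cast
  ring

/-- The Helly number of `ℤ^a × ℝ^b` is finite: the classical theorem of Helly in the fibres over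
`ℤ^a` reduces the claim to the projections to `ℤ^a` of the intersections of `b + 1` sets. -/
lemma exists_hasHellyProperty_mixedIntegerSet (a b : ℕ) :
    ∃ h, HasHellyProperty {T : Set (MixedSpace a b) | ∃ K : Set (MixedSpace a b),
      Convex ℝ K ∧ T = mixedIntegerSet a b ∩ K} h := by
  classical
  obtain ⟨k, hk⟩ := exists_hasHellyProperty_latticePoints a
  refine ⟨k * (b + 1), fun m K hK hmeet => ?_⟩
  have hJ := nonempty_biInter_of_forall_fin hmeet
  choose C hC hKC using hK
  let D : Finset (Fin m) → Set (Fin a → ℝ) := fun J =>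
    {u | ∃ w : Fin b → ℝ, ∀ j ∈ J, Sum.elim u w ∈ C j}
  have helim : ∀ (s t : ℝ) (u u' : Fin a → ℝ) (w w' : Fin b → ℝ),
      (Sum.elim (s • u + t • u') (s • w + t • w') : MixedSpace a b) =
        s • Sum.elim u w + t • Sum.elim u' w' := by
    intro s t u u' w w'
    ext (i | i) <;> rfl
  have hD : ∀ J, Convex ℝ (D J) := by
    rintro J u ⟨w, hw⟩ u' ⟨w', hw'⟩ s t hs ht hst
    refine ⟨s • w + t • w', fun j hj => ?_⟩
    rw [helim]
    exact hC j (hw j hj) (hw' j hj) hs ht hst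
  obtain ⟨u, hu⟩ := hk.nonempty_iInter (ι := {J : Finset (Fin m) // J.card ≤ b + 1})
    (A := fun J => latticePoints a ∩ D J) (fun J => SConvex.inter_of_convex (hD J)) (by
      intro 𝒥 h𝒥
      have hcard : (𝒥.biUnion Subtype.val).card ≤ k * (b + 1) :=
        (Finset.card_biUnion_le_card_mul _ _ _ fun J _ => J.2).trans
          (Nat.mul_le_mul_right _ h𝒥)
      obtain he | ⟨j, hj⟩ := (𝒥.biUnion Subtype.val).eq_empty_or_nonempty
      · refine ⟨0, Set.mem_iInter₂.2 fun J hJ𝒥 => ⟨fun i => ⟨0, by simp⟩, 0, fun j hj => ?_⟩⟩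
        exact absurd (Finset.mem_biUnion.2 ⟨J, hJ𝒥, hj⟩) (by simp [he])
      · obtain ⟨p, hp⟩ := hJ _ hcard
        rw [Set.mem_iInter₂] at hp
        have hpS : p ∈ mixedIntegerSet a b := (hKC j ▸ hp j hj).1
        refine ⟨p ∘ Sum.inl, Set.mem_iInter₂.2 fun J hJ𝒥 => ⟨hpS, p ∘ Sum.inr, fun l hl => ?_⟩⟩
        rw [Sum.elim_comp_inl_inr]
        have := hp l (Finset.mem_biUnion.2 ⟨J, hJ𝒥, hl⟩)
        rw [hKC l] at this
        exact this.2)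
  rw [Set.mem_iInter] at hu
  obtain ⟨w, hw⟩ := Convex.helly_theorem' (𝕜 := ℝ) (s := Finset.univ)
    (F := fun j : Fin m => {w : Fin b → ℝ | (Sum.elim u w : MixedSpace a b) ∈ C j})
    (by
      intro j _ w hw w' hw' s t hs ht hst
      have h1 := hC j hw hw' hs ht hst
      rw [← helim, ← add_smul, hst, one_smul] at h1
      exact h1)
    (by
      intro J _ hJb
      rw [Module.finrank_fin_fun] at hJb
      obtain ⟨-, w, hw⟩ := hu ⟨J, hJb⟩
      exact ⟨w, Set.mem_iInter₂.2 hw⟩)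
  rw [Set.mem_iInter₂] at hw
  refine ⟨Sum.elim u w, Set.mem_iInter.2 fun j => ?_⟩
  rw [hKC]
  exact ⟨(hu ⟨∅, by simp⟩).1, hw j (Finset.mem_univ j)⟩

lemma hasHellyProperty_mixedHelly (a b : ℕ) :
    HasHellyProperty {T : Set (MixedSpace a b) | ∃ K : Set (MixedSpace a b),
      Convex ℝ K ∧ T = mixedIntegerSet a b ∩ K} (mixedHelly a b) := by
  obtain ⟨h, hh⟩ := exists_hasHellyProperty_mixedIntegerSet a b
  obtain ⟨k, hk, hkH⟩ := csInf_mem (s := {x : ℕ∞ | ∃ h : ℕ, x = (h : ℕ∞) ∧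
    HasHellyProperty {T : Set (MixedSpace a b) | ∃ K : Set (MixedSpace a b),
      Convex ℝ K ∧ T = mixedIntegerSet a b ∩ K} h}) ⟨h, h, rfl, hh⟩
  have h1 : mixedHelly a b = k := by
    rw [mixedHelly, sHellyNumber, hellyNumber, hk, ENat.toNat_natCast]
  exact h1 ▸ hkH

lemma mixedHelly_pos (a b : ℕ) : 0 < mixedHelly a b := by
  rw [Nat.pos_iff_ne_zero]
  intro h0
  have h1 := hasHellyProperty_mixedHelly a b
  rw [h0] at h1
  obtain ⟨p, hp⟩ := h1 1 (fun _ => ∅) (fun _ => ⟨∅, convex_empty, by simp⟩)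
    (fun i => by simp)
  simp at hp

lemma isClosed_mixedIntegerSet (a b : ℕ) : IsClosed (mixedIntegerSet a b) := by
  have h1 : mixedIntegerSet a b =
      ⋂ i : Fin a, (fun x : MixedSpace a b => x (Sum.inl i)) ⁻¹' Set.range ((↑) : ℤ → ℝ) := by
    ext x
    simp [mixedIntegerSet, eq_comm]
  rw [h1]
  exact isClosed_iInter fun i =>
    Int.isClosedEmbedding_coe_real.isClosed_range.preimage (continuous_apply _)

end MixedInteger

/-! ### Asymptotics of the counting bound -/

section Asymptotics

open Filter Topology

lemma succ_mul_multichoose_succ (n k : ℕ) :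
    (k + 1) * n.multichoose (k + 1) = (n + k) * n.multichoose k := by
  cases n with
  | zero => cases k <;> simp
  | succ n =>
    rw [Nat.multichoose_eq, Nat.multichoose_eq, show n + 1 + (k + 1) - 1 = (n + k) + 1 by omega,
      show n + 1 + k - 1 = n + k by omega, show n + 1 + k = (n + k) + 1 by ring]
    linarith [Nat.add_one_mul_choose_eq (n + k) k]

lemma tendsto_multichoose_div_pow {u : ℕ → ℕ} {a : ℝ}
    (hu : Tendsto (fun L : ℕ => (u L : ℝ) / L) atTop (𝓝 a)) (k : ℕ) :
    Tendsto (fun L : ℕ => ((u L).multichoose k : ℝ) / (L : ℝ) ^ k) atTop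
      (𝓝 (a ^ k / (k.factorial : ℝ))) := by
  induction k with
  | zero => simp
  | succ k ih =>
    have h1 : Tendsto (fun L : ℕ => (k : ℝ) / L) atTop (𝓝 0) :=
      tendsto_const_div_atTop_nhds_zero_nat _
    have h2 := ((hu.add h1).mul ih).div_const ((k : ℝ) + 1)
    have h3 : (a + 0) * (a ^ k / (k.factorial : ℝ)) / ((k : ℝ) + 1) =
        a ^ (k + 1) / ((k + 1).factorial : ℝ) := by
      rw [Nat.factorial_succ]
      push_cast
      field_simp
      ring
    rw [h3] at h2
    refine h2.congr' ?_
    filter_upwards [eventually_gt_atTop 0] with L hL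
    have h4 : ((k : ℝ) + 1) * ((u L).multichoose (k + 1) : ℝ) =
        ((u L : ℝ) + k) * ((u L).multichoose k : ℝ) := by
      exact_mod_cast succ_mul_multichoose_succ (u L) k
    have hL' : (L : ℝ) ≠ 0 := by positivity
    have hk : (k : ℝ) + 1 ≠ 0 := by positivity
    rw [div_eq_iff hk, ← add_div, div_mul_div_comm, ← h4, pow_succ']
    field_simp

/-- The comparison of `M` samples with `L` further ones yields the binomial tail as `L → ∞`. -/
lemma le_binomialTail_of_le_sparseCount {d M : ℕ} (hM : d ≤ M) {p ε C : ℝ} (hε : 0 < ε)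
    (hε1 : ε ≤ 1)
    (h : ∀ L : ℕ, 0 < L → p * (1 - C / L) * ((M + L).choose M : ℝ) ≤
      (sparseCount d (M + L) ⌈ε * L⌉₊ M : ℝ)) :
    p ≤ binomialTail (d + 1) M ε := by
  have hid : Tendsto (fun L : ℕ => (L : ℝ) / L) atTop (𝓝 1) := by
    refine tendsto_const_nhds.congr' ?_
    filter_upwards [eventually_gt_atTop 0] with L hL
    rw [div_self (by positivity)]
  have hv : Tendsto (fun L : ℕ => ((⌈ε * L⌉₊ : ℕ) : ℝ) / L) atTop (𝓝 ε) :=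
    (tendsto_nat_ceil_mul_div_atTop hε.le).comp tendsto_natCast_atTop_atTop
  have hMd : Tendsto (fun L : ℕ => (M : ℝ) / L) atTop (𝓝 0) :=
    tendsto_const_div_atTop_nhds_zero_nat _
  have hw : Tendsto (fun L : ℕ => ((M + L - ⌈ε * L⌉₊ : ℕ) : ℝ) / L) atTop (𝓝 (1 - ε)) := by
    have h1 := (hMd.add hid).sub hv
    rw [zero_add] at h1
    refine h1.congr fun L => ?_
    have h2 : ⌈ε * L⌉₊ ≤ M + L := by
      refine (Nat.ceil_le.2 ?_).trans (Nat.le_add_left L M)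
      exact mul_le_of_le_one_left (Nat.cast_nonneg L) hε1
    rw [Nat.cast_sub h2]
    push_cast
    ring
  have hu : Tendsto (fun L : ℕ => ((L + 1 : ℕ) : ℝ) / L) atTop (𝓝 1) := by
    have h1 := hid.add (tendsto_const_div_atTop_nhds_zero_nat (1 : ℝ))
    rw [add_zero] at h1
    refine h1.congr fun L => ?_
    push_cast
    ring
  have hC : Tendsto (fun L : ℕ => C / L) atTop (𝓝 0) :=
    tendsto_const_div_atTop_nhds_zero_nat _
  have hleft := ((tendsto_const_nhds (x := p)).mul ((tendsto_const_nhds (x := (1 : ℝ))).sub hC)).mul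
    (tendsto_multichoose_div_pow hu M)
  have hright := tendsto_finsetSum (Finset.range d) fun l _ =>
    (tendsto_multichoose_div_pow hv l).mul (tendsto_multichoose_div_pow hw (M - l))
  have hlim := le_of_tendsto_of_tendsto hleft hright (by
    filter_upwards [eventually_gt_atTop 0] with L hL
    have hL' : (0 : ℝ) < L := by positivity
    have h1 := h L hL
    have h2 : ((M + L).choose M : ℝ) = ((L + 1).multichoose M : ℝ) := by
      rw [Nat.multichoose_eq, show L + 1 + M - 1 = M + L by omega]
    have h3 : ∑ l ∈ Finset.range d, ((⌈ε * L⌉₊.multichoose l : ℕ) : ℝ) / (L : ℝ) ^ l *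
        (((M + L - ⌈ε * L⌉₊).multichoose (M - l) : ℝ) / (L : ℝ) ^ (M - l)) =
        (sparseCount d (M + L) ⌈ε * L⌉₊ M : ℝ) / (L : ℝ) ^ M := by
      rw [sparseCount]
      push_cast
      rw [Finset.sum_div]
      refine Finset.sum_congr rfl fun l hl => ?_
      rw [Finset.mem_range] at hl
      rw [div_mul_div_comm, ← pow_add, Nat.add_sub_cancel' (by omega)]
    rw [h3, mul_div_assoc', ← h2]
    gcongr)
  have hM0 : (0 : ℝ) < (M.factorial : ℝ) := by exact_mod_cast Nat.factorial_pos M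
  rw [sub_zero, mul_one, one_pow, mul_one_div, div_le_iff₀ hM0, Finset.sum_mul] at hlim
  refine hlim.trans (le_of_eq ?_)
  rw [binomialTail, Nat.add_sub_cancel]
  refine Finset.sum_congr rfl fun l hl => ?_
  rw [Finset.mem_range] at hl
  have hlM : l ≤ M := by omega
  rw [Nat.cast_choose ℝ hlM]
  field_simp

end Asymptotics

/-! ### Random samples -/

section Sampling

open ProbabilityTheory

variable {Q : Type*} [MeasurableSpace Q] (μ : Measure Q) [IsProbabilityMeasure μ]

lemma measurePreserving_comp_injective {A B : Type*} [Fintype A] [Fintype B] {e : B → A}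
    (he : Function.Injective e) :
    MeasurePreserving (fun T : A → Q => T ∘ e) (Measure.pi fun _ => μ) (Measure.pi fun _ => μ) := by
  have hm : Measurable (fun T : A → Q => T ∘ e) :=
    measurable_pi_lambda _ fun b => measurable_pi_apply (e b)
  refine ⟨hm, (Measure.pi_eq fun s hs => ?_).symm⟩
  have h1 : (fun T : A → Q => T ∘ e) ⁻¹' Set.univ.pi s =
      Set.univ.pi fun a => ⋂ b, ⋂ (_ : e b = a), s b := by
    ext T
    simp only [Set.mem_preimage, Set.mem_univ_pi, Function.comp_apply, Set.mem_iInter]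
    exact ⟨fun h a b hb => hb ▸ h b, fun h b => h (e b) b rfl⟩
  rw [Measure.map_apply hm (MeasurableSet.univ_pi hs), h1, Measure.pi_pi]
  refine (Fintype.prod_of_injective e he _ _ (fun a ha => ?_) fun b => ?_).symm
  · have h2 : (⋂ b, ⋂ (_ : e b = a), s b) = Set.univ :=
      Set.iInter_eq_univ.2 fun b => Set.iInter_eq_univ.2 fun hb => absurd ⟨b, hb⟩ ha
    rw [h2, measure_univ]
  · congr 1
    ext q
    simp only [Set.mem_iInter]
    exact ⟨fun h b' hb' => he hb' ▸ h, fun h => h b rfl⟩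

/-- A set hit with probability more than `ε` is hit by a fraction of at least `ε` of many samples,
with high probability (Chebyshev). -/
lemma one_sub_le_measure_count {A : Set Q} (hA : MeasurableSet A) {ε ε' : ℝ} (hεε' : ε < ε')
    (hAε : ε' ≤ μ.real A) {L : ℕ} (hL : 0 < L) :
    1 - 1 / (ε' - ε) ^ 2 / L ≤ (Measure.pi fun _ : Fin L => μ).real
      {T | ⌈ε * L⌉₊ ≤ {l | T l ∈ A}.ncard} := by
  classical
  let P : Measure (Fin L → Q) := Measure.pi fun _ => μ
  let Y : Q → ℝ := A.indicator 1
  have hY : Measurable Y := measurable_one.indicator hA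
  have hY01 : ∀ q, Y q ∈ Set.Icc (0 : ℝ) 1 := fun q =>
    ⟨Set.indicator_nonneg (fun _ _ => zero_le_one) q,
      Set.indicator_le_self' (fun _ _ => zero_le_one) q⟩
  let X : Fin L → (Fin L → Q) → ℝ := fun l T => Y (T l)
  have hX : ∀ l, Measurable (X l) := fun l => hY.comp (measurable_pi_apply l)
  have hX01 : ∀ l, ∀ᵐ T ∂P, X l T ∈ Set.Icc (0 : ℝ) 1 := fun l => ae_of_all _ fun T => hY01 _
  have hXmem : ∀ l, MemLp (X l) 2 P := fun l =>
    memLp_of_bounded (hX01 l) (hX l).aestronglyMeasurable 2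
  have hmean : ∀ l, P[X l] = μ.real A := by
    intro l
    have h1 : ∫ T, Y (T l) ∂P = ∫ q, Y q ∂μ :=
      ((measurePreserving_eval (fun _ : Fin L => μ) l).map_eq ▸
        integral_map (measurable_pi_apply l).aemeasurable hY.aestronglyMeasurable).symm
    exact h1.trans (integral_indicator_one hA)
  have hvar : variance (∑ l, X l) P ≤ L := by
    rw [IndepFun.variance_sum (fun l _ => hXmem l) fun l _ l' _ hll' =>
      (iIndepFun_pi (μ := fun _ : Fin L => μ) (X := fun _ => Y)
        fun _ => hY.aemeasurable).indepFun hll']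
    refine (Finset.sum_le_sum fun l _ => (variance_le_sq_of_bounded (hX01 l)
      (hX l).aemeasurable).trans (by norm_num : ((1 - 0 : ℝ) / 2) ^ 2 ≤ 1)).trans ?_
    simp
  have hsum : P[∑ l, X l] = L * μ.real A := by
    have h1 : ∫ T, (∑ l, X l) T ∂P = ∑ l, ∫ T, X l T ∂P := by
      simp only [Finset.sum_apply]
      exact integral_finsetSum _ fun l _ => (hXmem l).integrable one_le_two
    rw [h1, Finset.sum_congr rfl fun l _ => hmean l]
    simp
  have hcount : ∀ T : Fin L → Q, ({l | T l ∈ A}.ncard : ℝ) = (∑ l, X l) T := by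
    intro T
    rw [Set.ncard_eq_toFinset_card', Finset.sum_apply]
    simp [X, Y, Set.indicator_apply]
  have hL' : (0 : ℝ) < L := by positivity
  have hη : 0 < ε' - ε := sub_pos.2 hεε'
  have hmeas : MeasurableSet {T : Fin L → Q | ⌈ε * L⌉₊ ≤ {l | T l ∈ A}.ncard} := by
    have h1 : {T : Fin L → Q | ⌈ε * L⌉₊ ≤ {l | T l ∈ A}.ncard} =
        {T | (⌈ε * L⌉₊ : ℝ) ≤ (∑ l, X l) T} := by
      ext T
      rw [Set.mem_ofPred_eq, Set.mem_ofPred_eq, ← hcount, Nat.cast_le]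
    rw [h1]
    have h2 : Measurable (∑ l, X l) := by
      rw [Finset.sum_fn]
      exact Finset.measurable_sum _ fun l _ => hX l
    exact measurableSet_le measurable_const h2
  have hcheb := meas_ge_le_variance_div_sq (memLp_finsetSum' Finset.univ fun l _ => hXmem l)
    (mul_pos hL' hη)
  have hsub : {T : Fin L → Q | ⌈ε * L⌉₊ ≤ {l | T l ∈ A}.ncard}ᶜ ⊆
      {T | L * (ε' - ε) ≤ |(∑ l, X l) T - P[∑ l, X l]|} := by
    intro T hT
    rw [Set.mem_compl_iff, Set.mem_ofPred_eq, not_le, Nat.lt_ceil, hcount] at hT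
    rw [Set.mem_ofPred_eq, hsum, abs_sub_comm]
    refine le_trans ?_ (le_abs_self _)
    nlinarith
  have hle : P.real {T : Fin L → Q | ⌈ε * L⌉₊ ≤ {l | T l ∈ A}.ncard}ᶜ ≤
      1 / (ε' - ε) ^ 2 / L := by
    refine ENNReal.toReal_le_of_le_ofReal (by positivity) ((measure_mono hsub).trans
      (hcheb.trans (ENNReal.ofReal_le_ofReal ?_)))
    calc variance (∑ l, X l) P / (L * (ε' - ε)) ^ 2 ≤ L / (L * (ε' - ε)) ^ 2 := by gcongr
      _ = 1 / (ε' - ε) ^ 2 / L := by field_simp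
  rw [probReal_compl_eq_one_sub hmeas] at hle
  linarith

lemma measurableSet_le_ncard {X : Type*} [MeasurableSpace X] {V : Set (X × Q)}
    (hV : MeasurableSet V) (L v : ℕ) :
    MeasurableSet {z : X × (Fin L → Q) | v ≤ {l | (z.1, z.2 l) ∈ V}.ncard} := by
  classical
  have h1 : {z : X × (Fin L → Q) | v ≤ {l | (z.1, z.2 l) ∈ V}.ncard} =
      ⋃ s ∈ (Finset.univ.powerset : Finset (Finset (Fin L))).filter fun s => v ≤ s.card,
        ⋂ l ∈ s, {z | (z.1, z.2 l) ∈ V} := by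
    ext z
    simp only [Set.mem_ofPred_eq, Set.mem_iUnion, Set.mem_iInter, exists_prop, Finset.mem_filter,
      Finset.mem_powerset, Finset.subset_univ, true_and]
    constructor
    · intro h
      refine ⟨Finset.univ.filter fun l => (z.1, z.2 l) ∈ V, ?_, fun l hl =>
        (Finset.mem_filter.1 hl).2⟩
      rwa [← Set.ncard_coe_finset, Finset.coe_filter_univ]
    · rintro ⟨s, hs, hsV⟩
      rw [← Set.ncard_coe_finset] at hs
      exact hs.trans (Set.ncard_le_ncard (fun l hl => hsV l hl) (Set.toFinite _))
  rw [h1]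
  refine Finset.measurableSet_biUnion _ fun s _ => Finset.measurableSet_biInter _ fun l _ => ?_
  exact hV.preimage (measurable_fst.prodMk ((measurable_pi_apply l).comp measurable_snd))

lemma measure_mul_le_measure_count {X : Type*} [MeasurableSpace X] (ρ : Measure X)
    [IsProbabilityMeasure ρ] {V : Set (X × Q)} (hV : MeasurableSet V) {ε ε' : ℝ} (hεε' : ε < ε')
    {L : ℕ} (hL : 0 < L) :
    ρ.real {x | ε' ≤ μ.real {q | (x, q) ∈ V}} * (1 - 1 / (ε' - ε) ^ 2 / L) ≤
      (ρ.prod (Measure.pi fun _ : Fin L => μ)).real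
        {z | ⌈ε * L⌉₊ ≤ {l | (z.1, z.2 l) ∈ V}.ncard} := by
  obtain h0 | h0 := le_or_gt (1 - 1 / (ε' - ε) ^ 2 / L) 0
  · exact (mul_nonpos_of_nonneg_of_nonpos measureReal_nonneg h0).trans measureReal_nonneg
  have hE := measurableSet_le_ncard hV L ⌈ε * L⌉₊
  rw [← ENNReal.ofReal_le_ofReal_iff measureReal_nonneg, ENNReal.ofReal_mul measureReal_nonneg,
    ofReal_measureReal, ofReal_measureReal, Measure.prod_apply hE]
  have hB : MeasurableSet {x | ε' ≤ μ.real {q | (x, q) ∈ V}} :=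
    measurableSet_le measurable_const (measurable_measure_prodMk_left hV).ennreal_toReal
  calc ρ {x | ε' ≤ μ.real {q | (x, q) ∈ V}} * ENNReal.ofReal (1 - 1 / (ε' - ε) ^ 2 / L)
      = ∫⁻ _ in {x | ε' ≤ μ.real {q | (x, q) ∈ V}},
          ENNReal.ofReal (1 - 1 / (ε' - ε) ^ 2 / L) ∂ρ := by
        rw [setLIntegral_const, mul_comm]
    _ ≤ ∫⁻ x in {x | ε' ≤ μ.real {q | (x, q) ∈ V}}, (Measure.pi fun _ : Fin L => μ)
          (Prod.mk x ⁻¹' {z | ⌈ε * L⌉₊ ≤ {l | (z.1, z.2 l) ∈ V}.ncard}) ∂ρ := by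
        refine setLIntegral_mono' hB fun x hx => ?_
        rw [← ofReal_measureReal]
        exact ENNReal.ofReal_le_ofReal (one_sub_le_measure_count μ (A := {q | (x, q) ∈ V})
          (hV.preimage measurable_prodMk_left) hεε' hx hL)
    _ ≤ _ := setLIntegral_le_lintegral _ _

end Sampling

/-! ### Sampled problems and their violation sets -/

section SampledProblems

variable {dZ dR n : ℕ} {Q : Type*} {J : Type}

/-- The points of `S` which satisfy the sampled constraints with index in `T`; the sample with index
`k` belongs to the agent `a k`. -/
def feasibleSet (f : Fin n → MixedSpace dZ dR → Q → ℝ) (a : J → Fin n) (q : J → Q)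
    (T : Finset J) : Set (MixedSpace dZ dR) :=
  {x | x ∈ mixedIntegerSet dZ dR ∧ ∀ k ∈ T, f (a k) x (q k) ≤ 0}

/-- The constraint functions of the agent `i` in the sampled constraints with index in `B`. -/
def constraintTypes (f : Fin n → MixedSpace dZ dR → Q → ℝ) (i : Fin n) (q : J → Q)
    (B : Finset J) : Set (MixedSpace dZ dR → ℝ) :=
  (fun k x => f i x (q k)) '' B

/-- Every subproblem with at least `d` different constraint functions of a single agent has exactly
one minimum point. -/
def UniquelySolvable (d : ℕ) (c : MixedSpace dZ dR) (f : Fin n → MixedSpace dZ dR → Q → ℝ)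
    (a : J → Fin n) (q : J → Q) : Prop :=
  ∀ (T B : Finset J) (i : Fin n), B ⊆ T → (∀ k ∈ B, a k = i) → d ≤ (constraintTypes f i q B).ncard →
    ∃ x ∈ feasibleSet f a q T, ∀ y ∈ feasibleSet f a q T, c ⬝ᵥ y ≤ c ⬝ᵥ x → y = x

/-- The further samples `r` whose constraint for the agent `i` is violated at the minimum point of
the problem sampled by `q`, jointly with `q`. That the minimum point is lost is expressed by means
of a rational bound on the objective. With fewer than `d` constraint functions of the agent among
the samples in `B`, the samples with a new constraint function are taken instead. -/
def violationSet (d : ℕ) (c : MixedSpace dZ dR) (f : Fin n → MixedSpace dZ dR → Q → ℝ)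
    (a : J → Fin n) [Fintype J] (B : Finset J) (i : Fin n) : Set ((J → Q) × Q) :=
  {z | (d ≤ (constraintTypes f i z.1 B).ncard ∧
      ∃ t : ℚ, (∃ x ∈ feasibleSet f a z.1 Finset.univ, c ⬝ᵥ x ≤ t) ∧
        ¬ ∃ x ∈ feasibleSet f a z.1 Finset.univ, f i x z.2 ≤ 0 ∧ c ⬝ᵥ x ≤ t) ∨
    (¬ d ≤ (constraintTypes f i z.1 B).ncard ∧ (fun x => f i x z.2) ∉ constraintTypes f i z.1 B)}

lemma isClosed_feasibleSet {f : Fin n → MixedSpace dZ dR → Q → ℝ}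
    (hf : ∀ i q, Continuous fun x => f i x q) (a : J → Fin n) (q : J → Q) (T : Finset J) :
    IsClosed (feasibleSet f a q T) := by
  have h1 : feasibleSet f a q T =
      mixedIntegerSet dZ dR ∩ ⋂ k ∈ T, {x | f (a k) x (q k) ≤ 0} := by
    ext x
    simp [feasibleSet]
  rw [h1]
  exact (isClosed_mixedIntegerSet dZ dR).inter
    (isClosed_biInter fun k _ => isClosed_le (hf _ _) continuous_const)

lemma continuous_of_convexOn {f : MixedSpace dZ dR → ℝ} (hf : ConvexOn ℝ Set.univ f) :
    Continuous f :=
  continuousOn_univ.1 (hf.continuousOn isOpen_univ)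

/-- The places in `B` and `L` further ones, among all places and `L` further ones. -/
def sampleEmbedding (B : Finset J) (L : ℕ) : B ⊕ Fin L ↪ J ⊕ Fin L :=
  Function.Embedding.sumMap (Function.Embedding.subtype (· ∈ B)) (Function.Embedding.refl (Fin L))

/-- The counting theorem for a single large sample `w`, in which the constraints of the other agents
restrict `S`. For each choice of `|B|` samples `R` of the agent, `w` is rearranged so that those in
`R` come to the places in `B`, and the number of violated further samples is considered. -/
lemma card_rearrangements_le {f : Fin n → MixedSpace dZ dR → Q → ℝ} {c : MixedSpace dZ dR}
    (hconv : ∀ i q, ConvexOn ℝ Set.univ fun x => f i x q) {d : ℕ} (hd : mixedHelly dZ dR = d + 1)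
    [Fintype J] [DecidableEq J] (a : J → Fin n) (B : Finset J) (i : Fin n) (hB : ∀ k ∈ B, a k = i)
    {L v : ℕ} (hv : 0 < v) (hvN : v ≤ B.card + L) (hdB : d ≤ B.card)
    (e : Finset (B ⊕ Fin L) → Equiv.Perm (B ⊕ Fin L))
    (he : ∀ R : Finset (B ⊕ Fin L), R.card = B.card →
      R = Finset.univ.image fun k : B => e R (Sum.inl k))
    (w : J ⊕ Fin L → Q) (hw : UniquelySolvable d c f (Sum.elim a fun _ => i) w) :
    {R | R ∈ (Finset.univ.powersetCard B.card : Finset (Finset (B ⊕ Fin L))) ∧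
      v ≤ {l | ((fun k => w ((e R).viaEmbedding (sampleEmbedding B L) (Sum.inl k))),
        w ((e R).viaEmbedding (sampleEmbedding B L) (Sum.inr l))) ∈
          violationSet d c f a B i}.ncard}.ncard ≤ sparseCount d (B.card + L) v B.card := by
  classical
  let j : B ⊕ Fin L ↪ J ⊕ Fin L := sampleEmbedding B L
  let aI : J ⊕ Fin L → Fin n := Sum.elim a fun _ => i
  have haj : ∀ k, aI (j k) = i := by
    rintro (k | l)
    · exact hB k k.2
    · rfl
  -- the places outside `B` count with the other agents and are kept fixed
  let others : Finset (J ⊕ Fin L) := (Finset.univ \ B).image Sum.inl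
  let S := feasibleSet f aI w others
  let C : Set (MixedSpace dZ dR) := {x | ∀ k ∈ others, f (aI k) x (w k) ≤ 0}
  have hC : Convex ℝ C := by
    intro x hx y hy s t hs ht hst k hk
    exact (((hconv (aI k) (w k)).convex_le 0) ⟨trivial, hx k hk⟩ ⟨trivial, hy k hk⟩ hs ht hst).2
  have hSC : S = mixedIntegerSet dZ dR ∩ C := rfl
  have hh : HasHellyProperty {T : Set (MixedSpace dZ dR) | ∃ K : Set (MixedSpace dZ dR),
      Convex ℝ K ∧ T = S ∩ K} (d + 1) := by
    intro m K hK
    refine hd ▸ hasHellyProperty_mixedHelly dZ dR m K fun l => ?_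
    obtain ⟨K', hK', h⟩ := hK l
    exact ⟨C ∩ K', hC.inter hK', by rw [h, hSC, Set.inter_assoc]⟩
  let K : B ⊕ Fin L → Set (MixedSpace dZ dR) := fun r => S ∩ {x | f i x (w (j r)) ≤ 0}
  have hK : ∀ r, SConvex S (K r) := fun r => SConvex.inter_of_convex <| by
    have := (hconv i (w (j r))).convex_le 0
    simpa using this
  let Φ : B ⊕ Fin L → MixedSpace dZ dR → ℝ := fun r x => f i x (w (j r))
  have hΦ : ∀ r r', Φ r = Φ r' → K r = K r' := by
    intro r r' h
    change S ∩ {x | Φ r x ≤ 0} = S ∩ {x | Φ r' x ≤ 0}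
    rw [h]
  have htypes : ∀ R : Finset (B ⊕ Fin L),
      constraintTypes f i w (R.map j) = ((R.image Φ : Finset _) : Set (MixedSpace dZ dR → ℝ)) := by
    intro R
    rw [constraintTypes, Finset.coe_map, Set.image_image, Finset.coe_image]
  have hfeas : ∀ (R : Finset (B ⊕ Fin L)) x, x ∈ feasibleSet f aI w (others ∪ R.map j) ↔
      x ∈ S ∧ ∀ r ∈ R, x ∈ K r := by
    intro R x
    constructor
    · intro hx
      have hxS : x ∈ S := ⟨hx.1, fun k hk => hx.2 k (Finset.mem_union_left _ hk)⟩
      refine ⟨hxS, fun r hr => ⟨hxS, ?_⟩⟩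
      have := hx.2 (j r) (Finset.mem_union_right _ (Finset.mem_map_of_mem j hr))
      rwa [haj] at this
    · rintro ⟨hxS, hx⟩
      refine ⟨hxS.1, fun k hk => ?_⟩
      obtain hk | hk := Finset.mem_union.1 hk
      · exact hxS.2 k hk
      · obtain ⟨r, hr, rfl⟩ := Finset.mem_map.1 hk
        rw [haj]
        exact (hx r hr).2
  have hx : ∀ R : Finset (B ⊕ Fin L), ∃ x, d ≤ (R.image Φ).card → x ∈ S ∧ (∀ r ∈ R, x ∈ K r) ∧
      ∀ y ∈ S, (∀ r ∈ R, y ∈ K r) → c ⬝ᵥ y ≤ c ⬝ᵥ x → y = x := by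
    intro R
    by_cases h : d ≤ (R.image Φ).card
    · obtain ⟨x, hx, hxu⟩ := hw (others ∪ R.map j) (R.map j) i Finset.subset_union_right
        (fun k hk => by
          obtain ⟨r, -, rfl⟩ := Finset.mem_map.1 hk
          exact haj r)
        (by rwa [htypes, Set.ncard_coe_finset])
      exact ⟨x, fun _ => ⟨((hfeas R x).1 hx).1, ((hfeas R x).1 hx).2,
        fun y hyS hyK => hxu y ((hfeas R y).2 ⟨hyS, hyK⟩)⟩⟩
    · exact ⟨0, fun h' => absurd h' h⟩
  choose x hx using hx
  have hcount := card_violators_le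
    (isClosed_feasibleSet (fun i q => continuous_of_convexOn (hconv i q)) aI w others) hh Φ K hK hΦ
    (dotProductBilin ℝ ℝ c) x hx hv (M := B.card) (by simpa using hvN) hdB
  rw [Fintype.card_sum, Fintype.card_coe, Fintype.card_fin] at hcount
  refine le_trans ?_ hcount
  refine (Set.ncard_le_ncard ?_ (Finset.finite_toSet _)).trans (Set.ncard_coe_finset _).le
  rintro R ⟨hR, hRv⟩
  rw [Finset.mem_coe, Finset.mem_filter]
  refine ⟨hR, hRv.trans ?_⟩
  have hReq := he R (Finset.mem_powersetCard.1 hR).2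
  have hσ : ∀ r, (e R).viaEmbedding j (j r) = j (e R r) := fun r =>
    Equiv.Perm.viaEmbedding_apply _ _ _
  have hσ' : ∀ k, k ∉ B → (e R).viaEmbedding j (Sum.inl k) = Sum.inl k := fun k hk =>
    Equiv.Perm.viaEmbedding_apply_of_notMem _ _ _ (by
      rintro ⟨k' | l, h⟩
      · exact hk (Sum.inl_injective h ▸ k'.2)
      · exact absurd h (by simp [j, sampleEmbedding]))
  let q' : J → Q := fun k => w ((e R).viaEmbedding j (Sum.inl k))
  have htypes' : constraintTypes f i q' B =
      ((R.image Φ : Finset _) : Set (MixedSpace dZ dR → ℝ)) := by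
    ext g
    rw [Finset.mem_coe, Finset.mem_image]
    constructor
    · rintro ⟨k, hk, rfl⟩
      refine ⟨e R (Sum.inl ⟨k, hk⟩), ?_, ?_⟩
      · exact hReq.ge (Finset.mem_image_of_mem _ (Finset.mem_univ _))
      · change (fun x => f i x (w (j (e R (Sum.inl ⟨k, hk⟩))))) = _
        rw [← hσ]
        rfl
    · rintro ⟨r, hr, rfl⟩
      rw [hReq, Finset.mem_image] at hr
      obtain ⟨k, -, rfl⟩ := hr
      refine ⟨k, k.2, ?_⟩
      change _ = fun x => f i x (w (j (e R (Sum.inl k))))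
      rw [← hσ]
      rfl
  have hfeas' : ∀ y, y ∈ feasibleSet f a q' Finset.univ ↔ y ∈ S ∧ ∀ r ∈ R, y ∈ K r := by
    intro y
    constructor
    · intro hy
      have hyS : y ∈ S := by
        refine ⟨hy.1, fun k hk => ?_⟩
        obtain ⟨k', hk', rfl⟩ := Finset.mem_image.1 hk
        have := hy.2 k' (Finset.mem_univ k')
        rwa [show q' k' = w (Sum.inl k') from
          congrArg w (hσ' k' (Finset.mem_sdiff.1 hk').2)] at this
      refine ⟨hyS, fun r hr => ⟨hyS, ?_⟩⟩
      rw [hReq, Finset.mem_image] at hr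
      obtain ⟨k, -, rfl⟩ := hr
      have := hy.2 k (Finset.mem_univ _)
      rw [hB k k.2] at this
      rw [Set.mem_ofPred_eq, ← hσ]
      exact this
    · rintro ⟨hyS, hy⟩
      refine ⟨hyS.1, fun k _ => ?_⟩
      by_cases hk : k ∈ B
      · have h1 := (hy (e R (Sum.inl ⟨k, hk⟩))
          (hReq.ge (Finset.mem_image_of_mem _ (Finset.mem_univ _)))).2
        rw [Set.mem_ofPred_eq, ← hσ] at h1
        rw [hB k hk]
        exact h1
      · have h1 := hyS.2 (Sum.inl k) (Finset.mem_image_of_mem _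
          (Finset.mem_sdiff.2 ⟨Finset.mem_univ k, hk⟩))
        rwa [show q' k = w (Sum.inl k) from congrArg w (hσ' k hk)]
  have hmaps : ∀ l, (q', w ((e R).viaEmbedding j (Sum.inr l))) ∈ violationSet d c f a B i →
      e R (Sum.inr l) ∈ violators Φ K d x R := by
    intro l hl
    rw [show (e R).viaEmbedding j (Sum.inr l) = j (e R (Sum.inr l)) from hσ (Sum.inr l)] at hl
    simp only [violationSet, Set.mem_ofPred_eq, htypes', Set.ncard_coe_finset] at hl
    obtain ⟨hdR, t, ⟨y, hy, hyt⟩, hno⟩ | ⟨hdR, hnew⟩ := hl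
    · refine (mem_violators_of_le hdR).2 fun hxK => hno ⟨x R, ?_, hxK.2, ?_⟩
      · exact (hfeas' _).2 ⟨(hx R hdR).1, (hx R hdR).2.1⟩
      · by_contra! hlt
        have h1 := (hx R hdR).2.2 y ((hfeas' y).1 hy).1 ((hfeas' y).1 hy).2
          (hyt.trans hlt.le)
        rw [h1] at hyt
        exact absurd hyt (not_le.2 hlt)
    · exact (mem_violators_of_not_le hdR).2 fun h => hnew (Finset.mem_coe.2 h)
  refine (Set.ncard_le_ncard_of_injOn (fun l => e R (Sum.inr l)) (fun l hl => hmaps l hl) ?_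
    (Finset.finite_toSet _)).trans (Set.ncard_coe_finset _).le
  intro l _ l' _ hll'
  exact Sum.inr_injective ((e R).injective hll')

variable {f : Fin n → MixedSpace dZ dR → Q → ℝ} {c : MixedSpace dZ dR}

/-- An optimal solution which violates a further constraint witnesses membership in the violation
set. -/
lemma mem_violationSet [Fintype J] {d : ℕ} {a : J → Fin n} {B : Finset J} {i : Fin n} (hB : ∀ k ∈ B, a k = i)
    {q : J → Q} {r : Q}
    (hsolv : UniquelySolvable d c f (Sum.elim a fun _ : Unit => i) (Sum.elim q fun _ => r))
    {x : MixedSpace dZ dR} (hx : x ∈ feasibleSet f a q Finset.univ)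
    (hmin : ∀ y ∈ feasibleSet f a q Finset.univ, c ⬝ᵥ x ≤ c ⬝ᵥ y) (hr : ¬ f i x r ≤ 0) :
    (q, r) ∈ violationSet d c f a B i := by
  classical
  by_cases hd : d ≤ (constraintTypes f i q B).ncard
  swap
  · refine Or.inr ⟨hd, ?_⟩
    rintro ⟨k, hk, hkr⟩
    apply hr
    rw [← congrFun hkr x, ← hB k hk]
    exact hx.2 k (Finset.mem_univ k)
  refine Or.inl ⟨hd, ?_⟩
  have htypes : constraintTypes f i (Sum.elim q fun _ : Unit => r) (B.image Sum.inl) =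
      constraintTypes f i q B := by
    rw [constraintTypes, Finset.coe_image, Set.image_image]
    rfl
  have hB' : ∀ k ∈ B.image Sum.inl, (Sum.elim a fun _ : Unit => i) k = i := by
    intro k hk
    obtain ⟨l, hl, rfl⟩ := Finset.mem_image.1 hk
    exact hB l hl
  have hfeas₁ : ∀ y, y ∈ feasibleSet f (Sum.elim a fun _ : Unit => i) (Sum.elim q fun _ => r)
      (Finset.univ.image Sum.inl) ↔ y ∈ feasibleSet f a q Finset.univ := by
    intro y
    simp [feasibleSet]
  have hfeas₂ : ∀ y, y ∈ feasibleSet f (Sum.elim a fun _ : Unit => i) (Sum.elim q fun _ => r)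
      Finset.univ ↔ y ∈ feasibleSet f a q Finset.univ ∧ f i y r ≤ 0 := by
    intro y
    simp [feasibleSet, and_assoc]
    tauto
  obtain ⟨x₁, hx₁, hx₁u⟩ := hsolv (Finset.univ.image Sum.inl) (B.image Sum.inl) i
    (Finset.image_subset_image (Finset.subset_univ B)) hB' (htypes ▸ hd)
  obtain ⟨x₂, hx₂, hx₂u⟩ := hsolv Finset.univ (B.image Sum.inl) i (Finset.subset_univ _) hB'
    (htypes ▸ hd)
  rw [hfeas₁] at hx₁
  rw [hfeas₂] at hx₂
  have hxx₁ : x = x₁ := hx₁u x ((hfeas₁ x).2 hx) (hmin x₁ hx₁)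
  have hlt : c ⬝ᵥ x < c ⬝ᵥ x₂ := by
    by_contra! hle
    have h1 := hx₁u x₂ ((hfeas₁ x₂).2 hx₂.1) (hxx₁ ▸ hle)
    exact hr (hxx₁ ▸ h1 ▸ hx₂.2)
  obtain ⟨t, hxt, htx₂⟩ := exists_rat_btwn hlt
  refine ⟨t, ⟨x, hx, hxt.le⟩, ?_⟩
  rintro ⟨y, hy, hyr, hyt⟩
  have h1 := hx₂u y ((hfeas₂ y).2 ⟨hy, hyr⟩) (hyt.trans htx₂.le)
  exact absurd htx₂ (not_lt.2 (h1 ▸ hyt))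

end SampledProblems

/-! ### Measurability of violation -/

section Measurability

variable {dZ dR n : ℕ} {Q : Type*} [MeasurableSpace Q] {J : Type}

lemma measurableSet_exists_mem_compact {X Ω : Type*} [TopologicalSpace X]
    [SecondCountableTopology X] [MeasurableSpace Ω] {C : Set X} (hC : IsCompact C)
    {g : X → Ω → ℝ} (hg : ∀ x, Measurable (g x)) (hg' : ∀ ω, Continuous fun x => g x ω) :
    MeasurableSet {ω | ∃ x ∈ C, g x ω ≤ 0} := by
  obtain ⟨D, hD, hDd⟩ := TopologicalSpace.exists_countable_dense C
  have h1 : {ω | ∃ x ∈ C, g x ω ≤ 0} =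
      ⋂ k : ℕ, ⋃ x ∈ D, {ω | g x ω < 1 / ((k : ℝ) + 1)} := by
    ext ω
    simp only [Set.mem_ofPred_eq, Set.mem_iInter, Set.mem_iUnion, exists_prop]
    constructor
    · rintro ⟨x, hx, hxg⟩ k
      have hopen : IsOpen {y : C | g y ω < 1 / ((k : ℝ) + 1)} :=
        isOpen_lt ((hg' ω).comp continuous_subtype_val) continuous_const
      obtain ⟨y, hy, hyD⟩ := hDd.inter_open_nonempty _ hopen
        ⟨⟨x, hx⟩, hxg.trans_lt Nat.one_div_pos_of_nat⟩
      exact ⟨y, hyD, hy⟩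
    · intro h
      obtain ⟨y, -, -⟩ := h 0
      obtain ⟨x, hx, hmin⟩ := hC.exists_isMinOn ⟨y, y.2⟩ (hg' ω).continuousOn
      refine ⟨x, hx, ?_⟩
      by_contra! hpos
      obtain ⟨k, hk⟩ := exists_nat_one_div_lt hpos
      obtain ⟨z, -, hz⟩ := h k
      exact absurd (hmin z.2) (not_le.2 (hz.trans hk))
  rw [h1]
  exact MeasurableSet.iInter fun k => MeasurableSet.biUnion hD fun x _ =>
    measurableSet_lt (hg x) measurable_const

lemma measurableSet_exists_mem_mixedIntegerSet {Ω : Type*} [MeasurableSpace Ω]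
    {g : MixedSpace dZ dR → Ω → ℝ} (hg : ∀ x, Measurable (g x))
    (hg' : ∀ ω, Continuous fun x => g x ω) (c : MixedSpace dZ dR) (t : ℝ) :
    MeasurableSet {ω | ∃ x ∈ mixedIntegerSet dZ dR, g x ω ≤ 0 ∧ c ⬝ᵥ x ≤ t} := by
  have h1 : {ω | ∃ x ∈ mixedIntegerSet dZ dR, g x ω ≤ 0 ∧ c ⬝ᵥ x ≤ t} =
      ⋃ k : ℕ, {ω | ∃ x ∈ Metric.closedBall 0 (k : ℝ) ∩ (mixedIntegerSet dZ dR ∩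
        {x | c ⬝ᵥ x ≤ t}), g x ω ≤ 0} := by
    ext ω
    simp only [Set.mem_ofPred_eq, Set.mem_iUnion]
    constructor
    · rintro ⟨x, hxS, hxg, hxt⟩
      obtain ⟨k, hk⟩ := exists_nat_ge ‖x‖
      exact ⟨k, x, ⟨mem_closedBall_zero_iff.2 hk, hxS, hxt⟩, hxg⟩
    · rintro ⟨k, x, ⟨-, hxS, hxt⟩, hxg⟩
      exact ⟨x, hxS, hxg, hxt⟩
  rw [h1]
  refine MeasurableSet.iUnion fun k => measurableSet_exists_mem_compact ?_ hg hg'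
  refine (isCompact_closedBall _ _).inter_right ((isClosed_mixedIntegerSet dZ dR).inter ?_)
  exact isClosed_le (continuous_const.dotProduct continuous_id) continuous_const

variable {f : Fin n → MixedSpace dZ dR → Q → ℝ}

lemma measurableSet_constraint_eq (hf : ∀ i q, Continuous fun x => f i x q)
    (hmeas : ∀ i x, Measurable (f i x)) (i : Fin n) {Ω : Type*} [MeasurableSpace Ω]
    {u v : Ω → Q} (hu : Measurable u) (hv : Measurable v) :
    MeasurableSet {ω | (fun x => f i x (u ω)) = fun x => f i x (v ω)} := by
  obtain ⟨D, hD, hDd⟩ := TopologicalSpace.exists_countable_dense (MixedSpace dZ dR)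
  have h1 : {ω | (fun x => f i x (u ω)) = fun x => f i x (v ω)} =
      ⋂ x ∈ D, {ω | f i x (u ω) = f i x (v ω)} := by
    ext ω
    simp only [Set.mem_ofPred_eq, Set.mem_iInter]
    constructor
    · exact fun h x _ => congrFun h x
    · exact fun h => Continuous.ext_on hDd (hf i _) (hf i _) h
  rw [h1]
  exact MeasurableSet.biInter hD fun x _ =>
    measurableSet_eq_fun ((hmeas i x).comp hu) ((hmeas i x).comp hv)

lemma measurableSet_le_ncard_constraintTypes (hf : ∀ i q, Continuous fun x => f i x q)
    (hmeas : ∀ i x, Measurable (f i x)) (i : Fin n) (B : Finset J) (d : ℕ) :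
    MeasurableSet {q : J → Q | d ≤ (constraintTypes f i q B).ncard} := by
  classical
  have h1 : {q : J → Q | d ≤ (constraintTypes f i q B).ncard} =
      ⋃ s ∈ B.powerset.filter fun s => d ≤ s.card, ⋂ k ∈ s, ⋂ l ∈ s.erase k,
        {q : J → Q | (fun x => f i x (q k)) = fun x => f i x (q l)}ᶜ := by
    ext q
    simp only [Set.mem_ofPred_eq, Set.mem_iUnion, Set.mem_iInter, exists_prop, Finset.mem_filter,
      Finset.mem_powerset, Set.mem_compl_iff, Finset.mem_erase]
    constructor
    · intro h
      obtain ⟨s, hsB, hinj, himg⟩ := Set.SurjOn.exists_subset_injOn_image_eq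
        (Set.surjOn_image (fun k x => f i x (q k)) (B : Set J))
      have hs : s.Finite := B.finite_toSet.subset hsB
      refine ⟨hs.toFinset, ⟨fun k hk => hsB (hs.mem_toFinset.1 hk), ?_⟩, ?_⟩
      · rw [← Set.ncard_eq_toFinset_card s hs, ← hinj.ncard_image, himg]
        exact h
      · intro k hk l hl hkl
        exact hl.1 (hinj (hs.mem_toFinset.1 hl.2) (hs.mem_toFinset.1 hk) hkl.symm)
    · rintro ⟨s, ⟨hsB, hds⟩, hs⟩
      refine hds.trans ?_
      have hinj : Set.InjOn (fun k x => f i x (q k)) (s : Set J) := by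
        intro k hk l hl hkl
        by_contra hne
        exact hs k hk l ⟨Ne.symm hne, hl⟩ hkl
      rw [← Set.ncard_coe_finset, ← hinj.ncard_image]
      exact Set.ncard_le_ncard (Set.image_mono hsB) (B.finite_toSet.image _)
  rw [h1]
  refine Finset.measurableSet_biUnion _ fun s _ => Finset.measurableSet_biInter _ fun k _ =>
    Finset.measurableSet_biInter _ fun l _ => MeasurableSet.compl ?_
  exact measurableSet_constraint_eq hf hmeas i (measurable_pi_apply k) (measurable_pi_apply l)

lemma sum_max_zero_nonpos_iff [Fintype J] (g : J → ℝ) :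
    ∑ k, max (g k) 0 ≤ 0 ↔ ∀ k, g k ≤ 0 := by
  rw [(Finset.sum_nonneg fun k _ => le_max_right (g k) 0).ge_iff_eq',
    Finset.sum_eq_zero_iff_of_nonneg fun k _ => le_max_right (g k) 0]
  simp

lemma measurableSet_violationSet [Fintype J] (hf : ∀ i q, Continuous fun x => f i x q)
    (hmeas : ∀ i x, Measurable (f i x)) (d : ℕ) (c : MixedSpace dZ dR) (a : J → Fin n)
    (B : Finset J) (i : Fin n) : MeasurableSet (violationSet d c f a B i) := by
  have hfeas : ∀ q x, x ∈ feasibleSet f a q Finset.univ ↔ x ∈ mixedIntegerSet dZ dR ∧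
      ∑ k, max (f (a k) x (q k)) 0 ≤ 0 := by
    intro q x
    rw [sum_max_zero_nonpos_iff]
    simp [feasibleSet]
  have hsum : ∀ x, Measurable fun q : J → Q => ∑ k, max (f (a k) x (q k)) 0 := fun x =>
    Finset.measurable_sum _ fun k _ =>
      ((hmeas (a k) x).comp (measurable_pi_apply k)).max measurable_const
  have hsum' : ∀ q : J → Q, Continuous fun x => ∑ k, max (f (a k) x (q k)) 0 := fun q =>
    continuous_finsetSum _ fun k _ => (hf (a k) (q k)).max continuous_const
  have hA : MeasurableSet {z : (J → Q) × Q | d ≤ (constraintTypes f i z.1 B).ncard} :=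
    measurable_fst (measurableSet_le_ncard_constraintTypes hf hmeas i B d)
  have hB : ∀ t : ℚ, MeasurableSet {z : (J → Q) × Q |
      ∃ x ∈ feasibleSet f a z.1 Finset.univ, c ⬝ᵥ x ≤ t} := by
    intro t
    have h1 := measurableSet_exists_mem_mixedIntegerSet hsum hsum' c t
    convert measurable_fst (β := Q) h1 using 1
    ext z
    simp only [hfeas, Set.mem_ofPred_eq, Set.mem_preimage, and_assoc]
  have hC : ∀ t : ℚ, MeasurableSet {z : (J → Q) × Q |
      ∃ x ∈ feasibleSet f a z.1 Finset.univ, f i x z.2 ≤ 0 ∧ c ⬝ᵥ x ≤ t} := by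
    intro t
    have h1 := measurableSet_exists_mem_mixedIntegerSet (Ω := (J → Q) × Q)
      (g := fun x z => max (∑ k, max (f (a k) x (z.1 k)) 0) (f i x z.2))
      (fun x => ((hsum x).comp measurable_fst).max ((hmeas i x).comp measurable_snd))
      (fun z => (hsum' z.1).max (hf i z.2)) c t
    convert h1 using 1
    ext z
    simp only [hfeas, Set.mem_ofPred_eq, max_le_iff, and_assoc]
  have hD : MeasurableSet {z : (J → Q) × Q |
      (fun x => f i x z.2) ∈ constraintTypes f i z.1 B} := by
    have h1 : {z : (J → Q) × Q | (fun x => f i x z.2) ∈ constraintTypes f i z.1 B} =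
        ⋃ k ∈ B, {z | (fun x => f i x (z.1 k)) = fun x => f i x z.2} := by
      ext z
      simp [constraintTypes]
    rw [h1]
    exact Finset.measurableSet_biUnion _ fun k _ => measurableSet_constraint_eq hf hmeas i
      ((measurable_pi_apply k).comp measurable_fst) measurable_snd
  have h1 : violationSet d c f a B i =
      ({z : (J → Q) × Q | d ≤ (constraintTypes f i z.1 B).ncard} ∩ ⋃ t : ℚ,
        {z : (J → Q) × Q | ∃ x ∈ feasibleSet f a z.1 Finset.univ, c ⬝ᵥ x ≤ t} ∩
        {z : (J → Q) × Q | ∃ x ∈ feasibleSet f a z.1 Finset.univ,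
          f i x z.2 ≤ 0 ∧ c ⬝ᵥ x ≤ t}ᶜ) ∪
      ({z : (J → Q) × Q | d ≤ (constraintTypes f i z.1 B).ncard}ᶜ ∩
        {z : (J → Q) × Q | (fun x => f i x z.2) ∈ constraintTypes f i z.1 B}ᶜ) := by
    ext z
    simp [violationSet]
  rw [h1]
  exact (hA.inter (MeasurableSet.iUnion fun t => (hB t).inter (hC t).compl)).union
    (hA.compl.inter hD.compl)

end Measurability

/-! ### The probability of violation -/

section Probability

variable {dZ dR n : ℕ} {Q : Type*} [MeasurableSpace Q] {J : Type} [Fintype J]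
variable {μ : Measure Q} [IsProbabilityMeasure μ] {c : MixedSpace dZ dR}
variable {f : Fin n → MixedSpace dZ dR → Q → ℝ}

lemma ae_uniquelySolvable (huniq : UniqueMinimumPoints μ c f) (a : J → Fin n) :
    ∀ᵐ q ∂(Measure.pi fun _ : J => μ), UniquelySolvable (mixedHelly dZ dR - 1) c f a q := by
  classical
  have h1 : ∀ T : Finset J, ∀ᵐ q ∂(Measure.pi fun _ : J => μ), ∀ (B : Finset J) (i : Fin n),
      B ⊆ T → (∀ k ∈ B, a k = i) → mixedHelly dZ dR - 1 ≤ (constraintTypes f i q B).ncard →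
      ∃ x ∈ feasibleSet f a q T, ∀ y ∈ feasibleSet f a q T, c ⬝ᵥ y ≤ c ⬝ᵥ x → y = x := by
    intro T
    let m : Fin n → ℕ := fun i => Fintype.card {k : T // a k = i}
    let e : (Σ i : Fin n, Fin (m i)) ≃ T :=
      (Equiv.sigmaCongrRight fun i => (Fintype.equivFin {k : T // a k = i}).symm).trans
        (Equiv.sigmaFiberEquiv fun k : T => a k)
    have hae : ∀ p, a (e p) = p.1 := fun p =>
      ((Fintype.equivFin {k : T // a k = p.1}).symm p.2).2
    have hinj : Function.Injective fun p => (e p : J) := Subtype.val_injective.comp e.injective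
    filter_upwards [(measurePreserving_comp_injective μ hinj).quasiMeasurePreserving.ae (huniq m)]
      with q hq B i hBT hBi hd
    have hfeas : ∀ x, x ∈ sampledConstraint f m (q ∘ fun p => (e p : J)) ∩ mixedIntegerSet dZ dR ↔
        x ∈ feasibleSet f a q T := by
      intro x
      constructor
      · rintro ⟨hx, hxS⟩
        refine ⟨hxS, fun k hk => ?_⟩
        obtain ⟨p, hp⟩ := e.surjective ⟨k, hk⟩
        have h2 : f p.1 x (q (e p)) ≤ 0 := (Set.mem_iInter₂.1 hx p.1 p.2).2
        rwa [← hae, hp] at h2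
      · intro hx
        refine ⟨Set.mem_iInter₂.2 fun i l => ⟨hx.1, ?_⟩, hx.1⟩
        have h2 := hx.2 (e ⟨i, l⟩) (e ⟨i, l⟩).2
        rwa [hae] at h2
    have hcard : mixedHelly dZ dR - 1 ≤
        (Set.range fun p => (p.1, (q ∘ fun p => (e p : J)) p)).ncard := by
      refine hd.trans ?_
      refine le_trans ?_ (Set.ncard_image_le (f := fun z : Fin n × Q => fun x => f i x z.2)
        (Set.finite_range _))
      refine Set.ncard_le_ncard ?_ ((Set.finite_range _).image _)
      rintro _ ⟨k, hk, rfl⟩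
      exact ⟨_, ⟨e.symm ⟨k, hBT hk⟩, rfl⟩, by simp⟩
    obtain ⟨x, hx, hxu⟩ := hq hcard
    refine ⟨x, (hfeas x).1 hx.1, fun y hy hyx => hxu y ⟨(hfeas y).2 hy, fun z hz => ?_⟩⟩
    exact hyx.trans (hx.2 z hz)
  filter_upwards [ae_all_iff.2 h1] with q hq T B i
  exact hq T B i

lemma exists_perm_image_eq {α β : Type*} [Fintype α] [Fintype β] [DecidableEq α] [DecidableEq β]
    (R : Finset (α ⊕ β)) (hR : R.card = Fintype.card α) :
    ∃ e : Equiv.Perm (α ⊕ β), R = Finset.univ.image fun k : α => e (Sum.inl k) := by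
  have hcard : ((Finset.univ : Finset α).image (Sum.inl : α → α ⊕ β)).card = R.card := by
    rw [Finset.card_image_of_injective _ Sum.inl_injective, Finset.card_univ, hR]
  let e := (Finset.equivOfCardEq hcard).extendSubtype
  refine ⟨e, (Finset.eq_of_subset_of_card_le (Finset.image_subset_iff.2 fun k _ => ?_) ?_).symm⟩
  · exact (Finset.equivOfCardEq hcard).extendSubtype_mem _
      (Finset.mem_image_of_mem _ (Finset.mem_univ k))
  · exact le_of_eq (hR.trans ((Finset.card_image_of_injective _
      (e.injective.comp Sum.inl_injective)).trans Finset.card_univ).symm)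

/-- If almost surely at most `C` of finitely many events occur, their probabilities add up to at
most `C`. -/
lemma sum_measureReal_le_of_ae {Ω ι : Type*} [MeasurableSpace Ω] {P : Measure Ω}
    [IsProbabilityMeasure P] (s : Finset ι) {A : ι → Set Ω} (hA : ∀ r, MeasurableSet (A r)) {C : ℕ}
    (h : ∀ᵐ ω ∂P, {r | r ∈ s ∧ ω ∈ A r}.ncard ≤ C) : ∑ r ∈ s, P.real (A r) ≤ C := by
  classical
  have h1 : ∑ r ∈ s, P.real (A r) = ∫ ω, ∑ r ∈ s, (A r).indicator (1 : Ω → ℝ) ω ∂P := by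
    refine Eq.trans ?_ (integral_finsetSum _ fun r _ =>
      (integrable_const (1 : ℝ)).indicator (hA r)).symm
    exact Finset.sum_congr rfl fun r _ => (integral_indicator_one (hA r)).symm
  rw [h1]
  have h2 : ∫ _, (C : ℝ) ∂P = C := by simp
  rw [← h2]
  refine integral_mono_ae (integrable_finsetSum _ fun r _ =>
    (integrable_const (1 : ℝ)).indicator (hA r)) (integrable_const _) ?_
  filter_upwards [h] with ω hω
  have h3 : ∑ r ∈ s, (A r).indicator (1 : Ω → ℝ) ω = ({r | r ∈ s ∧ ω ∈ A r}.ncard : ℝ) := by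
    have h4 : {r | r ∈ s ∧ ω ∈ A r} = ((s.filter fun r => ω ∈ A r : Finset ι) : Set ι) := by
      ext r
      simp
    rw [h4, Set.ncard_coe_finset]
    simp [Set.indicator_apply]
  rw [h3]
  exact_mod_cast hω

lemma choose_mul_measure_count_le (hconv : ∀ i q, ConvexOn ℝ Set.univ fun x => f i x q)
    (hmeas : ∀ i x, Measurable (f i x)) (huniq : UniqueMinimumPoints μ c f) {d : ℕ}
    (hd : mixedHelly dZ dR = d + 1) (a : J → Fin n) (B : Finset J) (i : Fin n)
    (hB : ∀ k ∈ B, a k = i) {L v : ℕ} (hv : 0 < v) (hvN : v ≤ B.card + L) (hdB : d ≤ B.card) :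
    ((B.card + L).choose B.card : ℝ) *
      ((Measure.pi fun _ : J => μ).prod (Measure.pi fun _ : Fin L => μ)).real
        {z | v ≤ {l | (z.1, z.2 l) ∈ violationSet d c f a B i}.ncard} ≤
      (sparseCount d (B.card + L) v B.card : ℝ) := by
  classical
  have hperm : ∀ R : Finset (B ⊕ Fin L), ∃ e : Equiv.Perm (B ⊕ Fin L), R.card = B.card →
      R = Finset.univ.image fun k : B => e (Sum.inl k) := by
    intro R
    by_cases hR : R.card = B.card
    · obtain ⟨e, he⟩ := exists_perm_image_eq R (by rw [hR, Fintype.card_coe])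
      exact ⟨e, fun _ => he⟩
    · exact ⟨1, fun h => absurd h hR⟩
  choose e he using hperm
  have hV := measurableSet_violationSet (fun i q => continuous_of_convexOn (hconv i q)) hmeas d c a
    B i
  have hE := measurableSet_le_ncard hV L v
  -- by exchangeability, the event has the same probability after each of the rearrangements `σ R`
  let σ : Finset (B ⊕ Fin L) → Equiv.Perm (J ⊕ Fin L) := fun R =>
    (e R).viaEmbedding (sampleEmbedding B L)
  let F : Finset (B ⊕ Fin L) → (J ⊕ Fin L → Q) → (J → Q) × (Fin L → Q) := fun R w =>
    (fun k => w (σ R (Sum.inl k)), fun l => w (σ R (Sum.inr l)))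
  have hF : ∀ R, MeasurePreserving (F R) (Measure.pi fun _ => μ)
      ((Measure.pi fun _ : J => μ).prod (Measure.pi fun _ : Fin L => μ)) := fun R =>
    (measurePreserving_sumPiEquivProdPi fun _ : J ⊕ Fin L => μ).comp
      (measurePreserving_comp_injective μ (σ R).injective)
  have hsum := sum_measureReal_le_of_ae (P := Measure.pi fun _ : J ⊕ Fin L => μ)
    (Finset.univ.powersetCard B.card : Finset (Finset (B ⊕ Fin L)))
    (A := fun R => F R ⁻¹' {z | v ≤ {l | (z.1, z.2 l) ∈ violationSet d c f a B i}.ncard})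
    (fun R => (hF R).measurable hE) (C := sparseCount d (B.card + L) v B.card) (by
      have h1 := ae_uniquelySolvable huniq (Sum.elim a fun _ : Fin L => i)
      rw [hd, Nat.add_sub_cancel] at h1
      filter_upwards [h1] with w hw
      exact card_rearrangements_le hconv hd a B i hB hv hvN hdB e he w hw)
  rw [Finset.sum_congr rfl fun R _ => (hF R).measureReal_preimage hE.nullMeasurableSet,
    Finset.sum_const, Finset.card_powersetCard, Finset.card_univ, Fintype.card_sum,
    Fintype.card_coe, Fintype.card_fin, nsmul_eq_mul] at hsum
  exact hsum

lemma binomialTail_eq_one {d M : ℕ} (h : M < d) (ε : ℝ) : binomialTail (d + 1) M ε = 1 := by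
  have h1 : ∑ l ∈ Finset.range (M + 1), (M.choose l : ℝ) * ε ^ l * (1 - ε) ^ (M - l) = 1 := by
    have h2 := add_pow ε (1 - ε) M
    rw [add_sub_cancel, one_pow] at h2
    refine Eq.trans (Finset.sum_congr rfl fun l _ => ?_) h2.symm
    ring
  rw [binomialTail, Nat.add_sub_cancel]
  refine Eq.trans ?_ h1
  refine (Finset.sum_subset (Finset.range_subset_range.2 h) fun l _ hl => ?_).symm
  rw [Finset.mem_range, not_lt] at hl
  rw [Nat.choose_eq_zero_of_lt (by omega)]
  simp

/-- The probability that the samples of a single agent lead to a violation probability of more than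
`ε` is at most the binomial tail. -/
theorem measure_violation_le (hconv : ∀ i q, ConvexOn ℝ Set.univ fun x => f i x q)
    (hmeas : ∀ i x, Measurable (f i x)) (huniq : UniqueMinimumPoints μ c f) {d : ℕ}
    (hd : mixedHelly dZ dR = d + 1) (a : J → Fin n) (B : Finset J) (i : Fin n)
    (hB : ∀ k ∈ B, a k = i) {ε : ℝ} (hε : 0 < ε) (hε1 : ε ≤ 1) :
    (Measure.pi fun _ : J => μ).real {q | ε < μ.real {r | (q, r) ∈ violationSet d c f a B i}} ≤
      binomialTail (d + 1) B.card ε := by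
  obtain hlt | hdB := lt_or_ge B.card d
  · -- for fewer than `d` samples the tail is the full binomial sum
    rw [binomialTail_eq_one hlt]
    exact measureReal_le_one
  have hV := measurableSet_violationSet (fun i q => continuous_of_convexOn (hconv i q)) hmeas d c a
    B i
  have hlevel : ∀ ε', ε < ε' → (Measure.pi fun _ : J => μ).real
      {q | ε' ≤ μ.real {r | (q, r) ∈ violationSet d c f a B i}} ≤
        binomialTail (d + 1) B.card ε := by
    intro ε' hεε'
    refine le_binomialTail_of_le_sparseCount hdB hε hε1 (C := 1 / (ε' - ε) ^ 2) fun L hL => ?_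
    have hv : 0 < ⌈ε * L⌉₊ := Nat.ceil_pos.2 (by positivity)
    have hvN : ⌈ε * L⌉₊ ≤ B.card + L := by
      refine (Nat.ceil_le.2 ?_).trans (Nat.le_add_left L B.card)
      exact mul_le_of_le_one_left (Nat.cast_nonneg L) hε1
    have h1 := measure_mul_le_measure_count μ (Measure.pi fun _ : J => μ) hV hεε' hL
    have h2 := choose_mul_measure_count_le hconv hmeas huniq hd a B i hB hv hvN hdB
    rw [mul_comm] at h2
    exact (mul_le_mul_of_nonneg_right h1 (Nat.cast_nonneg _)).trans h2
  -- the event is the increasing union of the level sets for `ε + 1 / (k + 1)`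
  have hunion : {q : J → Q | ε < μ.real {r | (q, r) ∈ violationSet d c f a B i}} =
      ⋃ k : ℕ, {q | ε + 1 / ((k : ℝ) + 1) ≤ μ.real {r | (q, r) ∈ violationSet d c f a B i}} := by
    ext q
    simp only [Set.mem_ofPred_eq, Set.mem_iUnion]
    constructor
    · intro h
      obtain ⟨k, hk⟩ := exists_nat_one_div_lt (sub_pos.2 h)
      exact ⟨k, by linarith⟩
    · rintro ⟨k, hk⟩
      have : 0 < 1 / ((k : ℝ) + 1) := Nat.one_div_pos_of_nat
      linarith
  have hmono : Monotone fun k : ℕ => {q : J → Q |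
      ε + 1 / ((k : ℝ) + 1) ≤ μ.real {r | (q, r) ∈ violationSet d c f a B i}} := by
    intro k k' hkk' q hq
    have : 1 / ((k' : ℝ) + 1) ≤ 1 / ((k : ℝ) + 1) := Nat.one_div_le_one_div hkk'
    exact le_trans (add_le_add_right this ε) hq
  have hlim := tendsto_measure_iUnion_atTop (μ := Measure.pi fun _ : J => μ) hmono
  rw [← hunion] at hlim
  refine le_of_tendsto' ((ENNReal.tendsto_toReal (measure_ne_top _ _)).comp hlim) fun k => ?_
  exact hlevel _ (lt_add_of_pos_right ε Nat.one_div_pos_of_nat)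

end Probability

theorem lemma1 {dZ dR n : ℕ} {Q : Type*} [MeasurableSpace Q]
    (μ : Measure Q) [IsProbabilityMeasure μ]
    (c : MixedSpace dZ dR) (f : Fin n → MixedSpace dZ dR → Q → ℝ)
    (hconv : ∀ i q, ConvexOn ℝ Set.univ fun x => f i x q)
    (hmeas : ∀ i x, Measurable (f i x))
    (huniq : UniqueMinimumPoints μ c f)
    (ε δ : Fin n → ℝ) (hε : ∀ i, 0 < ε i) (hδ : ∀ i, 0 < δ i)
    (Mscen : Fin n → ℕ)
    (hM : ∀ i, IsLeast {M : ℕ | binomialTail (mixedHelly dZ dR) M (ε i) ≤ δ i} (Mscen i))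
    (xstar : MultiSample Mscen Q → MixedSpace dZ dR)
    (hx : ∀ᵐ q ∂(multiSampleMeasure Mscen μ),
      IsOptimalSolution c (sampledConstraint f Mscen q) (xstar q)) :
    1 - ∑ i, δ i ≤
      (multiSampleMeasure Mscen μ).real
        {q | μ.real {r | xstar q ∉ ⋂ i, constraintSet f i r} ≤ ∑ i, ε i} := by
  classical
  obtain ⟨d, hd⟩ : ∃ d, mixedHelly dZ dR = d + 1 :=
    ⟨mixedHelly dZ dR - 1, (Nat.succ_pred_eq_of_pos (mixedHelly_pos dZ dR)).symm⟩
  let J := Σ i : Fin n, Fin (Mscen i)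
  let a : J → Fin n := Sigma.fst
  let ρ : Measure (J → Q) := Measure.pi fun _ => μ
  have hρ : multiSampleMeasure Mscen μ = ρ := rfl
  rw [hρ] at hx ⊢
  let B : Fin n → Finset J := fun i => Finset.univ.map ⟨Sigma.mk i, sigma_mk_injective⟩
  have hB : ∀ i, ∀ k ∈ B i, a k = i := by
    intro i k hk
    obtain ⟨l, -, rfl⟩ := Finset.mem_map.1 hk
    rfl
  have hBcard : ∀ i, (B i).card = Mscen i := fun i => by
    rw [Finset.card_map, Finset.card_univ, Fintype.card_fin]
  have hcont : ∀ i q, Continuous fun x => f i x q := fun i q => continuous_of_convexOn (hconv i q)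
  let V : Fin n → Set ((J → Q) × Q) := fun i => violationSet d c f a (B i) i
  have hV : ∀ i, MeasurableSet (V i) := fun i => measurableSet_violationSet hcont hmeas d c a (B i) i
  let bad : Fin n → Set (J → Q) := fun i => {q | ε i < μ.real {r | (q, r) ∈ V i}}
  have hbadm : ∀ i, MeasurableSet (bad i) := fun i =>
    measurableSet_lt measurable_const (measurable_measure_prodMk_left (hV i)).ennreal_toReal
  have hbad : ∀ i, ρ.real (bad i) ≤ δ i := by
    intro i
    obtain hε1 | hε1 := le_or_gt (ε i) 1
    · refine (measure_violation_le hconv hmeas huniq hd a (B i) i (hB i) (hε i) hε1).trans ?_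
      rw [hBcard, ← hd]
      exact (hM i).1
    · have hempty : bad i = ∅ := Set.eq_empty_of_forall_notMem fun q hq =>
        absurd (hε1.trans hq) (not_lt.2 measureReal_le_one)
      rw [hempty, measureReal_empty]
      exact (hδ i).le
  -- almost surely, the problems with one further sample are uniquely solvable as well
  have hsolv : ∀ i, ∀ᵐ q ∂ρ, ∀ᵐ r ∂μ, UniquelySolvable d c f (Sum.elim a fun _ : Unit => i)
      (Sum.elim q fun _ => r) := by
    intro i
    have h1 := ae_uniquelySolvable huniq (Sum.elim a fun _ : Unit => i)
    rw [hd, Nat.add_sub_cancel] at h1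
    have h2 := (measurePreserving_sumPiEquivProdPi_symm
      fun _ : J ⊕ Unit => μ).quasiMeasurePreserving.ae h1
    filter_upwards [Measure.ae_ae_of_ae_prod h2] with q hq
    filter_upwards [(measurePreserving_funUnique μ Unit).symm.quasiMeasurePreserving.ae hq] with r hr
    convert hr using 1
    ext (k | k) <;> rfl
  have hgood : ∀ᵐ q ∂ρ, q ∈ (⋃ i, bad i)ᶜ →
      q ∈ {q | μ.real {r | xstar q ∉ ⋂ i, constraintSet f i r} ≤ ∑ i, ε i} := by
    filter_upwards [hx, ae_all_iff.2 hsolv] with q hq hqs hqb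
    have hfeas : ∀ x, x ∈ sampledConstraint f Mscen q ∩ mixedIntegerSet dZ dR ↔
        x ∈ feasibleSet f a q Finset.univ := by
      intro x
      constructor
      · exact fun h => ⟨h.2, fun k _ => (Set.mem_iInter₂.1 h.1 k.1 k.2).2⟩
      · exact fun h => ⟨Set.mem_iInter₂.2 fun i l => ⟨h.1, h.2 ⟨i, l⟩ (Finset.mem_univ _)⟩, h.1⟩
    have hsub : ∀ᵐ r ∂μ, xstar q ∉ ⋂ i, constraintSet f i r → r ∈ ⋃ i, {r | (q, r) ∈ V i} := by
      filter_upwards [ae_all_iff.2 hqs] with r hr hxr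
      rw [Set.mem_iInter, not_forall] at hxr
      obtain ⟨i, hi⟩ := hxr
      have hxq := (hfeas _).1 hq.1
      refine Set.mem_iUnion.2 ⟨i, mem_violationSet (hB i) (hr i) hxq
        (fun y hy => hq.2 y ((hfeas y).2 hy)) fun hle => hi ⟨hxq.1, hle⟩⟩
    calc μ.real {r | xstar q ∉ ⋂ i, constraintSet f i r}
        ≤ μ.real (⋃ i, {r | (q, r) ∈ V i}) :=
          ENNReal.toReal_mono (measure_ne_top _ _) (measure_mono_ae hsub)
      _ ≤ ∑ i, μ.real {r | (q, r) ∈ V i} := measureReal_iUnion_fintype_le _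
      _ ≤ ∑ i, ε i := Finset.sum_le_sum fun i _ =>
          not_lt.1 fun h => hqb (Set.mem_iUnion.2 ⟨i, h⟩)
  have h1 : ρ.real (⋃ i, bad i) ≤ ∑ i, δ i :=
    (measureReal_iUnion_fintype_le _).trans (Finset.sum_le_sum fun i _ => hbad i)
  have h2 := probReal_compl_eq_one_sub (μ := ρ) (MeasurableSet.iUnion hbadm)
  have h3 : ρ.real (⋃ i, bad i)ᶜ ≤
      ρ.real {q | μ.real {r | xstar q ∉ ⋂ i, constraintSet f i r} ≤ ∑ i, ε i} :=
    ENNReal.toReal_mono (measure_ne_top _ _) (measure_mono_ae hgood)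
  linarith
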